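/- Let $n\ge 3$ be an integer, let $p>1$ be real, and put $2^*=\frac{2n}{n-2}$. Consider the Schrödinger–Poisson type system $$-\Delta u=\sqrt p\,u^{p-1}v,\qquad -\Delta v=\sqrt p\,u^{p},\qquad u>0,\ v>0\quad\text{in }\mathbb R^n, \tag{S}$$ whose positive solutions are understood in the classical sense, $u,v\in C^2(\mathbb R^n)$, and, for constants $c_1,c_2>0$, the integral system with Newton potentials $$u(x)=c_1\int_{\mathbb R^n}\frac{u^{p-1}(y)v(y)}{|x-y|^{n-2}}\,dy,\qquad v(x)=c_2\int_{\mathbb R^n}\frac{u^{p}(y)}{|x-y|^{n-2}}\,dy,\qquad u>0,\ v>0,\quad\text{for all }x\in\mathbb R^n, \tag{I}$$ whose positive solutions are measurable functions $u,v:\mathbb R^n\to(0,\infty)$ for which the integrals are finite and the equations hold at every $x$. (1) If $p\le\frac{n}{n-2}$, then (S) has no positive solution, and, for all $c_1,c_2>0$, (I) has no positive solution. (2) If $2\le p<2^*-1$, then (S) has no positive solution $(u,v)$ with $u\in L^{\frac{n(p-1)}{2}}(\mathbb R^n)$, and, for all $c_1,c_2>0$, (I) has no positive solution $(u,v)$ with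 $u\in L^{\frac{n(p-1)}{2}}(\mathbb R^n)$. -/

import Mathlib

/-- `(u, v)` is a positive classical solution on the whole space `ℝⁿ` of the Schrödinger-Poisson
type system `-Δu = √p u^(p-1) v`, `-Δv = √p u^p`. -/
structure IsPositiveClassicalSolution (n : ℕ) (p : ℝ)
    (u v : EuclideanSpace ℝ (Fin n) → ℝ) : Prop where
  contDiff_left : ContDiff ℝ 2 u
  contDiff_right : ContDiff ℝ 2 v
  pos_left : ∀ x, 0 < u x
  pos_right : ∀ x, 0 < v x
  eq_left : ∀ x, -(Laplacian.laplacian u x) = Real.sqrt p * (u x ^ (p - 1) * v x)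
  eq_right : ∀ x, -(Laplacian.laplacian v x) = Real.sqrt p * u x ^ p

/-- `(u, v)` is a positive solution on the whole space `ℝⁿ` (for `n ≥ 3`) of the integral system
with Newton potentials `u = c₁ |·|^(2-n) * (u^(p-1) v)`, `v = c₂ |·|^(2-n) * u^p`.
That the integrals are finite at every point is part of being a solution. -/
structure IsPositiveIntegralSolution (n : ℕ) (p c₁ c₂ : ℝ)
    (u v : EuclideanSpace ℝ (Fin n) → ℝ) : Prop where
  measurable_left : Measurable u
  measurable_right : Measurable v
  pos_left : ∀ x, 0 < u x
  pos_right : ∀ x, 0 < v x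
  integrable_left : ∀ x, MeasureTheory.Integrable
    (fun y => u y ^ (p - 1) * v y / ‖x - y‖ ^ (n - 2)) MeasureTheory.volume
  integrable_right : ∀ x, MeasureTheory.Integrable
    (fun y => u y ^ p / ‖x - y‖ ^ (n - 2)) MeasureTheory.volume
  eq_left : ∀ x, u x = c₁ * ∫ y, u y ^ (p - 1) * v y / ‖x - y‖ ^ (n - 2)
  eq_right : ∀ x, v x = c₂ * ∫ y, u y ^ p / ‖x - y‖ ^ (n - 2)

/-! The core is a Liouville theorem for continuous positive pairs u = a + c I(u^(p-1) v), v = b + d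
I(u^p) with a, b ≥ 0, where I is the Newton potential: by `IsPotentialPair.elim` none exists for 1 <
p < 2* - 1. The method is that of moving spheres in integral form. Folding the integral across the
sphere of radius lam writes U minus its Kelvin transform as an integral over the exterior, of a
difference of densities against a nonnegative kernel (`sub_kelvin_eq`). Subcriticality gives the
reflected density a factor (lam/‖z‖)^τ < 1, so the comparison "U dominates its Kelvin transform"
reproduces itself with a strict gain. It holds for small lam, and it can always be pushed beyond any
radius already reached: away from the sphere by the strict gain, near it by the narrow region
principle `exists_narrow`. Hence it holds for all radii and all centres. Letting spheres open up to
a hyperplane between two points shows that u is constant, but the Newton potential of a positive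
constant diverges.

Classical solutions enter through `exists_newton_representation`: a nonnegative superharmonic
function is a nonnegative constant plus a multiple of the Newton potential of minus its Laplacian.
This comes from weighted ball means, whose limit at infinity does not depend on the centre.

Integral solutions are only measurable. If p ≤ n/(n-2), then m = min(u, v) satisfies m ≥ c I(m^p),
and the mass of m^p on balls would be bounded and yet grow by a fixed amount with each doubling of
the radius (`no_positive_supersolution`). If p is larger, the integrability assumption says that V =
u^(p-1) lies in L^(n/2). By the Hardy-Littlewood-Sobolev inequality, u = c I(V I(V u)) is then a
contraction up to a harmless term (`regularity_lifting`); so u and v have enough integrability to be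
continuous, and the core theorem applies with a = b = 0. -/

open MeasureTheory Metric Set Filter Topology
open scoped ENNReal

/-- The Euclidean space `ℝⁿ`. -/
abbrev Euc (n : ℕ) := EuclideanSpace ℝ (Fin n)

/-! ### The Newton kernel -/

/-- The Newton kernel `|x - y|^(2-n)`, with the value `0` on the diagonal. -/
noncomputable def newton {n : ℕ} (x y : Euc n) : ℝ := (‖x - y‖ ^ (n - 2))⁻¹

section Kernel

variable {n : ℕ}

lemma newton_nonneg (x y : Euc n) : 0 ≤ newton x y := by unfold newton; positivity

lemma newton_sub_right (x y : Euc n) : newton x y = newton 0 (y - x) := by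
  simp [newton, norm_sub_rev x]

lemma newton_add (x y z : Euc n) : newton (x + z) (y + z) = newton x y := by
  simp [newton]

lemma measurable_newton_right (x : Euc n) : Measurable (fun y => newton x y) := by
  unfold newton; fun_prop

lemma newton_le_of_le {r : ℝ} (hr : 0 < r) {x y : Euc n} (h : r ≤ ‖x - y‖) :
    newton x y ≤ (r ^ (n - 2))⁻¹ := by
  unfold newton; gcongr

lemma le_newton_of_le {r : ℝ} {x y : Euc n} (hxy : x ≠ y) (h : ‖x - y‖ ≤ r) :
    (r ^ (n - 2))⁻¹ ≤ newton x y := by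
  have := norm_pos_iff.2 (sub_ne_zero.2 hxy)
  unfold newton; gcongr

/-- The value 0 on the diagonal breaks the lower bounds for the kernel, so kernels are compared off
one point, which is a null set. -/
lemma ae_ne_point (hn : 3 ≤ n) (x : Euc n) : ∀ᵐ y : Euc n, y ≠ x := by
  have : Nontrivial (Euc n) := Module.nontrivial_of_finrank_pos (R := ℝ) (by simp; omega)
  exact (Set.countable_singleton x).ae_notMem volume

lemma integrableOn_newton_ball (hn : 3 ≤ n) (r : ℝ) :
    IntegrableOn (fun y : Euc n => newton 0 y) (ball 0 r) := by
  refine integrableOn_ball_of_norm_le_rpow (C := 1) (α := (n : ℝ) - 2) (by simp; omega)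
    (by simp) (Eventually.of_forall fun y => ?_) (measurable_newton_right 0).aestronglyMeasurable
  have h2 : ((n : ℝ) - 2) = ((n - 2 : ℕ) : ℝ) := by push_cast [show 2 ≤ n by omega]; ring
  rw [Real.norm_of_nonneg (newton_nonneg _ _), h2, Real.rpow_neg (norm_nonneg _),
    Real.rpow_natCast]
  simp [newton]

lemma lintegral_newton_shift (x : Euc n) (E : Set (Euc n)) :
    ∫⁻ y in E, ENNReal.ofReal (newton x y) =
      ∫⁻ y in (fun y => y + x) ⁻¹' E, ENNReal.ofReal (newton 0 y) := by
  have := (measurePreserving_add_right volume x).setLIntegral_comp_preimage_emb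
    (MeasurableEquiv.addRight x).measurableEmbedding
    (fun y => ENNReal.ofReal (newton x y)) E
  rw [← this]
  refine lintegral_congr fun y => ?_
  rw [newton_sub_right x]; simp

/-- The potential of a set of small measure is uniformly small. -/
lemma exists_lintegral_newton_le (hn : 3 ≤ n) {ε : ℝ} (hε : 0 < ε) :
    ∃ δ : ℝ, 0 < δ ∧ ∀ E : Set (Euc n), MeasurableSet E →
      volume E ≤ ENNReal.ofReal δ → ∀ x, ∫⁻ y in E, ENNReal.ofReal (newton x y) ≤ ENNReal.ofReal ε := by
  have hfin : ∫⁻ y in ball (0 : Euc n) 1, ENNReal.ofReal (newton 0 y) ≠ ⊤ :=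
    ((hasFiniteIntegral_iff_ofReal (Eventually.of_forall fun y => newton_nonneg _ _)).1
      (integrableOn_newton_ball hn 1).2).ne
  have hε2 : ENNReal.ofReal (ε / 2) ≠ 0 := by simpa using hε
  obtain ⟨δ₁, hδ₁, h⟩ := exists_pos_setLIntegral_lt_of_measure_lt hfin hε2
  obtain ⟨δ₂, hδ₂, hδ₂'⟩ : ∃ δ : ℝ, 0 < δ ∧ ENNReal.ofReal δ < δ₁ := by
    obtain ⟨d, hd0, hd⟩ := exists_between hδ₁
    refine ⟨d.toReal, ENNReal.toReal_pos hd0.ne' (hd.trans_le le_top).ne, ?_⟩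
    rwa [ENNReal.ofReal_toReal (hd.trans_le le_top).ne]
  -- After translation to x = 0, the part of E in the unit ball is controlled by absolute continuity
  -- of the integral (δ₂); outside the kernel is at most 1, so the measure itself suffices (ε / 2).
  refine ⟨min δ₂ (ε / 2), by positivity, fun E hEm hE x => ?_⟩
  rw [lintegral_newton_shift]
  set E' := (fun y => y + x) ⁻¹' E
  have hE' : volume E' ≤ ENNReal.ofReal (min δ₂ (ε / 2)) := by
    rwa [measure_preimage_add_right]
  have h1 : ∫⁻ y in E' ∩ ball 0 1, ENNReal.ofReal (newton 0 y) ≤ ENNReal.ofReal (ε / 2) := by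
    have hlt : (volume.restrict (ball (0 : Euc n) 1)) E' < δ₁ :=
      ((Measure.restrict_apply_le _ _).trans hE').trans_lt
        ((ENNReal.ofReal_le_ofReal (min_le_left _ _)).trans_lt hδ₂')
    have := (h E' hlt).le
    rwa [Measure.restrict_restrict₀' measurableSet_ball.nullMeasurableSet] at this
  have h2 : ∫⁻ y in E' \ ball 0 1, ENNReal.ofReal (newton 0 y) ≤ ENNReal.ofReal (ε / 2) := by
    calc ∫⁻ y in E' \ ball 0 1, ENNReal.ofReal (newton 0 y)
        ≤ ∫⁻ y in E' \ ball 0 1, 1 := by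
          refine setLIntegral_mono' ((hEm.preimage (measurable_add_const x)).diff
            measurableSet_ball) fun y hy => ?_
          have := newton_le_of_le one_pos (x := 0) (y := y) (by simpa using hy.2)
          simpa using this
      _ ≤ volume E' := by simp; exact measure_mono sdiff_subset
      _ ≤ _ := hE'.trans (ENNReal.ofReal_le_ofReal (min_le_right _ _))
  calc _ ≤ _ := lintegral_mono_set (show E' ⊆ (E' ∩ ball 0 1) ∪ (E' \ ball 0 1) by simp)
    _ ≤ _ := lintegral_union_le _ _ _
    _ ≤ ENNReal.ofReal (ε / 2) + ENNReal.ofReal (ε / 2) := add_le_add h1 h2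
    _ = _ := by rw [← ENNReal.ofReal_add (by positivity) (by positivity)]; simp

end Kernel

/-! ### Inversion and the Kelvin transform of the kernel -/

/-- Inversion in the sphere of radius `lam` about the origin. -/
noncomputable def sphInv {n : ℕ} (lam : ℝ) (y : Euc n) : Euc n :=
  EuclideanGeometry.inversion 0 lam y

/-- The Kelvin transform of `u` in the sphere of radius `lam` about the origin. -/
noncomputable def kelvin {n : ℕ} (lam : ℝ) (u : Euc n → ℝ) (y : Euc n) : ℝ :=
  (lam / ‖y‖) ^ (n - 2) * u (sphInv lam y)

/-- The difference of the Newton kernel and its Kelvin transform. -/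
noncomputable def kelvinKernel {n : ℕ} (lam : ℝ) (y z : Euc n) : ℝ :=
  newton y z - kelvin lam (fun w => newton w z) y

section Inversion

variable {n : ℕ} {lam : ℝ}

lemma sphInv_eq (lam : ℝ) (y : Euc n) : sphInv lam y = (lam / ‖y‖) ^ 2 • y := by
  simp [sphInv, EuclideanGeometry.inversion]

lemma norm_sphInv (lam : ℝ) (y : Euc n) : ‖sphInv lam y‖ = lam ^ 2 / ‖y‖ := by
  simpa [sphInv] using EuclideanGeometry.dist_inversion_center (0 : Euc n) y lam

lemma sphInv_sphInv (h : lam ≠ 0) (y : Euc n) : sphInv lam (sphInv lam y) = y :=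
  EuclideanGeometry.inversion_inversion 0 h y

lemma sphInv_ne_zero (h : lam ≠ 0) {y : Euc n} (hy : y ≠ 0) : sphInv lam y ≠ 0 := by
  intro h0; exact hy ((EuclideanGeometry.inversion_eq_center h).1 h0)

lemma norm_sphInv_sub_sphInv {y z : Euc n} (hy : y ≠ 0) (hz : z ≠ 0) :
    ‖sphInv lam y - sphInv lam z‖ = lam ^ 2 / (‖y‖ * ‖z‖) * ‖y - z‖ := by
  simpa [sphInv, dist_eq_norm] using EuclideanGeometry.dist_inversion_inversion hy hz lam

lemma norm_sphInv_sub_mul {y z : Euc n} (hy : y ≠ 0) (hz : z ≠ 0) :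
    ‖sphInv lam y - z‖ * ‖y‖ = ‖y - sphInv lam z‖ * ‖z‖ := by
  simpa [sphInv, dist_eq_norm] using EuclideanGeometry.dist_inversion_mul_dist_center_eq (R := lam) hy hz

/-- The two distances entering the Kelvin kernel. -/
lemma sq_norm_sphInv_sub (h : lam ≠ 0) {y z : Euc n} (hy : y ≠ 0) :
    (‖y‖ / lam * ‖sphInv lam y - z‖) ^ 2 =
      ‖y - z‖ ^ 2 + (‖y‖ ^ 2 - lam ^ 2) * (‖z‖ ^ 2 - lam ^ 2) / lam ^ 2 := by
  have hy' : ‖y‖ ≠ 0 := norm_ne_zero_iff.2 hy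
  rw [mul_pow, sphInv_eq, @norm_sub_sq_real, @norm_sub_sq_real, norm_smul, inner_smul_left]
  simp only [norm_pow, norm_div, Real.norm_eq_abs, abs_norm, mul_pow, div_pow, sq_abs,
    conj_trivial, ← pow_mul]
  field_simp
  ring

lemma kelvin_newton_eq {y z : Euc n} (hy : y ≠ 0) :
    kelvin lam (fun w => newton w z) y = ((‖y‖ / lam * ‖sphInv lam y - z‖) ^ (n - 2))⁻¹ := by
  have hy' : ‖y‖ ≠ 0 := norm_ne_zero_iff.2 hy
  rw [kelvin, newton, mul_pow, mul_inv, ← inv_pow (‖y‖ / lam), inv_div]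

/-- Reflecting the source point exchanges the kernel and its Kelvin transform, up to a power of ‖z‖
/ lam. With `kelvin_newton_sphInv`, this symmetry is what makes the folded integrals combine into a
product. -/
lemma newton_sphInv_right (h : 0 < lam) {y z : Euc n} (hy : y ≠ 0) (hz : z ≠ 0) :
    newton y (sphInv lam z) = (‖z‖ / lam) ^ (n - 2) * kelvin lam (fun w => newton w z) y := by
  have hy' : 0 < ‖y‖ := norm_pos_iff.2 hy
  have hz' : 0 < ‖z‖ := norm_pos_iff.2 hz
  have e : ‖y - sphInv lam z‖ = (lam / ‖z‖) * (‖y‖ / lam * ‖sphInv lam y - z‖) := by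
    have := norm_sphInv_sub_mul (lam := lam) hy hz
    field_simp; linarith
  rw [kelvin_newton_eq hy, newton, e, mul_pow, mul_inv, ← inv_pow (lam / ‖z‖), inv_div]

lemma kelvin_newton_sphInv (h : 0 < lam) {y z : Euc n} (hy : y ≠ 0) (hz : z ≠ 0) :
    kelvin lam (fun w => newton w (sphInv lam z)) y = (‖z‖ / lam) ^ (n - 2) * newton y z := by
  have hy' : 0 < ‖y‖ := norm_pos_iff.2 hy
  have hz' : 0 < ‖z‖ := norm_pos_iff.2 hz
  have e : ‖y‖ / lam * ‖sphInv lam y - sphInv lam z‖ = (lam / ‖z‖) * ‖y - z‖ := by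
    rw [norm_sphInv_sub_sphInv hy hz]; field_simp
  rw [kelvin_newton_eq hy, newton, e, mul_pow, mul_inv, ← inv_pow (lam / ‖z‖), inv_div]

lemma kelvin_newton_nonneg (h : 0 < lam) (y z : Euc n) :
    0 ≤ kelvin lam (fun w => newton w z) y :=
  mul_nonneg (by positivity) (newton_nonneg _ _)

lemma kelvinKernel_le (h : 0 < lam) (y z : Euc n) : kelvinKernel lam y z ≤ newton y z :=
  sub_le_self _ (kelvin_newton_nonneg h y z)

/-- By `sq_norm_sphInv_sub` the squared reflected distance exceeds ‖y - z‖² by a product of two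
factors which are both nonnegative outside the sphere. The case z = y is excluded because of the
value 0 on the diagonal. -/
lemma kelvinKernel_nonneg (h : 0 < lam) {y z : Euc n} (hyz : z ≠ y) (hy : lam ≤ ‖y‖)
    (hz : lam ≤ ‖z‖) : 0 ≤ kelvinKernel lam y z := by
  have hy0 : y ≠ 0 := norm_pos_iff.1 (h.trans_le hy)
  have hd : 0 < ‖y - z‖ := norm_pos_iff.2 (sub_ne_zero.2 hyz.symm)
  rw [kelvinKernel, kelvin_newton_eq hy0, newton, sub_nonneg]
  gcongr
  refine le_of_sq_le_sq ?_ (by positivity)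
  rw [sq_norm_sphInv_sub h.ne' hy0, le_add_iff_nonneg_right]
  have h1 : 0 ≤ ‖y‖ ^ 2 - lam ^ 2 := by nlinarith
  have h2 : 0 ≤ ‖z‖ ^ 2 - lam ^ 2 := by nlinarith
  positivity

/-- Lower bound of the Kelvin kernel for `z` in an annulus and `y` away from the sphere. -/
lemma exists_le_kelvinKernel (hn : 3 ≤ n) (h : 0 < lam) {δ : ℝ} (hδ : 0 < δ) :
    ∃ c : ℝ, 0 < c ∧ ∀ y z : Euc n, z ≠ y → lam + δ ≤ ‖y‖ → lam + 1 ≤ ‖z‖ → ‖z‖ ≤ lam + 2 →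
      c * (‖y‖ ^ (n - 2))⁻¹ ≤ kelvinKernel lam y z := by
  -- C₁ gives ‖y - z‖ ≤ C₁ ‖y‖, and c₂ ‖y‖² is a lower bound for the excess in `sq_norm_sphInv_sub`.
  -- So the reflected distance is at least ρ > 1 times ‖y - z‖, with the same ρ for all y up to
  -- infinity.
  set C₁ : ℝ := 1 + (lam + 2) / lam
  have hC₁ : 0 < C₁ := by positivity
  set c₂ : ℝ := (1 - lam ^ 2 / (lam + δ) ^ 2) * (((lam + 1) ^ 2 - lam ^ 2) / lam ^ 2)
  have hc₀ : 0 < 1 - lam ^ 2 / (lam + δ) ^ 2 := by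
    rw [sub_pos, div_lt_one (by positivity)]; nlinarith
  have hc₁ : 0 < ((lam + 1) ^ 2 - lam ^ 2) / lam ^ 2 := by
    apply div_pos _ (by positivity); nlinarith
  have hc₂ : 0 < c₂ := mul_pos hc₀ hc₁
  set ρ : ℝ := √(1 + c₂ / C₁ ^ 2)
  have hρ : 1 < ρ := by
    rw [Real.lt_sqrt (by norm_num)]
    have : 0 < c₂ / C₁ ^ 2 := by positivity
    linarith
  have hρ0 : 0 < ρ := one_pos.trans hρ
  have hρ2 : ρ ^ 2 = 1 + c₂ / C₁ ^ 2 := Real.sq_sqrt (by positivity)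
  refine ⟨(1 - ρ⁻¹) * (C₁ ^ (n - 2))⁻¹, mul_pos (sub_pos.2 (inv_lt_one_of_one_lt₀ hρ))
    (by positivity), fun y z hzy hy hz1 hz2 => ?_⟩
  have hy0 : 0 < ‖y‖ := by linarith
  have hA : 0 < ‖y - z‖ := norm_pos_iff.2 (sub_ne_zero.2 hzy.symm)
  have hA1 : ‖y - z‖ ≤ C₁ * ‖y‖ := by
    have h1 := norm_sub_le y z
    have h2 : lam + 2 ≤ (lam + 2) / lam * ‖y‖ := by
      rw [div_mul_eq_mul_div, le_div_iff₀ h]; gcongr; linarith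
    simp only [C₁, add_mul, one_mul]; linarith
  set B := ‖y‖ / lam * ‖sphInv lam y - z‖ with hB
  have hB2 : B ^ 2 = ‖y - z‖ ^ 2 + (‖y‖ ^ 2 - lam ^ 2) * (‖z‖ ^ 2 - lam ^ 2) / lam ^ 2 :=
    sq_norm_sphInv_sub h.ne' (norm_pos_iff.1 hy0)
  have hX : c₂ * ‖y‖ ^ 2 ≤ (‖y‖ ^ 2 - lam ^ 2) * (‖z‖ ^ 2 - lam ^ 2) / lam ^ 2 := by
    have e1 : (1 - lam ^ 2 / (lam + δ) ^ 2) * ‖y‖ ^ 2 ≤ ‖y‖ ^ 2 - lam ^ 2 := by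
      have : lam ^ 2 ≤ lam ^ 2 / (lam + δ) ^ 2 * ‖y‖ ^ 2 := by
        rw [div_mul_eq_mul_div, le_div_iff₀ (by positivity)]; gcongr
      linarith
    have e2 : ((lam + 1) ^ 2 - lam ^ 2) / lam ^ 2 ≤ (‖z‖ ^ 2 - lam ^ 2) / lam ^ 2 := by gcongr
    calc c₂ * ‖y‖ ^ 2 = ((1 - lam ^ 2 / (lam + δ) ^ 2) * ‖y‖ ^ 2) *
          (((lam + 1) ^ 2 - lam ^ 2) / lam ^ 2) := by ring
      _ ≤ (‖y‖ ^ 2 - lam ^ 2) * ((‖z‖ ^ 2 - lam ^ 2) / lam ^ 2) :=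
          mul_le_mul e1 e2 hc₁.le ((by positivity : (0 : ℝ) ≤ _).trans e1)
      _ = _ := by ring
  have hBA : ρ * ‖y - z‖ ≤ B := by
    refine le_of_sq_le_sq ?_ (by positivity)
    rw [mul_pow, hρ2, hB2, add_mul, one_mul]
    gcongr
    refine le_trans ?_ hX
    calc c₂ / C₁ ^ 2 * ‖y - z‖ ^ 2 ≤ c₂ / C₁ ^ 2 * (C₁ * ‖y‖) ^ 2 := by gcongr
      _ = c₂ * ‖y‖ ^ 2 := by field_simp
  have hBn : (B ^ (n - 2))⁻¹ ≤ ρ⁻¹ * (‖y - z‖ ^ (n - 2))⁻¹ := by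
    rw [← mul_inv]
    gcongr
    calc ρ * ‖y - z‖ ^ (n - 2) ≤ ρ ^ (n - 2) * ‖y - z‖ ^ (n - 2) := by
          gcongr; exact le_self_pow₀ hρ.le (by omega)
      _ = (ρ * ‖y - z‖) ^ (n - 2) := (mul_pow _ _ _).symm
      _ ≤ B ^ (n - 2) := by gcongr
  rw [kelvinKernel, kelvin_newton_eq (norm_pos_iff.1 hy0), newton]
  calc (1 - ρ⁻¹) * (C₁ ^ (n - 2))⁻¹ * (‖y‖ ^ (n - 2))⁻¹
      = (1 - ρ⁻¹) * ((C₁ * ‖y‖) ^ (n - 2))⁻¹ := by rw [mul_pow, mul_inv, mul_assoc]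
    _ ≤ (1 - ρ⁻¹) * (‖y - z‖ ^ (n - 2))⁻¹ := by
        have := (sub_pos.2 (inv_lt_one_of_one_lt₀ hρ)).le
        gcongr
    _ ≤ _ := by rw [sub_mul, one_mul]; exact sub_le_sub_left hBn _

/-- The derivative of an inversion is a multiple of a reflection; this gives the Jacobian
(lam/‖z‖)^(2n). -/
lemma abs_det_smul_reflection (c : ℝ) (K : Submodule ℝ (Euc n)) :
    |((c • (K.reflection : Euc n →L[ℝ] Euc n)) : Euc n →L[ℝ] Euc n).det| = |c| ^ n := by
  have h1 : ((c • (K.reflection : Euc n →L[ℝ] Euc n)) : Euc n →L[ℝ] Euc n).det =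
      LinearMap.det (c • K.reflection.toLinearMap) := rfl
  rw [h1, LinearMap.det_smul, K.det_reflection, abs_mul, abs_pow, abs_pow, abs_neg, abs_one,
    one_pow, mul_one, finrank_euclideanSpace_fin]

lemma sphInv_image (h : 0 < lam) :
    (sphInv lam : Euc n → Euc n) '' {z | lam < ‖z‖} = ball 0 lam \ {0} := by
  ext w
  simp only [mem_image, mem_ofPred_eq, Set.mem_sdiff, mem_ball_zero_iff, mem_singleton_iff]
  constructor
  · rintro ⟨z, hz, rfl⟩
    have hz0 : 0 < ‖z‖ := h.trans hz
    refine ⟨?_, sphInv_ne_zero h.ne' (norm_pos_iff.1 hz0)⟩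
    rw [norm_sphInv, div_lt_iff₀ hz0]; nlinarith
  · rintro ⟨hw, hw0⟩
    have hw' := norm_pos_iff.2 hw0
    refine ⟨sphInv lam w, ?_, sphInv_sphInv h.ne' w⟩
    rw [norm_sphInv, lt_div_iff₀ hw']; nlinarith

lemma hasFDerivWithinAt_sphInv (h : 0 < lam) : ∀ z ∈ {z : Euc n | lam < ‖z‖},
    HasFDerivWithinAt (sphInv lam) (((lam / ‖z‖) ^ 2 •
      ((ℝ ∙ (z - 0))ᗮ.reflection : Euc n →L[ℝ] Euc n))) {z | lam < ‖z‖} z := by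
  intro z hz
  have hz0 : z ≠ 0 := norm_pos_iff.1 (h.trans hz)
  have := (EuclideanGeometry.hasFDerivAt_inversion (R := lam) hz0).hasFDerivWithinAt
    (s := {z | lam < ‖z‖})
  rw [dist_zero_right] at this
  exact this

lemma isOpen_exterior (lam : ℝ) : IsOpen {z : Euc n | lam < ‖z‖} :=
  isOpen_lt continuous_const continuous_norm

lemma sphInv_injOn (h : 0 < lam) (s : Set (Euc n)) : InjOn (sphInv lam) s :=
  (EuclideanGeometry.inversion_injective 0 h.ne').injOn

lemma ball_diff_zero_ae_eq (hn : 3 ≤ n) :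
    (ball (0 : Euc n) lam \ {0} : Set (Euc n)) =ᵐ[volume] ball 0 lam := by
  filter_upwards [ae_ne_point hn 0] with y hy
  apply propext
  exact ⟨fun h => h.1, fun h => ⟨h, hy⟩⟩

lemma integrableOn_exterior_of_integrable (h : 0 < lam) {f : Euc n → ℝ} (hf : Integrable f) :
    IntegrableOn (fun z => (lam / ‖z‖) ^ (2 * n) * f (sphInv lam z)) {z | lam < ‖z‖} := by
  have := (integrableOn_image_iff_integrableOn_abs_det_fderiv_smul volume
    (isOpen_exterior lam).measurableSet (hasFDerivWithinAt_sphInv h) (sphInv_injOn h _) f).1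
    hf.integrableOn
  refine this.congr_fun (fun z _ => ?_) (isOpen_exterior lam).measurableSet
  simp only [abs_det_smul_reflection, smul_eq_mul]
  rw [abs_of_nonneg (by positivity), ← pow_mul]

/-- Folding an integral over the whole space into one over the exterior of a ball. -/
lemma integral_eq_integral_exterior (hn : 3 ≤ n) (h : 0 < lam) {f : Euc n → ℝ}
    (hf : Integrable f) :
    ∫ z, f z = ∫ z in {z | lam < ‖z‖}, (f z + (lam / ‖z‖) ^ (2 * n) * f (sphInv lam z)) := by
  -- Inversion maps the exterior onto the punctured ball; the centre and the sphere are null sets.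
  have h1 : ∫ z in ball (0 : Euc n) lam, f z =
      ∫ z in {z | lam < ‖z‖}, (lam / ‖z‖) ^ (2 * n) * f (sphInv lam z) := by
    rw [← setIntegral_congr_set (ball_diff_zero_ae_eq hn), ← sphInv_image h,
      integral_image_eq_integral_abs_det_fderiv_smul volume
      (isOpen_exterior lam).measurableSet (hasFDerivWithinAt_sphInv h) (sphInv_injOn h _) f]
    refine setIntegral_congr_fun (isOpen_exterior lam).measurableSet fun z _ => ?_
    simp only [abs_det_smul_reflection, smul_eq_mul]
    rw [abs_of_nonneg (by positivity), ← pow_mul]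
  have h2 : ({z : Euc n | lam < ‖z‖} : Set (Euc n)) =ᵐ[volume] (ball 0 lam)ᶜ := by
    have h0 : ∀ᵐ z : Euc n, z ∉ sphere (0 : Euc n) lam :=
      measure_eq_zero_iff_ae_notMem.1 (Measure.addHaar_sphere_of_ne_zero volume 0 h.ne')
    filter_upwards [h0] with z hz
    apply propext
    change lam < ‖z‖ ↔ z ∈ (ball 0 lam)ᶜ
    simp only [mem_sphere_iff_norm, sub_zero] at hz
    simp only [mem_compl_iff, mem_ball_zero_iff, not_lt]
    exact ⟨le_of_lt, fun h' => lt_of_le_of_ne h' (Ne.symm hz)⟩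
  rw [integral_add hf.integrableOn (integrableOn_exterior_of_integrable h hf), ← h1,
    setIntegral_congr_set h2, add_comm]
  exact (integral_add_compl measurableSet_ball hf).symm

end Inversion

/-! ### Folding potentials across a sphere -/

/-- The density whose potential is the Kelvin transform of the potential of `f`. -/
noncomputable def kelvinDensity {n : ℕ} (lam : ℝ) (f : Euc n → ℝ) (z : Euc n) : ℝ :=
  (lam / ‖z‖) ^ (n + 2) * f (sphInv lam z)

section Difference

variable {n : ℕ} {lam : ℝ}

/-- The Jacobian contributes the exponent 2n and the reflected kernel takes back n - 2; the
remainder n + 2 is the weight in `kelvinDensity`. -/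
lemma ratio_pow_mul (hn : 3 ≤ n) (h : 0 < lam) {z : Euc n} (hz : z ≠ 0) :
    (lam / ‖z‖) ^ (2 * n) * (‖z‖ / lam) ^ (n - 2) = (lam / ‖z‖) ^ (n + 2) := by
  have hz' : 0 < ‖z‖ := norm_pos_iff.2 hz
  have e : 2 * n = (n + 2) + (n - 2) := by omega
  rw [e, pow_add, mul_assoc, ← mul_pow, div_mul_div_cancel₀ hz'.ne', div_self h.ne', one_pow,
    mul_one]

lemma integrable_mul_kelvin {f : Euc n → ℝ}
    (hf : ∀ x, Integrable (fun z => f z * newton x z)) (y : Euc n) :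
    Integrable (fun z => f z * kelvin lam (fun w => newton w z) y) := by
  refine ((hf (sphInv lam y)).const_mul ((lam / ‖y‖) ^ (n - 2))).congr
    (Eventually.of_forall fun z => ?_)
  simp only [kelvin]; ring

lemma integrableOn_kelvinDensity_mul_kelvin (hn : 3 ≤ n) (h : 0 < lam) {f : Euc n → ℝ}
    (hf : ∀ x, Integrable (fun z => f z * newton x z)) {y : Euc n} (hy : y ≠ 0) :
    IntegrableOn (fun z => kelvinDensity lam f z * kelvin lam (fun w => newton w z) y)
      {z | lam < ‖z‖} := by
  refine (integrableOn_exterior_of_integrable h (hf y)).congr_fun (fun z hz => ?_)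
    (isOpen_exterior lam).measurableSet
  have hz0 : z ≠ 0 := norm_pos_iff.1 (h.trans hz)
  simp only [kelvinDensity, newton_sphInv_right h hy hz0, ← ratio_pow_mul hn h hz0]
  ring

lemma integrableOn_kelvinDensity_mul_newton (hn : 3 ≤ n) (h : 0 < lam) {f : Euc n → ℝ}
    (hf : ∀ x, Integrable (fun z => f z * newton x z)) {y : Euc n} (hy : y ≠ 0) :
    IntegrableOn (fun z => kelvinDensity lam f z * newton y z) {z | lam < ‖z‖} := by
  refine (integrableOn_exterior_of_integrable h
    (integrable_mul_kelvin (lam := lam) hf y)).congr_fun (fun z hz => ?_)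
    (isOpen_exterior lam).measurableSet
  have hz0 : z ≠ 0 := norm_pos_iff.1 (h.trans hz)
  simp only [kelvinDensity, kelvin_newton_sphInv h hy hz0, ← ratio_pow_mul hn h hz0]
  ring

lemma integrableOn_sub_mul_kelvinKernel (hn : 3 ≤ n) (h : 0 < lam) {f : Euc n → ℝ}
    (hf : ∀ x, Integrable (fun z => f z * newton x z)) {y : Euc n} (hy : y ≠ 0) :
    IntegrableOn (fun z => (f z - kelvinDensity lam f z) * kelvinKernel lam y z)
      {z | lam < ‖z‖} := by
  have := (((hf y).integrableOn (s := {z | lam < ‖z‖})).sub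
    (integrable_mul_kelvin (lam := lam) hf y).integrableOn).sub
    ((integrableOn_kelvinDensity_mul_newton hn h hf hy).sub
    (integrableOn_kelvinDensity_mul_kelvin hn h hf hy))
  refine this.congr (Eventually.of_forall fun z => ?_)
  simp only [kelvinKernel, Pi.sub_apply]; ring

/-- The difference of a potential and its Kelvin transform, as an integral over the exterior of
the sphere. -/
lemma sub_kelvin_eq (hn : 3 ≤ n) (h : 0 < lam) {f U : Euc n → ℝ} {a c : ℝ}
    (hf : ∀ x, Integrable (fun z => f z * newton x z))
    (hU : ∀ x, U x = a + c * ∫ z, f z * newton x z) {y : Euc n} (hy : y ≠ 0) :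
    U y - kelvin lam U y = a * (1 - (lam / ‖y‖) ^ (n - 2)) +
      c * ∫ z in {z | lam < ‖z‖}, (f z - kelvinDensity lam f z) * kelvinKernel lam y z := by
  have e1 : ∫ z, f z * newton y z = ∫ z in {z | lam < ‖z‖},
      (f z * newton y z + kelvinDensity lam f z * kelvin lam (fun w => newton w z) y) := by
    rw [integral_eq_integral_exterior hn h (hf y)]
    refine setIntegral_congr_fun (isOpen_exterior lam).measurableSet fun z hz => ?_
    have hz0 : z ≠ 0 := norm_pos_iff.1 (h.trans hz)
    simp only [kelvinDensity, newton_sphInv_right h hy hz0, ← ratio_pow_mul hn h hz0]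
    ring
  have e2 : (lam / ‖y‖) ^ (n - 2) * ∫ z, f z * newton (sphInv lam y) z =
      ∫ z in {z | lam < ‖z‖}, (f z * kelvin lam (fun w => newton w z) y +
        kelvinDensity lam f z * newton y z) := by
    have : (lam / ‖y‖) ^ (n - 2) * ∫ z, f z * newton (sphInv lam y) z =
        ∫ z, f z * kelvin lam (fun w => newton w z) y := by
      rw [← integral_const_mul]
      congr 1; ext z; simp only [kelvin]; ring
    rw [this, integral_eq_integral_exterior hn h (integrable_mul_kelvin hf y)]
    refine setIntegral_congr_fun (isOpen_exterior lam).measurableSet fun z hz => ?_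
    have hz0 : z ≠ 0 := norm_pos_iff.1 (h.trans hz)
    simp only [kelvinDensity, kelvin_newton_sphInv h hy hz0, ← ratio_pow_mul hn h hz0]
    ring
  -- Since folding exchanges the two kernels, the four terms on the exterior factor as a difference
  -- of densities times a difference of kernels.
  have e3 : ∫ z in {z | lam < ‖z‖}, (f z - kelvinDensity lam f z) * kelvinKernel lam y z =
      (∫ z, f z * newton y z) - (lam / ‖y‖) ^ (n - 2) * ∫ z, f z * newton (sphInv lam y) z := by
    rw [e1, e2, ← integral_sub]
    · refine setIntegral_congr_fun (isOpen_exterior lam).measurableSet fun z _ => ?_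
      simp only [kelvinKernel]; ring
    · exact (hf y).integrableOn.add (integrableOn_kelvinDensity_mul_kelvin hn h hf hy)
    · exact (integrable_mul_kelvin hf y).integrableOn.add
        (integrableOn_kelvinDensity_mul_newton hn h hf hy)
  rw [e3, kelvin, hU y, hU (sphInv lam y)]
  ring

/-- One-sided estimate of the defect `kelvin lam U - U` when the density is larger than its Kelvin
transform outside a set `E`. -/
lemma kelvin_sub_le (hn : 3 ≤ n) (h : 0 < lam) {f U : Euc n → ℝ} {a c : ℝ} (ha : 0 ≤ a)
    (hc : 0 < c) (hf : ∀ x, Integrable (fun z => f z * newton x z))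
    (hU : ∀ x, U x = a + c * ∫ z, f z * newton x z) {E : Set (Euc n)} (hE : MeasurableSet E)
    {ε D : ℝ} (hε : 0 ≤ ε) (hD : 0 ≤ D)
    (hEε : ∀ x, ∫⁻ y in E, ENNReal.ofReal (newton x y) ≤ ENNReal.ofReal ε)
    (hout : ∀ z, lam < ‖z‖ → z ∉ E → kelvinDensity lam f z ≤ f z)
    (hin : ∀ z, lam < ‖z‖ → z ∈ E → kelvinDensity lam f z ≤ f z + D)
    {y : Euc n} (hy : lam < ‖y‖) : kelvin lam U y - U y ≤ c * (D * ε) := by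
  have hy0 : y ≠ 0 := norm_pos_iff.1 (h.trans hy)
  have hint : IntegrableOn (fun z => newton y z) E :=
    ⟨(measurable_newton_right y).aestronglyMeasurable,
      (hasFiniteIntegral_iff_ofReal (Eventually.of_forall fun z => newton_nonneg y z)).2
        ((hEε y).trans_lt ENNReal.ofReal_lt_top)⟩
  have hintE : ∫ z in E, newton y z ≤ ε := by
    rw [integral_eq_lintegral_of_nonneg_ae (Eventually.of_forall fun z => newton_nonneg y z)
      (measurable_newton_right y).aestronglyMeasurable]
    exact ENNReal.toReal_le_of_le_ofReal hε (hEε y)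
  have hind : Integrable (fun z => E.indicator (fun z => D * newton y z) z) :=
    (integrable_indicator_iff hE).2 (hint.const_mul D)
  have hpos : ∀ z, 0 ≤ E.indicator (fun z => D * newton y z) z := fun z =>
    indicator_nonneg (fun z _ => mul_nonneg hD (newton_nonneg y z)) z
  -- The integrand is nonnegative off E. On E it is at least -D times the Newton kernel, whose
  -- integral over E is at most ε.
  have key : -(D * ε) ≤
      ∫ z in {z | lam < ‖z‖}, (f z - kelvinDensity lam f z) * kelvinKernel lam y z := by
    calc -(D * ε) ≤ -∫ z in {z | lam < ‖z‖}, E.indicator (fun z => D * newton y z) z := by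
          rw [neg_le_neg_iff]
          calc ∫ z in {z | lam < ‖z‖}, E.indicator (fun z => D * newton y z) z
              ≤ ∫ z, E.indicator (fun z => D * newton y z) z :=
                setIntegral_le_integral hind (Eventually.of_forall hpos)
            _ = D * ∫ z in E, newton y z := by rw [integral_indicator hE, integral_const_mul]
            _ ≤ D * ε := by gcongr
      _ = ∫ z in {z | lam < ‖z‖}, -E.indicator (fun z => D * newton y z) z :=
          (integral_neg _).symm
      _ ≤ _ := by
          refine setIntegral_mono_on_ae hind.neg.integrableOn
            (integrableOn_sub_mul_kelvinKernel hn h hf hy0) (isOpen_exterior lam).measurableSet ?_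
          filter_upwards [ae_ne_point hn y] with z hzy hz
          have hk := kelvinKernel_nonneg h hzy hy.le (le_of_lt hz)
          by_cases hzE : z ∈ E
          · rw [indicator_of_mem hzE]
            have h1 : -D ≤ f z - kelvinDensity lam f z := by linarith [hin z hz hzE]
            calc -(D * newton y z) ≤ -(D * kelvinKernel lam y z) := by
                  gcongr; exact kelvinKernel_le h y z
              _ = -D * kelvinKernel lam y z := by ring
              _ ≤ _ := by gcongr
          · rw [indicator_of_notMem hzE, neg_zero]
            exact mul_nonneg (sub_nonneg.2 (hout z hz hzE)) hk
  have h1 : (lam / ‖y‖) ^ (n - 2) ≤ 1 :=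
    pow_le_one₀ (by positivity) ((div_le_one (h.trans hy)).2 hy.le)
  have h2 := sub_kelvin_eq (lam := lam) hn h hf hU hy0
  -- The additive constant has the favourable sign: a nonnegative constant dominates its Kelvin
  -- transform outside the sphere.
  have h3 : 0 ≤ a * (1 - (lam / ‖y‖) ^ (n - 2)) := mul_nonneg ha (by linarith)
  have h4 := mul_le_mul_of_nonneg_left key hc.le
  linarith

/-- Quantitative strict positivity of `U - kelvin lam U` away from the sphere. -/
lemma exists_le_sub_kelvin (hn : 3 ≤ n) (h : 0 < lam) {f U : Euc n → ℝ} {a c m δ : ℝ} (ha : 0 ≤ a)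
    (hc : 0 < c) (hf : ∀ x, Integrable (fun z => f z * newton x z))
    (hU : ∀ x, U x = a + c * ∫ z, f z * newton x z) (hδ : 0 < δ) (hm : 0 < m)
    (hout : ∀ z, lam < ‖z‖ → kelvinDensity lam f z ≤ f z)
    (hin : ∀ z, lam + 1 ≤ ‖z‖ → ‖z‖ ≤ lam + 2 → m ≤ f z - kelvinDensity lam f z) :
    ∃ c' : ℝ, 0 < c' ∧ ∀ y : Euc n, lam + δ ≤ ‖y‖ →
      c' * (‖y‖ ^ (n - 2))⁻¹ ≤ U y - kelvin lam U y := by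
  obtain ⟨c₀, hc₀, hK⟩ := exists_le_kelvinKernel (n := n) hn h hδ
  -- The integrand over the exterior is nonnegative, so only this annulus is kept: there the density
  -- gap is at least m and the kernel at least c₀ ‖y‖^(2-n).
  set A : Set (Euc n) := {z | lam + 1 ≤ ‖z‖ ∧ ‖z‖ ≤ lam + 2}
  have hAm : MeasurableSet A :=
    (isClosed_le continuous_const continuous_norm).measurableSet.inter
      (isClosed_le continuous_norm continuous_const).measurableSet
  have hAfin : volume A ≠ ⊤ :=
    ((measure_mono (fun z hz => by simpa using hz.2)).trans_lt
      (measure_closedBall_lt_top (x := (0 : Euc n)) (r := lam + 2))).ne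
  have hApos : 0 < volume.real A := by
    have : Nontrivial (Euc n) := Module.nontrivial_of_finrank_pos (R := ℝ) (by simp; omega)
    obtain ⟨z₀, hz₀⟩ := exists_norm_eq (Euc n) (c := lam + 3 / 2) (by positivity)
    have hsub : ball z₀ (1 / 2) ⊆ A := by
      intro z hz
      rw [mem_ball, dist_eq_norm] at hz
      have h1 := abs_le.1 (abs_norm_sub_norm_le z z₀)
      exact ⟨by linarith [h1.1], by linarith [h1.2]⟩
    exact ENNReal.toReal_pos ((measure_ball_pos volume z₀ (by norm_num)).trans_le
      (measure_mono hsub)).ne' hAfin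
  refine ⟨c * (m * (c₀ * volume.real A)), by positivity, fun y hy => ?_⟩
  have hy1 : lam < ‖y‖ := by linarith
  have hy0 : y ≠ 0 := norm_pos_iff.1 (h.trans hy1)
  have hint := integrableOn_sub_mul_kelvinKernel hn h hf hy0
  have hAS : A ⊆ {z | lam < ‖z‖} := fun z hz => by
    have := hz.1
    change lam < ‖z‖; linarith
  have key : volume.real A * (m * (c₀ * (‖y‖ ^ (n - 2))⁻¹)) ≤
      ∫ z in {z | lam < ‖z‖}, (f z - kelvinDensity lam f z) * kelvinKernel lam y z := by
    calc volume.real A * (m * (c₀ * (‖y‖ ^ (n - 2))⁻¹))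
        = ∫ z in A, m * (c₀ * (‖y‖ ^ (n - 2))⁻¹) := by rw [setIntegral_const, smul_eq_mul]
      _ ≤ ∫ z in A, (f z - kelvinDensity lam f z) * kelvinKernel lam y z := by
          refine setIntegral_mono_on_ae (integrableOn_const hAfin) (hint.mono_set hAS) hAm ?_
          filter_upwards [ae_ne_point hn y] with z hzy hz
          have := hin z hz.1 hz.2
          exact mul_le_mul this (hK y z hzy hy hz.1 hz.2) (by positivity) (hm.le.trans this)
      _ ≤ _ := by
          refine setIntegral_mono_set hint ?_ (LE.le.eventuallyLE hAS)
          refine (ae_restrict_iff' (isOpen_exterior lam).measurableSet).2 ?_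
          filter_upwards [ae_ne_point hn y] with z hzy hz
          exact mul_nonneg (sub_nonneg.2 (hout z hz)) (kelvinKernel_nonneg h hzy hy1.le (le_of_lt hz))
  have h1 : (lam / ‖y‖) ^ (n - 2) ≤ 1 :=
    pow_le_one₀ (by positivity) ((div_le_one (h.trans hy1)).2 hy1.le)
  have h2 := sub_kelvin_eq (lam := lam) hn h hf hU hy0
  have h3 : 0 ≤ a * (1 - (lam / ‖y‖) ^ (n - 2)) := mul_nonneg ha (by linarith)
  have h4 := mul_le_mul_of_nonneg_left key hc.le
  linarith

end Difference

/-! ### The system and its nonlinearity -/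

/-- `(u, v)` is a continuous positive solution of the integral system
`u = a + c |·|^(2-n) * (u^(p-1) v)`, `v = b + d |·|^(2-n) * u^p`. -/
structure IsPotentialPair (n : ℕ) (p a b c d : ℝ) (u v : Euc n → ℝ) : Prop where
  nonneg_a : 0 ≤ a
  nonneg_b : 0 ≤ b
  pos_c : 0 < c
  pos_d : 0 < d
  continuous_left : Continuous u
  continuous_right : Continuous v
  pos_left : ∀ x, 0 < u x
  pos_right : ∀ x, 0 < v x
  integrable_left : ∀ x, Integrable (fun z => u z ^ (p - 1) * v z * newton x z)
  integrable_right : ∀ x, Integrable (fun z => u z ^ (p - 1) * u z * newton x z)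
  eq_left : ∀ x, u x = a + c * ∫ z, u z ^ (p - 1) * v z * newton x z
  eq_right : ∀ x, v x = b + d * ∫ z, u z ^ (p - 1) * u z * newton x z

/-- Subcriticality of the exponent, as positivity of the scaling defect. -/
noncomputable def scalingDefect (n : ℕ) (p : ℝ) : ℝ := (n + 2) - (n - 2) * p

section Nonlinearity

variable {n : ℕ} {lam p : ℝ}

lemma kelvin_pos (h : 0 < lam) {u : Euc n → ℝ} (hu : ∀ x, 0 < u x) {z : Euc n} (hz : z ≠ 0) :
    0 < kelvin lam u z := by
  have := norm_pos_iff.2 hz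
  have := hu (sphInv lam z)
  unfold kelvin; positivity

/-- The density is homogeneous of degree p in (u, v), so the Kelvin weights of u and v account for
(n - 2) p of the exponent n + 2. What is left is `scalingDefect`, which vanishes exactly at the
critical exponent. -/
lemma kelvinDensity_eq (hn : 3 ≤ n) (h : 0 < lam) {u v : Euc n → ℝ} (hu : ∀ x, 0 < u x)
    {z : Euc n} (hz : z ≠ 0) :
    kelvinDensity lam (fun z => u z ^ (p - 1) * v z) z =
      (lam / ‖z‖) ^ scalingDefect n p * (kelvin lam u z ^ (p - 1) * kelvin lam v z) := by
  have hz' := norm_pos_iff.2 hz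
  have ht : 0 < lam / ‖z‖ := by positivity
  have hn2 : ((n - 2 : ℕ) : ℝ) = (n : ℝ) - 2 := by push_cast [show 2 ≤ n by omega]; ring
  have e : (lam / ‖z‖) ^ (n + 2) = (lam / ‖z‖) ^ scalingDefect n p *
      (((lam / ‖z‖) ^ (n - 2)) ^ (p - 1) * (lam / ‖z‖) ^ (n - 2)) := by
    rw [← Real.rpow_natCast (lam / ‖z‖) (n - 2), ← Real.rpow_natCast (lam / ‖z‖) (n + 2),
      ← Real.rpow_mul ht.le, ← Real.rpow_add ht, ← Real.rpow_add ht, hn2, scalingDefect]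
    congr 1; push_cast; ring
  simp only [kelvinDensity, kelvin]
  rw [Real.mul_rpow (by positivity) (hu _).le, e]
  ring

lemma kelvinDensity_le (hn : 3 ≤ n) (h : 0 < lam) (hp : 0 < scalingDefect n p)
    {u v : Euc n → ℝ} (hu : ∀ x, 0 < u x) (hv : ∀ x, 0 < v x) {z : Euc n} (hz : lam < ‖z‖) :
    kelvinDensity lam (fun z => u z ^ (p - 1) * v z) z ≤
      kelvin lam u z ^ (p - 1) * kelvin lam v z := by
  have hz0 : z ≠ 0 := norm_pos_iff.1 (h.trans hz)
  rw [kelvinDensity_eq hn h hu hz0]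
  have h1 : (lam / ‖z‖) ^ scalingDefect n p ≤ 1 :=
    Real.rpow_le_one (by positivity) ((div_le_one (h.trans hz)).2 hz.le) hp.le
  have := kelvin_pos h hu hz0
  have := kelvin_pos h hv hz0
  exact mul_le_of_le_one_left (by positivity) h1

/-- Lipschitz bound for `x ^ r` on a compact interval of positive numbers. -/
lemma exists_rpow_sub_le {m M : ℝ} (hm : 0 < m) (r : ℝ) (hr : 0 < r) :
    ∃ L : ℝ, 0 ≤ L ∧ ∀ s t, m ≤ s → s ≤ t → t ≤ M → t ^ r - s ^ r ≤ L * (t - s) := by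
  refine ⟨r * (m ^ (r - 1) + |M| ^ (r - 1)), by positivity, fun s t hs hst ht => ?_⟩
  rcases hst.eq_or_lt with rfl | hlt
  · simp
  have hs0 : 0 < s := hm.trans_le hs
  obtain ⟨x, hx, hxe⟩ := exists_deriv_eq_slope (fun x : ℝ => x ^ r) hlt
    (fun x hx => (Real.continuousAt_rpow_const x r
      (Or.inl (hs0.trans_le hx.1).ne')).continuousWithinAt)
    (fun x hx => (Real.differentiableAt_rpow_const_of_ne r
      (hs0.trans hx.1).ne').differentiableWithinAt)
  have hx0 : 0 < x := hs0.trans hx.1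
  rw [Real.deriv_rpow_const, eq_div_iff (sub_pos.2 hlt).ne'] at hxe
  rw [← hxe]
  have hMx : x ≤ |M| := (hx.2.le.trans ht).trans (le_abs_self M)
  have : x ^ (r - 1) ≤ m ^ (r - 1) + |M| ^ (r - 1) := by
    have p1 : 0 ≤ m ^ (r - 1) := by positivity
    have p2 : 0 ≤ |M| ^ (r - 1) := by positivity
    rcases le_total 0 (r - 1) with h0 | h0
    · have := Real.rpow_le_rpow hx0.le hMx h0
      linarith
    · have := Real.rpow_le_rpow_of_nonpos hm (hs.trans hx.1.le) h0
      linarith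
  have := sub_pos.2 hlt
  gcongr

/-- Only an upper bound is needed, so s and t may be replaced by their maxima with s₀ and t₀. The
lower bound m on s₀ then keeps the power p - 1 Lipschitz even when p < 2, while s itself may be
arbitrarily small. -/
lemma exists_rpow_mul_le {m M : ℝ} (hm : 0 < m) (hp : 1 < p) :
    ∃ L : ℝ, 0 ≤ L ∧ ∀ s s₀ t t₀ W, 0 ≤ W → m ≤ s₀ → s₀ ≤ M → 0 ≤ t₀ → t₀ ≤ M → 0 ≤ s → s ≤ M →
      0 ≤ t → t ≤ M → s ≤ s₀ + W → t ≤ t₀ + W →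
      s ^ (p - 1) * t ≤ s₀ ^ (p - 1) * t₀ + L * W := by
  obtain ⟨L, hL, hLip⟩ := exists_rpow_sub_le (M := M) hm (p - 1) (by linarith)
  refine ⟨L * |M| + |M| ^ (p - 1), by positivity, ?_⟩
  intro s s₀ t t₀ W hW hs₀ hs₀M ht₀ ht₀M hs hsM ht htM hsW htW
  have hM : |M| = M := abs_of_nonneg (hs.trans hsM)
  have hr : 0 ≤ p - 1 := by linarith
  have hs00 : 0 < s₀ := hm.trans_le hs₀
  have h1 := hLip s₀ (max s s₀) hs₀ (le_max_right _ _) (max_le hsM hs₀M)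
  have h2 : max s s₀ - s₀ ≤ W := by
    rw [sub_le_iff_le_add]; exact max_le (by linarith) (by linarith)
  have h3 : max t t₀ - t₀ ≤ W := by
    rw [sub_le_iff_le_add]; exact max_le (by linarith) (by linarith)
  have h4 : s ^ (p - 1) ≤ (max s s₀) ^ (p - 1) := Real.rpow_le_rpow hs (le_max_left _ _) hr
  have h5 : s₀ ^ (p - 1) ≤ M ^ (p - 1) := Real.rpow_le_rpow hs00.le hs₀M hr
  have h6 : 0 ≤ s₀ ^ (p - 1) := by positivity
  have h7 : max t t₀ ≤ M := max_le htM ht₀M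
  have h8 : 0 ≤ max t t₀ := ht.trans (le_max_left _ _)
  have h9 : (max s s₀) ^ (p - 1) - s₀ ^ (p - 1) ≤ L * W :=
    h1.trans (mul_le_mul_of_nonneg_left h2 hL)
  have h10 : 0 ≤ t₀ := ht₀
  calc s ^ (p - 1) * t ≤ (max s s₀) ^ (p - 1) * max t t₀ :=
        mul_le_mul h4 (le_max_left _ _) ht (by positivity)
    _ = s₀ ^ (p - 1) * t₀ + (((max s s₀) ^ (p - 1) - s₀ ^ (p - 1)) * max t t₀ +
          s₀ ^ (p - 1) * (max t t₀ - t₀)) := by ring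
    _ ≤ s₀ ^ (p - 1) * t₀ + (L * W * M + M ^ (p - 1) * W) := by
        have a1 : ((max s s₀) ^ (p - 1) - s₀ ^ (p - 1)) * max t t₀ ≤ L * W * M :=
          mul_le_mul h9 h7 h8 (by positivity)
        have a2 : s₀ ^ (p - 1) * (max t t₀ - t₀) ≤ M ^ (p - 1) * W :=
          mul_le_mul h5 h3 (sub_nonneg.2 (le_max_right _ _)) (h6.trans h5)
        linarith
    _ = _ := by rw [hM]; ring

end Nonlinearity

/-! ### The narrow region principle -/

namespace IsPotentialPair

variable {n : ℕ} {p a b c d : ℝ} {u v : Euc n → ℝ}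

/-- The sphere of radius `lam` can be reached by the moving sphere method. -/
def Good (u v : Euc n → ℝ) (lam : ℝ) : Prop :=
  ∀ y : Euc n, lam < ‖y‖ → kelvin lam u y ≤ u y ∧ kelvin lam v y ≤ v y

lemma exists_bounds (h : IsPotentialPair n p a b c d u v) (R : ℝ) : ∃ m M : ℝ, 0 < m ∧ 0 < M ∧
    ∀ y : Euc n, ‖y‖ ≤ R → m ≤ u y ∧ u y ≤ M ∧ v y ≤ M := by
  have hK := isCompact_closedBall (0 : Euc n) R
  obtain ⟨M₁, hM₁⟩ := hK.bddAbove_image h.continuous_left.continuousOn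
  obtain ⟨M₂, hM₂⟩ := hK.bddAbove_image h.continuous_right.continuousOn
  obtain ⟨m, hm, hmle⟩ := hK.exists_forall_le' h.continuous_left.continuousOn
    (a := 0) (fun y _ => h.pos_left y)
  refine ⟨m, max 1 (max M₁ M₂), hm, by positivity, fun y hy => ?_⟩
  have hy' : y ∈ closedBall (0 : Euc n) R := by simpa using hy
  exact ⟨hmle y hy', (hM₁ (mem_image_of_mem _ hy')).trans (by simp),
    (hM₂ (mem_image_of_mem _ hy')).trans (by simp)⟩

lemma kelvin_le_of_bound {w : Euc n → ℝ} {R M lam : ℝ} (hl : 0 < lam)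
    (hlR : lam ≤ R) (hM : ∀ y : Euc n, ‖y‖ ≤ R → w y ≤ M) {y : Euc n} (hy : lam < ‖y‖) :
    kelvin lam w y ≤ (lam / ‖y‖) ^ (n - 2) * M := by
  unfold kelvin
  gcongr
  refine hM _ ?_
  rw [norm_sphInv, div_le_iff₀ (hl.trans hy)]
  nlinarith

/-- Narrow region principle. -/
lemma exists_narrow (hn : 3 ≤ n) (hp : 1 < p) (hτ : 0 < scalingDefect n p)
    (h : IsPotentialPair n p a b c d u v) (R : ℝ) :
    ∃ δ : ℝ, 0 < δ ∧ ∀ lam, 0 < lam → lam ≤ R → ∀ E : Set (Euc n), MeasurableSet E →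
      E ⊆ closedBall 0 R → volume E ≤ ENNReal.ofReal δ →
      (∀ y, lam < ‖y‖ → y ∉ E → kelvin lam u y ≤ u y ∧ kelvin lam v y ≤ v y) →
      Good u v lam := by
  obtain ⟨m, M, hm, hM, hb⟩ := h.exists_bounds R
  obtain ⟨L, hL, hLip⟩ := exists_rpow_mul_le (M := M) hm hp
  have hc := h.pos_c
  have hd := h.pos_d
  -- ε is chosen so that one pass through the integral equations multiplies the defect by at most (c
  -- + d) L ε ≤ 1/2.
  obtain ⟨δ, hδ, hsmall⟩ := exists_lintegral_newton_le (n := n) hn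
    (ε := 1 / (2 * ((c + d) * L + 1))) (by positivity)
  set ε := 1 / (2 * ((c + d) * L + 1)) with hε
  have hε0 : 0 < ε := by positivity
  have hεL : (c + d) * L * ε ≤ 1 / 2 := by
    rw [hε, mul_one_div, div_le_div_iff₀ (by positivity) (by positivity)]
    nlinarith [mul_nonneg (add_pos hc hd).le hL]
  refine ⟨δ, hδ, fun lam hl hlR E hEm hER hEδ hout => ?_⟩
  have hEε := hsmall E hEm hEδ
  have hkM : ∀ {w : Euc n → ℝ}, (∀ x, 0 < w x) → (∀ y : Euc n, ‖y‖ ≤ R → w y ≤ M) →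
      ∀ y : Euc n, lam < ‖y‖ → kelvin lam w y ≤ M := fun _ hwM y hy =>
    (kelvin_le_of_bound hl hlR hwM hy).trans (mul_le_of_le_one_left hM.le
      (pow_le_one₀ (by positivity) ((div_le_one (hl.trans hy)).2 hy.le)))
  have hku := hkM h.pos_left fun y hy => (hb y hy).2.1
  have hkv := hkM h.pos_right fun y hy => (hb y hy).2.2
  -- A priori the defect is at most M, because reflected points lie in the ball of radius R. There
  -- is no defect in the densities off E, so each pass through the equations halves the bound, and
  -- the limit k → ∞ leaves no defect at all.
  have hdefect : ∀ k : ℕ, ∀ y : Euc n, lam < ‖y‖ →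
      kelvin lam u y - u y ≤ M * (1 / 2) ^ k ∧ kelvin lam v y - v y ≤ M * (1 / 2) ^ k := by
    intro k
    induction k with
    | zero =>
      intro y hy
      rw [pow_zero, mul_one]
      exact ⟨by linarith [hku y hy, h.pos_left y], by linarith [hkv y hy, h.pos_right y]⟩
    | succ k ih =>
      set W := M * (1 / 2) ^ k with hWdef
      have hW : 0 ≤ W := by positivity
      have hW' : M * (1 / 2) ^ (k + 1) = W * (1 / 2) := by rw [hWdef, pow_succ]; ring
      rw [hW']
      -- Both densities have the form u^(p-1) w, with w = v for the first equation and w = u for the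
      -- second.
      have main : ∀ {w U : Euc n → ℝ} {a' c' : ℝ}, (∀ x, 0 < w x) →
          (∀ y : Euc n, ‖y‖ ≤ R → w y ≤ M) → 0 ≤ a' → 0 < c' → c' ≤ c + d →
          (∀ x, Integrable (fun z => u z ^ (p - 1) * w z * newton x z)) →
          (∀ x, U x = a' + c' * ∫ z, u z ^ (p - 1) * w z * newton x z) →
          (∀ y, lam < ‖y‖ → y ∉ E → kelvin lam w y ≤ w y) →
          (∀ y, lam < ‖y‖ → kelvin lam w y ≤ w y + W) →
          ∀ y, lam < ‖y‖ → kelvin lam U y - U y ≤ W * (1 / 2) := by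
        intro w U a' c' hw hwM ha' hc' hcd hint hU hwout hwW y hy
        refine (kelvin_sub_le hn hl ha' hc' hint hU hEm hε0.le
          (mul_nonneg hL hW) hEε ?_ ?_ hy).trans ?_
        · intro z hz hzE
          have hz0 : z ≠ 0 := norm_pos_iff.1 (hl.trans hz)
          have := (kelvin_pos hl h.pos_left hz0).le
          have := (kelvin_pos hl hw hz0).le
          refine (kelvinDensity_le hn hl hτ h.pos_left hw hz).trans ?_
          refine mul_le_mul ?_ (hwout z hz hzE) this (by have := h.pos_left z; positivity)
          exact Real.rpow_le_rpow (by assumption) (hout z hz hzE).1 (by linarith)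
        · intro z hz hzE
          have hz0 : z ≠ 0 := norm_pos_iff.1 (hl.trans hz)
          have hzR : ‖z‖ ≤ R := by simpa using hER hzE
          refine (kelvinDensity_le hn hl hτ h.pos_left hw hz).trans ?_
          exact hLip _ _ _ _ W hW (hb z hzR).1 (hb z hzR).2.1 (hw z).le (hwM z hzR)
            (kelvin_pos hl h.pos_left hz0).le (hku z hz) (kelvin_pos hl hw hz0).le
            (hkM hw hwM z hz) (by linarith [(ih z hz).1]) (hwW z hz)
        · calc c' * (L * W * ε) = (c' * L * ε) * W := by ring
            _ ≤ ((c + d) * L * ε) * W := by gcongr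
            _ ≤ 1 / 2 * W := by gcongr
            _ = _ := by ring
      intro y hy
      refine ⟨main h.pos_right (fun y hy => (hb y hy).2.2) h.nonneg_a hc (by linarith)
        h.integrable_left h.eq_left (fun y hy hyE => (hout y hy hyE).2)
        (fun y hy => by linarith [(ih y hy).2]) y hy,
        main h.pos_left (fun y hy => (hb y hy).2.1) h.nonneg_b hd (by linarith)
        h.integrable_right h.eq_right (fun y hy hyE => (hout y hy hyE).1)
        (fun y hy => by linarith [(ih y hy).1]) y hy⟩
  have hlim : Tendsto (fun k : ℕ => M * (1 / 2 : ℝ) ^ k) atTop (𝓝 0) := by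
    simpa using (tendsto_pow_atTop_nhds_zero_of_lt_one (r := (1 / 2 : ℝ)) (by norm_num)
      (by norm_num)).const_mul M
  intro y hy
  exact ⟨sub_nonpos.1 (ge_of_tendsto' hlim fun k => (hdefect k y hy).1),
    sub_nonpos.1 (ge_of_tendsto' hlim fun k => (hdefect k y hy).2)⟩

end IsPotentialPair

/-! ### Thin shells and lower bounds at infinity -/

section Auxiliary

variable {n : ℕ}

/-- The shells decrease to the empty set, so continuity from above applies. A thin shell is the
exceptional set in the narrow region principle; r = 0 gives a punctured ball. -/
lemma exists_shell_small (r : ℝ) {δ : ℝ} (hδ : 0 < δ) : ∃ η : ℝ, 0 < η ∧ η ≤ 1 ∧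
    volume {y : Euc n | r < ‖y‖ ∧ ‖y‖ < r + η} ≤ ENNReal.ofReal δ := by
  set S : ℕ → Set (Euc n) := fun k => {y | r < ‖y‖ ∧ ‖y‖ < r + 1 / ((k : ℝ) + 1)}
  have hS : ∀ k, MeasurableSet (S k) := fun k =>
    ((isOpen_lt continuous_const continuous_norm).inter
      (isOpen_lt continuous_norm continuous_const)).measurableSet
  have hanti : Antitone S := fun i j hij y hy => ⟨hy.1, hy.2.trans_le (by gcongr)⟩
  have hempty : ⋂ k, S k = ∅ := by
    refine eq_empty_of_forall_notMem fun y hy => ?_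
    rw [mem_iInter] at hy
    obtain ⟨k, hk⟩ := exists_nat_one_div_lt (sub_pos.2 (hy 0).1)
    have := (hy k).2
    linarith
  have hfin : volume (S 0) ≠ ⊤ := by
    refine ((measure_mono fun y hy => ?_).trans_lt
      (measure_ball_lt_top (x := (0 : Euc n)) (r := r + 1))).ne
    simpa using hy.2
  have := tendsto_measure_iInter_atTop (fun k => (hS k).nullMeasurableSet) hanti ⟨0, hfin⟩
  rw [hempty, measure_empty] at this
  obtain ⟨k, hk⟩ := (this.eventually (ge_mem_nhds (ENNReal.ofReal_pos.2 hδ))).exists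
  refine ⟨1 / ((k : ℝ) + 1), by positivity, ?_, hk⟩
  rw [div_le_one (by positivity)]
  have : (0 : ℝ) ≤ k := k.cast_nonneg
  linarith

/-- In polar coordinates the integrand becomes t^(n-1) t^(2-n) = t, which is not integrable on the
half-line. -/
lemma not_integrable_newton (hn : 3 ≤ n) : ¬ Integrable (fun z : Euc n => newton 0 z) := by
  have : Nontrivial (Euc n) := Module.nontrivial_of_finrank_pos (R := ℝ) (by simp; omega)
  intro h
  have h1 : Integrable (fun z : Euc n => (fun t : ℝ => (t ^ (n - 2))⁻¹) ‖z‖) := by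
    simpa [newton] using h
  have h2 := (integrable_fun_norm_addHaar volume (f := fun t : ℝ => (t ^ (n - 2))⁻¹)).1 h1
  refine not_integrableOn_Ioi_rpow 1 (h2.congr_fun (fun t ht => ?_) measurableSet_Ioi)
  have ht' : (0 : ℝ) < t := ht
  simp only [finrank_euclideanSpace_fin, Real.rpow_one, smul_eq_mul]
  rw [show n - 1 = (n - 2) + 1 by omega, pow_succ]
  field_simp

/-- A positive potential decays at most like the Newton kernel. -/
lemma exists_le_potential {f U : Euc n → ℝ} {a c r : ℝ} (ha : 0 ≤ a) (hc : 0 < c)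
    (hfc : Continuous f) (hf0 : ∀ x, 0 < f x)
    (hf : ∀ x, Integrable (fun z => f z * newton x z))
    (hU : ∀ x, U x = a + c * ∫ z, f z * newton x z) (hr : 0 < r) (hn : 3 ≤ n) :
    ∃ c' : ℝ, 0 < c' ∧ ∀ y : Euc n, r ≤ ‖y‖ → c' * (‖y‖ ^ (n - 2))⁻¹ ≤ U y := by
  obtain ⟨m, hm, hmle⟩ := (isCompact_closedBall (0 : Euc n) 1).exists_forall_le'
    hfc.continuousOn (a := 0) (fun y _ => hf0 y)
  set V := volume.real (closedBall (0 : Euc n) 1)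
  have hV : 0 < V := ENNReal.toReal_pos (measure_closedBall_pos volume _ one_pos).ne'
    measure_closedBall_lt_top.ne
  set C : ℝ := 1 + 1 / r
  refine ⟨c * (V * (m * (C ^ (n - 2))⁻¹)), by positivity, fun y hy => ?_⟩
  have hy0 : 0 < ‖y‖ := hr.trans_le hy
  have key : V * (m * ((C * ‖y‖) ^ (n - 2))⁻¹) ≤ ∫ z, f z * newton y z := by
    calc V * (m * ((C * ‖y‖) ^ (n - 2))⁻¹)
        = ∫ z in closedBall (0 : Euc n) 1, m * ((C * ‖y‖) ^ (n - 2))⁻¹ := by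
          rw [setIntegral_const, smul_eq_mul]
      _ ≤ ∫ z in closedBall (0 : Euc n) 1, f z * newton y z := by
          refine setIntegral_mono_on_ae (integrableOn_const measure_closedBall_lt_top.ne)
            (hf y).integrableOn measurableSet_closedBall ?_
          filter_upwards [ae_ne_point hn y] with z hzy hz
          have hz1 : ‖z‖ ≤ 1 := by simpa using hz
          have hd : ‖y - z‖ ≤ C * ‖y‖ := by
            have h1 := norm_sub_le y z
            have h2 : 1 ≤ 1 / r * ‖y‖ := by rwa [one_div_mul_eq_div, one_le_div hr]
            simp only [C, add_mul, one_mul]; linarith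
          exact mul_le_mul (hmle z hz) (le_newton_of_le hzy.symm hd) (by positivity) (hf0 z).le
      _ ≤ _ := setIntegral_le_integral (hf y) (Eventually.of_forall fun z =>
          mul_nonneg (hf0 z).le (newton_nonneg y z))
  rw [hU y]
  have := mul_le_mul_of_nonneg_left key hc.le
  rw [mul_pow, mul_inv] at this
  linarith

end Auxiliary

/-! ### The moving sphere argument -/

namespace IsPotentialPair

variable {n : ℕ} {p a b c d : ℝ} {u v : Euc n → ℝ}

lemma density_continuous (h : IsPotentialPair n p a b c d u v) {w : Euc n → ℝ}
    (hw : Continuous w) : Continuous (fun z => u z ^ (p - 1) * w z) :=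
  (h.continuous_left.rpow_const fun x => Or.inl (h.pos_left x).ne').mul hw

lemma density_pos (h : IsPotentialPair n p a b c d u v) {w : Euc n → ℝ}
    (hw : ∀ x, 0 < w x) (z : Euc n) : 0 < u z ^ (p - 1) * w z :=
  mul_pos (Real.rpow_pos_of_pos (h.pos_left z) _) (hw z)

/-- For ‖y‖ ≥ η the Kelvin transforms are at most lam^(n-2) M ‖y‖^(2-n), which for small lam lies
below the decay rate that `exists_le_potential` guarantees. The remaining punctured ball of radius η
is narrow. -/
lemma exists_good_small (hn : 3 ≤ n) (hp : 1 < p) (hτ : 0 < scalingDefect n p)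
    (h : IsPotentialPair n p a b c d u v) :
    ∃ l₀ : ℝ, 0 < l₀ ∧ ∀ lam, 0 < lam → lam ≤ l₀ → Good u v lam := by
  obtain ⟨δ, hδ, hnarrow⟩ := h.exists_narrow hn hp hτ 1
  obtain ⟨η, hη, hη1, hvol⟩ := exists_shell_small (n := n) 0 hδ
  obtain ⟨m, M, hm, hM, hb⟩ := h.exists_bounds 1
  obtain ⟨c₁, hc₁, h₁⟩ := exists_le_potential h.nonneg_a h.pos_c
    (h.density_continuous h.continuous_right) (h.density_pos h.pos_right)
    h.integrable_left h.eq_left hη hn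
  obtain ⟨c₂, hc₂, h₂⟩ := exists_le_potential h.nonneg_b h.pos_d
    (h.density_continuous h.continuous_left) (h.density_pos h.pos_left)
    h.integrable_right h.eq_right hη hn
  refine ⟨min 1 (min c₁ c₂ / M), by positivity, fun lam hl hle => ?_⟩
  have hl1 : lam ≤ 1 := hle.trans (min_le_left _ _)
  have hlM : lam ^ (n - 2) * M ≤ min c₁ c₂ := by
    calc lam ^ (n - 2) * M ≤ lam * M := by
          gcongr; exact pow_le_of_le_one hl.le hl1 (by omega)
      _ ≤ _ := (le_div_iff₀ hM).1 (hle.trans (min_le_right _ _))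
  refine hnarrow lam hl hl1 {y | 0 < ‖y‖ ∧ ‖y‖ < 0 + η} ?_ ?_ hvol ?_
  · exact ((isOpen_lt continuous_const continuous_norm).inter
      (isOpen_lt continuous_norm continuous_const)).measurableSet
  · intro y hy
    have := hy.2
    simp only [mem_closedBall_zero_iff]; linarith
  · intro y hy hyE
    have hy0 : 0 < ‖y‖ := hl.trans hy
    have hyη : η ≤ ‖y‖ := by
      by_contra hcon
      exact hyE ⟨hy0, by linarith [not_le.1 hcon]⟩
    have aux : ∀ {w : Euc n → ℝ} {c' : ℝ}, min c₁ c₂ ≤ c' → (∀ y : Euc n, ‖y‖ ≤ 1 → w y ≤ M) →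
        c' * (‖y‖ ^ (n - 2))⁻¹ ≤ w y → kelvin lam w y ≤ w y := by
      intro w c' hc' hwM hw
      calc kelvin lam w y ≤ (lam / ‖y‖) ^ (n - 2) * M := kelvin_le_of_bound hl hl1 hwM hy
        _ = lam ^ (n - 2) * M * (‖y‖ ^ (n - 2))⁻¹ := by rw [div_pow]; ring
        _ ≤ c' * (‖y‖ ^ (n - 2))⁻¹ := by gcongr; exact hlM.trans hc'
        _ ≤ w y := hw
    exact ⟨aux (min_le_left _ _) (fun y hy => (hb y hy).2.1) (h₁ y hyη),
      aux (min_le_right _ _) (fun y hy => (hb y hy).2.2) (h₂ y hyη)⟩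

/-- Apart from the factor ‖y‖^(2-n), the point y enters only through y/‖y‖², which stays in a
compact ball when y is bounded away from 0. Continuity in lam is therefore uniform up to infinity.
-/
lemma kelvin_eq_scaled (lam : ℝ) (w : Euc n → ℝ) (y : Euc n) :
    kelvin lam w y = lam ^ (n - 2) * w (lam ^ 2 • ((‖y‖ ^ 2)⁻¹ • y)) * (‖y‖ ^ (n - 2))⁻¹ := by
  rw [kelvin, sphInv_eq, div_pow, div_pow, smul_smul, div_eq_mul_inv (lam ^ 2)]
  ring

lemma good_of_forall_lt (h : IsPotentialPair n p a b c d u v) {lam : ℝ} (hl : 0 < lam)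
    (hlt : ∀ μ, 0 < μ → μ < lam → Good u v μ) : Good u v lam := by
  intro y hy
  have hcont : ∀ {w : Euc n → ℝ}, Continuous w → (∀ μ, 0 < μ → μ < lam → kelvin μ w y ≤ w y) →
      kelvin lam w y ≤ w y := by
    intro w hw hle
    have ht : Tendsto (fun μ => kelvin μ w y) (𝓝[<] lam) (𝓝 (kelvin lam w y)) := by
      simp_rw [kelvin_eq_scaled]
      have : Continuous (fun μ : ℝ =>
          μ ^ (n - 2) * w (μ ^ 2 • ((‖y‖ ^ 2)⁻¹ • y)) * (‖y‖ ^ (n - 2))⁻¹) := by fun_prop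
      exact (this.tendsto lam).mono_left nhdsWithin_le_nhds
    refine le_of_tendsto ht ?_
    filter_upwards [Ioo_mem_nhdsLT hl] with μ hμ
    exact hle μ hμ.1 hμ.2
  exact ⟨hcont h.continuous_left fun μ h0 h1 => (hlt μ h0 h1 y (h1.trans hy)).1,
    hcont h.continuous_right fun μ h0 h1 => (hlt μ h0 h1 y (h1.trans hy)).2⟩

/-- Subcriticality yields strictness without a strong maximum principle: on the annulus at distance
1 to 2 from the sphere the reflected density carries a factor at most θ < 1, so the densities differ
there by at least (1 - θ) m. -/
lemma exists_gap (hn : 3 ≤ n) (hp : 1 < p) (hτ : 0 < scalingDefect n p)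
    (h : IsPotentialPair n p a b c d u v) {lam δ : ℝ} (hl : 0 < lam) (hgood : Good u v lam)
    (hδ : 0 < δ) {w U : Euc n → ℝ} {a' c' : ℝ} (ha' : 0 ≤ a') (hc' : 0 < c')
    (hw : ∀ x, 0 < w x) (hwc : Continuous w)
    (hint : ∀ x, Integrable (fun z => u z ^ (p - 1) * w z * newton x z))
    (hU : ∀ x, U x = a' + c' * ∫ z, u z ^ (p - 1) * w z * newton x z)
    (hwk : ∀ y, lam < ‖y‖ → kelvin lam w y ≤ w y) :
    ∃ c'' : ℝ, 0 < c'' ∧ ∀ y : Euc n, lam + δ ≤ ‖y‖ →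
      c'' * (‖y‖ ^ (n - 2))⁻¹ ≤ U y - kelvin lam U y := by
  obtain ⟨m, hm, hmle⟩ := (isCompact_closedBall (0 : Euc n) (lam + 2)).exists_forall_le'
    (h.density_continuous hwc).continuousOn (a := 0) (fun y _ => h.density_pos hw y)
  set θ : ℝ := (lam / (lam + 1)) ^ scalingDefect n p
  have hθ : θ < 1 := Real.rpow_lt_one (by positivity)
    ((div_lt_one (by positivity)).2 (by linarith)) hτ
  have hθ0 : 0 ≤ θ := by positivity
  have hprod : ∀ z, lam < ‖z‖ →
      kelvin lam u z ^ (p - 1) * kelvin lam w z ≤ u z ^ (p - 1) * w z := by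
    intro z hz
    have hz0 : z ≠ 0 := norm_pos_iff.1 (hl.trans hz)
    have hk := kelvin_pos hl h.pos_left hz0
    refine mul_le_mul (Real.rpow_le_rpow hk.le (hgood z hz).1 (by linarith)) (hwk z hz)
      (kelvin_pos hl hw hz0).le (Real.rpow_nonneg (h.pos_left z).le _)
  refine exists_le_sub_kelvin hn hl ha' hc' hint hU hδ (m := (1 - θ) * m)
    (mul_pos (sub_pos.2 hθ) hm)
    (fun z hz => (kelvinDensity_le hn hl hτ h.pos_left hw hz).trans (hprod z hz)) ?_
  intro z hz1 hz2
  have hz : lam < ‖z‖ := by linarith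
  have hz0 : z ≠ 0 := norm_pos_iff.1 (hl.trans hz)
  have hf := h.density_pos (p := p) hw z
  have hθz : (lam / ‖z‖) ^ scalingDefect n p ≤ θ :=
    Real.rpow_le_rpow (by positivity) (by gcongr) hτ.le
  have hle : kelvinDensity lam (fun z => u z ^ (p - 1) * w z) z ≤ θ * (u z ^ (p - 1) * w z) := by
    rw [kelvinDensity_eq hn hl h.pos_left hz0]
    have := kelvin_pos hl h.pos_left hz0
    have := kelvin_pos hl hw hz0
    exact mul_le_mul hθz (hprod z hz) (by positivity) hθ0
  have hmz := hmle z (by simpa using hz2)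
  have h1 : (1 - θ) * m ≤ (1 - θ) * (u z ^ (p - 1) * w z) :=
    mul_le_mul_of_nonneg_left hmz (by linarith)
  linarith

/-- Beyond a thin shell, the gap of order ‖y‖^(2-n) from `exists_gap` absorbs the change of the
Kelvin transforms between the radii lam and μ, which is small on the same scale. The shell itself is
left to the narrow region principle. -/
lemma exists_good_extend (hn : 3 ≤ n) (hp : 1 < p) (hτ : 0 < scalingDefect n p)
    (h : IsPotentialPair n p a b c d u v) {lam : ℝ} (hl : 0 < lam) (hgood : Good u v lam) :
    ∃ ε : ℝ, 0 < ε ∧ ∀ μ, lam ≤ μ → μ < lam + ε → Good u v μ := by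
  obtain ⟨δ, hδ, hnarrow⟩ := h.exists_narrow hn hp hτ (lam + 1)
  obtain ⟨η, hη, hη1, hvol⟩ := exists_shell_small (n := n) lam hδ
  obtain ⟨c₁, hc₁, h₁⟩ := h.exists_gap hn hp hτ hl hgood hη h.nonneg_a h.pos_c h.pos_right
    h.continuous_right h.integrable_left h.eq_left (fun y hy => (hgood y hy).2)
  obtain ⟨c₂, hc₂, h₂⟩ := h.exists_gap hn hp hτ hl hgood hη h.nonneg_b h.pos_d h.pos_left
    h.continuous_left h.integrable_right h.eq_right (fun y hy => (hgood y hy).1)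
  have hcomp : ∀ {w : Euc n → ℝ} {c' : ℝ}, Continuous w → 0 < c' → ∀ᶠ μ in 𝓝 lam,
      ∀ x ∈ closedBall (0 : Euc n) lam⁻¹,
        μ ^ (n - 2) * w (μ ^ 2 • x) - lam ^ (n - 2) * w (lam ^ 2 • x) < c' := by
    intro w c' hw hc'
    refine (isCompact_closedBall (0 : Euc n) lam⁻¹).eventually_forall_of_forall_eventually
      fun x _ => ?_
    have hcont : Continuous (fun q : ℝ × Euc n =>
        q.1 ^ (n - 2) * w (q.1 ^ 2 • q.2) - lam ^ (n - 2) * w (lam ^ 2 • q.2)) := by fun_prop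
    have := hcont.tendsto (lam, x)
    simp only [sub_self] at this
    exact this.eventually (gt_mem_nhds hc')
  obtain ⟨ε₀, hε₀, hball⟩ := Metric.eventually_nhds_iff.1
    ((hcomp h.continuous_left hc₁).and (hcomp h.continuous_right hc₂))
  refine ⟨min ε₀ 1, by positivity, fun μ hμ hμ' => ?_⟩
  have hμ0 : 0 < μ := hl.trans_le hμ
  have hb := hball (y := μ) (by
    rw [Real.dist_eq, abs_of_nonneg (by linarith)]
    linarith [min_le_left ε₀ 1])
  refine hnarrow μ hμ0 (by linarith [min_le_right ε₀ 1]) {y | lam < ‖y‖ ∧ ‖y‖ < lam + η} ?_ ?_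
    hvol ?_
  · exact ((isOpen_lt continuous_const continuous_norm).inter
      (isOpen_lt continuous_norm continuous_const)).measurableSet
  · intro y hy
    have := hy.2
    simp only [mem_closedBall_zero_iff]; linarith
  · intro y hy hyE
    have hy0 : 0 < ‖y‖ := hμ0.trans hy
    have hyη : lam + η ≤ ‖y‖ := by
      by_contra hcon
      exact hyE ⟨hμ.trans_lt hy, not_le.1 hcon⟩
    have hx : (‖y‖ ^ 2)⁻¹ • y ∈ closedBall (0 : Euc n) lam⁻¹ := by
      rw [mem_closedBall_zero_iff, norm_smul, norm_inv, norm_pow, norm_norm, sq, mul_inv,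
        mul_assoc, inv_mul_cancel₀ hy0.ne', mul_one]
      gcongr; linarith
    have aux : ∀ {w : Euc n → ℝ} {c' : ℝ},
        μ ^ (n - 2) * w (μ ^ 2 • ((‖y‖ ^ 2)⁻¹ • y)) -
          lam ^ (n - 2) * w (lam ^ 2 • ((‖y‖ ^ 2)⁻¹ • y)) < c' →
        c' * (‖y‖ ^ (n - 2))⁻¹ ≤ w y - kelvin lam w y → kelvin μ w y ≤ w y := by
      intro w c' h1 h2
      have h3 : kelvin μ w y - kelvin lam w y ≤ c' * (‖y‖ ^ (n - 2))⁻¹ := by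
        rw [kelvin_eq_scaled, kelvin_eq_scaled, ← sub_mul]
        gcongr
      linarith
    exact ⟨aux (hb.1 _ hx) (h₁ y hyη), aux (hb.2 _ hx) (h₂ y hyη)⟩

lemma good_all (hn : 3 ≤ n) (hp : 1 < p) (hτ : 0 < scalingDefect n p)
    (h : IsPotentialPair n p a b c d u v) {lam : ℝ} (hl : 0 < lam) : Good u v lam := by
  set S : Set ℝ := {l | 0 < l ∧ ∀ μ, 0 < μ → μ ≤ l → Good u v μ}
  obtain ⟨l₀, hl₀, hsmall⟩ := h.exists_good_small hn hp hτ
  have hl₀S : l₀ ∈ S := ⟨hl₀, hsmall⟩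
  by_cases hbdd : BddAbove S
  · exfalso
    set L := sSup S
    have hL : 0 < L := hl₀.trans_le (le_csSup hbdd hl₀S)
    have hlt : ∀ μ, 0 < μ → μ < L → Good u v μ := by
      intro μ hμ hμL
      obtain ⟨l, hlS, hμl⟩ := exists_lt_of_lt_csSup ⟨l₀, hl₀S⟩ hμL
      exact hlS.2 μ hμ hμl.le
    obtain ⟨ε, hε, hext⟩ := h.exists_good_extend hn hp hτ hL (h.good_of_forall_lt hL hlt)
    have : L + ε / 2 ∈ S := by
      refine ⟨by positivity, fun μ hμ hμle => ?_⟩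
      rcases lt_or_ge μ L with h1 | h1
      · exact hlt μ hμ h1
      · exact hext μ h1 (by linarith)
    linarith [le_csSup hbdd this]
  · obtain ⟨l, hlS, hll⟩ := not_bddAbove_iff.1 hbdd lam
    exact hlS.2 lam hl hll.le

lemma translate (h : IsPotentialPair n p a b c d u v) (x₀ : Euc n) :
    IsPotentialPair n p a b c d (fun x => u (x + x₀)) (fun x => v (x + x₀)) where
  nonneg_a := h.nonneg_a
  nonneg_b := h.nonneg_b
  pos_c := h.pos_c
  pos_d := h.pos_d
  continuous_left := h.continuous_left.comp (continuous_add_const x₀)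
  continuous_right := h.continuous_right.comp (continuous_add_const x₀)
  pos_left x := h.pos_left _
  pos_right x := h.pos_right _
  integrable_left x := by
    simpa only [newton_add] using (h.integrable_left (x + x₀)).comp_add_right x₀
  integrable_right x := by
    simpa only [newton_add] using (h.integrable_right (x + x₀)).comp_add_right x₀
  eq_left x := by
    rw [h.eq_left (x + x₀), ← integral_add_right_eq_self _ x₀]
    simp only [newton_add]
  eq_right x := by
    rw [h.eq_right (x + x₀), ← integral_add_right_eq_self _ x₀]
    simp only [newton_add]

/-- Subcritical systems have no continuous positive solutions. -/
theorem elim (hn : 3 ≤ n) (hp : 1 < p) (hτ : 0 < scalingDefect n p)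
    (h : IsPotentialPair n p a b c d u v) : False := by
  have hle : ∀ y₁ y₂, u y₂ ≤ u y₁ := by
    intro y₁ y₂
    rcases eq_or_ne y₁ y₂ with rfl | hne
    · rfl
    have he : 0 < ‖y₂ - y₁‖ := norm_pos_iff.2 (sub_ne_zero.2 hne.symm)
    -- The centre y₂ + t (y₂ - y₁) lies on the line through both points, at distances (1 + t)‖y₂ -
    -- y₁‖ and t‖y₂ - y₁‖ from y₁ and y₂. The sphere whose radius is the geometric mean of the two
    -- distances exchanges the points, with y₁ outside. The Kelvin factor is s^(n-2) with s² =
    -- t/(t+1), which tends to 1 as t = k + 1 grows.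
    have hk : ∀ k : ℕ, (√(1 - 1 / ((k : ℝ) + 1 + 1))) ^ (n - 2) * u y₂ ≤ u y₁ := by
      intro k
      set t : ℝ := (k : ℝ) + 1
      have ht : 0 < t := by positivity
      have hs : 1 - 1 / (t + 1) = t / (t + 1) := by field_simp; ring
      set s := √(1 - 1 / (t + 1)) with hsdef
      have hs2 : s ^ 2 = t / (t + 1) := by
        rw [hsdef, Real.sq_sqrt (by rw [hs]; positivity), hs]
      have hs0 : 0 < s := by rw [hsdef, hs]; positivity
      have hs1 : s < 1 := by
        have : s ^ 2 < 1 := by rw [hs2, div_lt_one (by positivity)]; linarith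
        nlinarith
      set y : Euc n := -((1 + t) • (y₂ - y₁))
      have hy : 0 < ‖y‖ := by
        rw [norm_neg, norm_smul]
        have : 0 < ‖(1 + t : ℝ)‖ := norm_pos_iff.2 (by positivity)
        positivity
      have hg := ((h.translate (y₂ + t • (y₂ - y₁))).good_all hn hp hτ (lam := s * ‖y‖)
        (by positivity) y (by nlinarith)).1
      have e1 : y + (y₂ + t • (y₂ - y₁)) = y₁ := by simp only [y]; module
      have e2 : sphInv (s * ‖y‖) y + (y₂ + t • (y₂ - y₁)) = y₂ := by
        rw [sphInv_eq, mul_div_cancel_right₀ _ hy.ne', hs2]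
        have : (t / (t + 1)) • y = -(t • (y₂ - y₁)) := by
          simp only [y, smul_neg, smul_smul]
          congr 2; field_simp; ring
        rw [this]; abel
      simp only [kelvin] at hg
      rwa [e1, e2, mul_div_cancel_right₀ _ hy.ne'] at hg
    have hlim : Tendsto (fun k : ℕ => (√(1 - 1 / ((k : ℝ) + 1 + 1))) ^ (n - 2) * u y₂) atTop
        (𝓝 ((√(1 - 0)) ^ (n - 2) * u y₂)) := by
      have h1 : Tendsto (fun k : ℕ => 1 / ((k : ℝ) + 1 + 1)) atTop (𝓝 0) := by
        have := (tendsto_add_atTop_iff_nat 1).2 (tendsto_one_div_add_atTop_nhds_zero_nat (𝕜 := ℝ))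
        simpa using this
      exact (((tendsto_const_nhds.sub h1).sqrt).pow _).mul_const _
    have := le_of_tendsto' hlim hk
    simpa using this
  have hconst : ∀ y, u y = u 0 := fun y => le_antisymm (hle 0 y) (hle y 0)
  have hint := h.integrable_right 0
  simp_rw [hconst] at hint
  have hpos : u 0 ^ (p - 1) * u 0 ≠ 0 :=
    (mul_pos (Real.rpow_pos_of_pos (h.pos_left 0) _) (h.pos_left 0)).ne'
  refine not_integrable_newton hn ((hint.const_mul (u 0 ^ (p - 1) * u 0)⁻¹).congr
    (Eventually.of_forall fun z => ?_))
  simp only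
  rw [← mul_assoc, inv_mul_cancel₀ hpos, one_mul]

end IsPotentialPair

/-! ### Supersolutions for p ≤ n/(n-2) -/

section Supersolution

variable {n : ℕ} {p : ℝ}

lemma integrableOn_ball_of_integrable_newton (hn : 3 ≤ n) {f : Euc n → ℝ} (hf : Measurable f)
    (h : Integrable (fun y => f y * newton 0 y)) (R : ℝ) :
    IntegrableOn f (ball 0 R) := by
  refine Integrable.mono' (h.integrableOn.norm.const_mul (R ^ (n - 2))) hf.aestronglyMeasurable ?_
  refine (ae_restrict_iff' measurableSet_ball).2 ?_
  filter_upwards [ae_ne_point hn 0] with y hy0 hy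
  have hyR : ‖y‖ < R := by simpa using hy
  have hy' := norm_pos_iff.2 hy0
  rw [norm_mul, Real.norm_of_nonneg (newton_nonneg 0 y), newton, zero_sub, norm_neg]
  calc ‖f y‖ = ‖y‖ ^ (n - 2) * (‖f y‖ * (‖y‖ ^ (n - 2))⁻¹) := by field_simp
    _ ≤ _ := by gcongr

/-- The inequality `m ≥ c |·|^(2-n) * m^p` has no positive solutions for `1 < p ≤ n/(n-2)`. -/
theorem no_positive_supersolution (hn : 3 ≤ n) (hp : 1 < p) (hp' : p ≤ (n : ℝ) / (n - 2))
    {m : Euc n → ℝ} {c : ℝ} (hc : 0 < c) (hm : Measurable m) (hpos : ∀ x, 0 < m x)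
    (hint : ∀ x, Integrable (fun y => m y ^ p * newton x y))
    (h : ∀ x, c * ∫ y, m y ^ p * newton x y ≤ m x) : False := by
  have hmp : Measurable (fun y => m y ^ p) := hm.pow_const p
  have hmp0 : ∀ y, 0 < m y ^ p := fun y => Real.rpow_pos_of_pos (hpos y) p
  have hJint : ∀ R, IntegrableOn (fun y => m y ^ p) (ball 0 R) := fun R =>
    integrableOn_ball_of_integrable_newton hn hmp (hint 0) R
  -- The contradiction comes from this mass: it is bounded for R ≥ 1 (`hbound`) and yet gains a
  -- fixed amount at each doubling of R (`hgrow`).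
  set J : ℝ → ℝ := fun R => ∫ y in ball (0 : Euc n) R, m y ^ p
  set V := volume.real (ball (0 : Euc n) 1)
  have hV : 0 < V := ENNReal.toReal_pos (measure_ball_pos volume _ one_pos).ne'
    measure_ball_lt_top.ne
  have hvol : ∀ R, 0 < R → volume.real (ball (0 : Euc n) R) = R ^ n * V := fun R hR => by
    simp only [Measure.real, V]
    rw [Measure.addHaar_ball_of_pos _ _ hR, ENNReal.toReal_mul, finrank_euclideanSpace_fin,
      ENNReal.toReal_ofReal (by positivity)]
  have hJpos : ∀ R, 0 < R → 0 < J R := fun R hR => by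
    refine (setIntegral_pos_iff_support_of_nonneg_ae (Eventually.of_forall fun y => (hmp0 y).le)
      (hJint R)).2 ?_
    have : Function.support (fun y => m y ^ p) = univ :=
      eq_univ_of_forall fun y => (hmp0 y).ne'
    rw [this, univ_inter]
    exact measure_ball_pos volume _ hR
  have hJmono : ∀ R S, R ≤ S → J R ≤ J S := fun R S hRS =>
    setIntegral_mono_set (hJint S) (Eventually.of_forall fun y => (hmp0 y).le)
      (LE.le.eventuallyLE (ball_subset_ball hRS))
  have hlow : ∀ R, 0 < R → ∀ x : Euc n, ‖x‖ < 2 * R → c * (((4 * R) ^ (n - 2))⁻¹ * J R) ≤ m x := by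
    intro R hR x hx
    refine le_trans ?_ (h x)
    gcongr
    calc ((4 * R) ^ (n - 2))⁻¹ * J R
        = ∫ y in ball (0 : Euc n) R, m y ^ p * ((4 * R) ^ (n - 2))⁻¹ := by
          rw [integral_mul_const, mul_comm]
      _ ≤ ∫ y in ball (0 : Euc n) R, m y ^ p * newton x y := by
          refine setIntegral_mono_on_ae ((hJint R).mul_const _) (hint x).integrableOn
            measurableSet_ball ?_
          filter_upwards [ae_ne_point hn x] with y hyx hy
          have hyR : ‖y‖ < R := by simpa using hy
          refine mul_le_mul_of_nonneg_left (le_newton_of_le hyx.symm ?_) (hmp0 y).le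
          linarith [norm_sub_le x y]
      _ ≤ _ := setIntegral_le_integral (hint x) (Eventually.of_forall fun y =>
          mul_nonneg (hmp0 y).le (newton_nonneg x y))
  set κ : ℝ := V * (c * (4 ^ (n - 2))⁻¹) ^ p
  have hκ : 0 < κ := by positivity
  have hn2 : ((n - 2 : ℕ) : ℝ) = (n : ℝ) - 2 := by push_cast [show 2 ≤ n by omega]; ring
  have hn0 : (0 : ℝ) < (n : ℝ) - 2 := by
    have : (3 : ℝ) ≤ n := by exact_mod_cast hn
    linarith
  -- Feeding the lower bound `hlow` back into m^p produces the factor R^(n - (n-2)p), which is at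
  -- least 1 because p ≤ n/(n-2) and R ≥ 1.
  have hset : ∀ R, 1 ≤ R → ∀ A ⊆ ball (0 : Euc n) (2 * R), MeasurableSet A →
      R ^ n * V ≤ volume.real A → κ * J R ^ p ≤ ∫ y in A, m y ^ p := by
    intro R hR A hA hAm hAV
    have hR0 : 0 < R := one_pos.trans_le hR
    have hAfin : volume A ≠ ⊤ := ((measure_mono hA).trans_lt measure_ball_lt_top).ne
    set q := c * (((4 * R) ^ (n - 2))⁻¹ * J R)
    have hJ := hJpos R hR0
    have hq : 0 < q := by positivity
    have hqe : κ * J R ^ p ≤ (R ^ n * V) * q ^ p := by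
      have e : q = (c * (4 ^ (n - 2))⁻¹) * ((R ^ (n - 2))⁻¹ * J R) := by
        simp only [q]; rw [mul_pow, mul_inv]; ring
      rw [e, Real.mul_rpow (by positivity) (by positivity),
        Real.mul_rpow (by positivity) hJ.le]
      have : 1 ≤ R ^ n * ((R ^ (n - 2))⁻¹) ^ p := by
        rw [← Real.rpow_natCast R n, ← Real.rpow_natCast R (n - 2), ← Real.rpow_neg hR0.le,
          ← Real.rpow_mul hR0.le, ← Real.rpow_add hR0, hn2]
        refine Real.one_le_rpow hR ?_
        have := (le_div_iff₀ hn0).1 hp'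
        linarith
      calc κ * J R ^ p = κ * J R ^ p * 1 := by ring
        _ ≤ κ * J R ^ p * (R ^ n * ((R ^ (n - 2))⁻¹) ^ p) := by gcongr
        _ = _ := by simp only [κ]; ring
    calc κ * J R ^ p ≤ (R ^ n * V) * q ^ p := hqe
      _ ≤ volume.real A * q ^ p := by gcongr
      _ = ∫ y in A, q ^ p := by rw [setIntegral_const, smul_eq_mul]
      _ ≤ ∫ y in A, m y ^ p := by
          refine setIntegral_mono_on (integrableOn_const hAfin) ((hJint _).mono_set hA) hAm ?_
          intro y hy
          exact Real.rpow_le_rpow hq.le (hlow R hR0 y (by simpa using hA hy)) (by linarith)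
  have hbound : ∀ R, 1 ≤ R → κ * J R ^ (p - 1) ≤ 1 := by
    intro R hR
    have hR0 : 0 < R := one_pos.trans_le hR
    have hJ := hJpos R hR0
    have h1 := hset R hR (ball 0 R) (ball_subset_ball (by linarith)) measurableSet_ball
      (hvol R hR0).ge
    rw [Real.rpow_sub_one hJ.ne', mul_div_assoc', div_le_one hJ]
    exact h1
  -- Here A is the annulus between R and 2R, whose volume is 2^n - 1 ≥ 1 times that of the ball of
  -- radius R.
  have hgrow : ∀ R, 1 ≤ R → J R + κ * J 1 ^ p ≤ J (2 * R) := by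
    intro R hR
    have hR0 : 0 < R := one_pos.trans_le hR
    have hsub : ball (0 : Euc n) R ⊆ ball 0 (2 * R) := ball_subset_ball (by linarith)
    have h1 := hset R hR (ball 0 (2 * R) \ ball 0 R) sdiff_subset
      (measurableSet_ball.diff measurableSet_ball) (by
        rw [measureReal_sdiff hsub measurableSet_ball, hvol R hR0, hvol (2 * R) (by positivity),
          mul_pow]
        have : (2 : ℝ) ≤ 2 ^ n := le_self_pow₀ (by norm_num) (by omega)
        have h3 : 0 < R ^ n * V := by positivity
        nlinarith)
    rw [setIntegral_sdiff measurableSet_ball (hJint _) hsub] at h1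
    have h2 : J 1 ^ p ≤ J R ^ p :=
      Real.rpow_le_rpow (hJpos 1 one_pos).le (hJmono 1 R hR) (by linarith)
    have := mul_le_mul_of_nonneg_left h2 hκ.le
    change _ ≤ J (2 * R) - J R at h1
    linarith
  set κ' := κ * J 1 ^ p
  have hJ1 := hJpos 1 one_pos
  have hκ' : 0 < κ' := by positivity
  have hiter : ∀ k : ℕ, k * κ' ≤ J (2 ^ k) := by
    intro k
    induction k with
    | zero => simpa using (hJpos 1 one_pos).le
    | succ k ih =>
      have := hgrow (2 ^ k) (one_le_pow₀ (by norm_num))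
      rw [pow_succ, mul_comm ((2 : ℝ) ^ k) 2]
      push_cast; linarith
  obtain ⟨k, hk⟩ := exists_nat_gt (((2 / κ) ^ (1 / (p - 1))) / κ')
  rw [div_lt_iff₀ hκ'] at hk
  have hp1 : 0 < p - 1 := by linarith
  have h1 : (2 / κ) ≤ J (2 ^ k) ^ (p - 1) := by
    calc 2 / κ = ((2 / κ) ^ (1 / (p - 1))) ^ (p - 1) := by
          rw [← Real.rpow_mul (by positivity), one_div_mul_cancel hp1.ne', Real.rpow_one]
      _ ≤ _ := Real.rpow_le_rpow (by positivity) (hk.le.trans (hiter k)) hp1.le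
  have h2 := hbound (2 ^ k) (one_le_pow₀ (by norm_num))
  have h3 := mul_le_mul_of_nonneg_left h1 hκ.le
  rw [mul_div_cancel₀ _ hκ.ne'] at h3
  linarith

/-- A pair of positive supersolutions of the integral system does not exist for
`1 < p ≤ n/(n-2)`. -/
theorem no_positive_superpair (hn : 3 ≤ n) (hp : 1 < p) (hp' : p ≤ (n : ℝ) / (n - 2))
    {u v : Euc n → ℝ} {c d : ℝ} (hc : 0 < c) (hd : 0 < d) (hum : Measurable u)
    (hvm : Measurable v) (hu : ∀ x, 0 < u x) (hv : ∀ x, 0 < v x)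
    (hint₁ : ∀ x, Integrable (fun y => u y ^ (p - 1) * v y * newton x y))
    (hint₂ : ∀ x, Integrable (fun y => u y ^ p * newton x y))
    (h₁ : ∀ x, c * ∫ y, u y ^ (p - 1) * v y * newton x y ≤ u x)
    (h₂ : ∀ x, d * ∫ y, u y ^ p * newton x y ≤ v x) : False := by
  -- The p-th power of min(u, v) lies below both densities u^(p-1) v and u^p, so the minimum is a
  -- supersolution of the scalar inequality with constant min(c, d).
  have hm : ∀ x, 0 < min (u x) (v x) := fun x => lt_min (hu x) (hv x)
  have le₂ : ∀ y, min (u y) (v y) ^ p ≤ u y ^ p := fun y =>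
    Real.rpow_le_rpow (hm y).le (min_le_left _ _) (by linarith)
  have le₁ : ∀ y, min (u y) (v y) ^ p ≤ u y ^ (p - 1) * v y := fun y => by
    calc min (u y) (v y) ^ p = min (u y) (v y) ^ (p - 1) * min (u y) (v y) := by
          rw [Real.rpow_sub_one (hm y).ne', div_mul_cancel₀ _ (hm y).ne']
      _ ≤ _ := mul_le_mul (Real.rpow_le_rpow (hm y).le (min_le_left _ _) (by linarith))
          (min_le_right _ _) (hm y).le (Real.rpow_nonneg (hu y).le _)
  have hmm : Measurable (fun x => min (u x) (v x)) := hum.min hvm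
  have hint : ∀ x, Integrable (fun y => min (u y) (v y) ^ p * newton x y) := fun x => by
    refine (hint₂ x).mono' ((hmm.pow_const p).mul
      (measurable_newton_right x)).aestronglyMeasurable (Eventually.of_forall fun y => ?_)
    rw [Real.norm_of_nonneg (mul_nonneg (Real.rpow_nonneg (hm y).le _) (newton_nonneg x y))]
    exact mul_le_mul_of_nonneg_right (le₂ y) (newton_nonneg x y)
  refine no_positive_supersolution hn hp hp' (c := min c d) (lt_min hc hd) hmm hm hint fun x => ?_
  have i₁ : ∫ y, min (u y) (v y) ^ p * newton x y ≤ ∫ y, u y ^ (p - 1) * v y * newton x y :=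
    integral_mono (hint x) (hint₁ x) fun y => mul_le_mul_of_nonneg_right (le₁ y) (newton_nonneg x y)
  have i₂ : ∫ y, min (u y) (v y) ^ p * newton x y ≤ ∫ y, u y ^ p * newton x y :=
    integral_mono (hint x) (hint₂ x) fun y => mul_le_mul_of_nonneg_right (le₂ y) (newton_nonneg x y)
  have i₀ : 0 ≤ ∫ y, min (u y) (v y) ^ p * newton x y := integral_nonneg fun y =>
    mul_nonneg (Real.rpow_nonneg (hm y).le _) (newton_nonneg x y)
  refine le_min ((mul_le_mul (min_le_left _ _) i₁ i₀ hc.le).trans (h₁ x))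
    ((mul_le_mul (min_le_right _ _) i₂ i₀ hd.le).trans (h₂ x))

end Supersolution

/-! ### The Hardy-Littlewood-Sobolev inequality -/

/-- The Newton kernel as an extended nonnegative function of one variable. -/
noncomputable def newtonK {n : ℕ} (z : Euc n) : ℝ≥0∞ := ENNReal.ofReal ((‖z‖ ^ (n - 2))⁻¹)

/-- The Newton potential of an extended nonnegative function. -/
noncomputable def riesz {n : ℕ} (f : Euc n → ℝ≥0∞) (x : Euc n) : ℝ≥0∞ :=
  ∫⁻ y, f y * newtonK (x - y)

section HLS

variable {n : ℕ}

lemma measurable_newtonK : Measurable (newtonK : Euc n → ℝ≥0∞) := by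
  unfold newtonK; fun_prop

lemma measurable_riesz {f : Euc n → ℝ≥0∞} (hf : Measurable f) : Measurable (riesz f) := by
  have : Measurable (fun q : Euc n × Euc n => f q.2 * newtonK (q.1 - q.2)) :=
    (hf.comp measurable_snd).mul (measurable_newtonK.comp (measurable_fst.sub measurable_snd))
  exact this.lintegral_prod_right

lemma lintegral_comp_smul_pos {g : Euc n → ℝ≥0∞} (hg : Measurable g) {R : ℝ} (hR : 0 < R) :
    ∫⁻ x, g x = ENNReal.ofReal (R ^ n) * ∫⁻ x, g (R • x) := by
  have h1 : ∫⁻ x, g (R • x) = ∫⁻ x, g x ∂(Measure.map (R • ·) volume) :=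
    (lintegral_map hg (measurable_const_smul R)).symm
  rw [h1, Measure.map_addHaar_smul _ hR.ne', lintegral_smul_measure, finrank_euclideanSpace_fin,
    smul_eq_mul, ← mul_assoc, ← ENNReal.ofReal_mul (by positivity), abs_of_pos (by positivity),
    mul_inv_cancel₀ (by positivity), ENNReal.ofReal_one, one_mul]

lemma newtonK_smul {R : ℝ} (hR : 0 < R) (z : Euc n) :
    newtonK (R • z) = ENNReal.ofReal ((R ^ (n - 2))⁻¹) * newtonK z := by
  rw [newtonK, newtonK, ← ENNReal.ofReal_mul (by positivity), norm_smul, mul_pow, mul_inv,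
    Real.norm_of_nonneg hR.le]

/-- Integral of the Newton kernel over balls. -/
lemma lintegral_newtonK_ball (hn : 3 ≤ n) {R : ℝ} (hR : 0 < R) :
    ∫⁻ z, (ball (0 : Euc n) R).indicator newtonK z =
      ENNReal.ofReal (R ^ 2) * ∫⁻ z, (ball (0 : Euc n) 1).indicator newtonK z := by
  rw [lintegral_comp_smul_pos (measurable_newtonK.indicator measurableSet_ball) hR]
  have : ∀ z : Euc n, (ball (0 : Euc n) R).indicator newtonK (R • z) =
      ENNReal.ofReal ((R ^ (n - 2))⁻¹) * (ball (0 : Euc n) 1).indicator newtonK z := by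
    intro z
    have hiff : R • z ∈ ball (0 : Euc n) R ↔ z ∈ ball (0 : Euc n) 1 := by
      simp only [mem_ball_zero_iff, norm_smul, Real.norm_of_nonneg hR.le]
      exact mul_lt_iff_lt_one_right hR
    by_cases hz : z ∈ ball (0 : Euc n) 1
    · rw [indicator_of_mem hz, indicator_of_mem (hiff.2 hz), newtonK_smul hR]
    · rw [indicator_of_notMem hz, indicator_of_notMem (hiff.not.2 hz), mul_zero]
  simp_rw [this]
  rw [lintegral_const_mul _ (measurable_newtonK.indicator measurableSet_ball), ← mul_assoc,
    ← ENNReal.ofReal_mul (by positivity)]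
  congr 2
  rw [show n = (n - 2) + 2 by omega, pow_add, show n - 2 + 2 - 2 = n - 2 by omega]
  field_simp

lemma lintegral_newtonK_unit_ball_lt_top (hn : 3 ≤ n) :
    ∫⁻ z, (ball (0 : Euc n) 1).indicator newtonK z < ⊤ := by
  rw [lintegral_indicator measurableSet_ball]
  have := (hasFiniteIntegral_iff_ofReal (Eventually.of_forall fun y => newton_nonneg _ _)).1
    (integrableOn_newton_ball hn 1).2
  simpa [newtonK, newton] using this

/-- Integral of powers of the Newton kernel over exteriors of balls. -/
lemma lintegral_newtonK_rpow_exterior (b : ℝ) (hb : 0 < b) {R : ℝ} (hR : 0 < R) :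
    ∫⁻ z, ((ball (0 : Euc n) R)ᶜ.indicator newtonK z) ^ b =
      ENNReal.ofReal (R ^ ((n : ℝ) - ((n - 2 : ℕ) : ℝ) * b)) *
        ∫⁻ z, ((ball (0 : Euc n) 1)ᶜ.indicator newtonK z) ^ b := by
  have hm : ∀ r : ℝ, Measurable (fun z : Euc n => ((ball (0 : Euc n) r)ᶜ.indicator newtonK z) ^ b) :=
    fun r => (measurable_newtonK.indicator measurableSet_ball.compl).pow_const b
  rw [lintegral_comp_smul_pos (hm R) hR]
  have : ∀ z : Euc n, ((ball (0 : Euc n) R)ᶜ.indicator newtonK (R • z)) ^ b =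
      ENNReal.ofReal (R ^ (-(((n - 2 : ℕ) : ℝ) * b))) *
        ((ball (0 : Euc n) 1)ᶜ.indicator newtonK z) ^ b := by
    intro z
    have hiff : R • z ∈ (ball (0 : Euc n) R)ᶜ ↔ z ∈ (ball (0 : Euc n) 1)ᶜ := by
      simp only [mem_compl_iff, mem_ball_zero_iff, norm_smul, Real.norm_of_nonneg hR.le]
      rw [mul_lt_iff_lt_one_right hR]
    by_cases hz : z ∈ (ball (0 : Euc n) 1)ᶜ
    · rw [indicator_of_mem hz, indicator_of_mem (hiff.2 hz), newtonK_smul hR,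
        ENNReal.mul_rpow_of_nonneg _ _ hb.le, ENNReal.ofReal_rpow_of_nonneg (by positivity) hb.le]
      congr 2
      rw [← Real.rpow_natCast, ← Real.rpow_neg hR.le, ← Real.rpow_mul hR.le]
      congr 1; ring
    · rw [indicator_of_notMem hz, indicator_of_notMem (hiff.not.2 hz),
        ENNReal.zero_rpow_of_pos hb, mul_zero]
  simp_rw [this]
  rw [lintegral_const_mul _ (hm 1), ← mul_assoc, ← ENNReal.ofReal_mul (by positivity)]
  congr 2
  rw [← Real.rpow_natCast, ← Real.rpow_add hR]
  congr 1

lemma lintegral_newtonK_rpow_unit_exterior_lt_top {b : ℝ} (hb : (n : ℝ) < ((n - 2 : ℕ) : ℝ) * b)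
    (hb0 : 0 < b) : ∫⁻ z, ((ball (0 : Euc n) 1)ᶜ.indicator newtonK z) ^ b < ⊤ := by
  have h := finite_integral_one_add_norm (μ := (volume : Measure (Euc n)))
    (r := ((n - 2 : ℕ) : ℝ) * b) (by simpa using hb)
  refine (lintegral_mono fun z => ?_).trans_lt
    ((lintegral_const_mul _ (by fun_prop)).trans_lt (ENNReal.mul_lt_top
      (ENNReal.ofReal_lt_top (r := 2 ^ (((n - 2 : ℕ) : ℝ) * b))) h))
  by_cases hz : z ∈ (ball (0 : Euc n) 1)ᶜ
  · have hz1 : 1 ≤ ‖z‖ := by simpa using hz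
    rw [indicator_of_mem hz, newtonK, ENNReal.ofReal_rpow_of_nonneg (by positivity) hb0.le,
      ← ENNReal.ofReal_mul (by positivity)]
    apply ENNReal.ofReal_le_ofReal
    have hz0 : 0 < ‖z‖ := by linarith
    rw [← Real.rpow_natCast, ← Real.rpow_neg hz0.le, ← Real.rpow_mul hz0.le, neg_mul,
      Real.rpow_neg hz0.le, Real.rpow_neg (by positivity), ← div_eq_mul_inv,
      inv_eq_one_div, div_le_div_iff₀ (by positivity) (by positivity), one_mul,
      ← Real.mul_rpow (by norm_num) hz0.le]
    exact Real.rpow_le_rpow (by positivity) (by linarith) (by positivity)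
  · rw [indicator_of_notMem hz, ENNReal.zero_rpow_of_pos hb0]
    exact zero_le

lemma riesz_eq_near_add_far (f : Euc n → ℝ≥0∞) (x : Euc n) (hf : Measurable f) (R : ℝ) :
    riesz f x = (∫⁻ y, f y * (ball (0 : Euc n) R).indicator newtonK (x - y)) +
      ∫⁻ y, f y * (ball (0 : Euc n) R)ᶜ.indicator newtonK (x - y) := by
  rw [← lintegral_add_left]
  · refine lintegral_congr fun y => ?_
    rw [← mul_add, ← Pi.add_apply, indicator_self_add_compl]
  · exact hf.mul ((measurable_newtonK.indicator measurableSet_ball).comp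
      (measurable_const.sub measurable_id))

/-- The far part of a potential, by Hölder's inequality. -/
lemma far_le {a a' : ℝ} (ha : a.HolderConjugate a') {f : Euc n → ℝ≥0∞} (hf : Measurable f)
    (hfa : ∫⁻ y, f y ^ a ≤ 1) {R : ℝ} (hR : 0 < R) (x : Euc n) :
    ∫⁻ y, f y * (ball (0 : Euc n) R)ᶜ.indicator newtonK (x - y) ≤
      (∫⁻ z, ((ball (0 : Euc n) 1)ᶜ.indicator newtonK z) ^ a') ^ (1 / a') *
        ENNReal.ofReal (R ^ ((n : ℝ) / a' - ((n - 2 : ℕ) : ℝ))) := by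
  have hm : Measurable (fun y => (ball (0 : Euc n) R)ᶜ.indicator newtonK (x - y)) :=
    (measurable_newtonK.indicator measurableSet_ball.compl).comp
      (measurable_const.sub measurable_id)
  have ha'0 : 0 < a' := ha.symm.pos
  refine (ENNReal.lintegral_mul_le_Lp_mul_Lq volume ha hf.aemeasurable hm.aemeasurable).trans ?_
  have h1 : (∫⁻ y, f y ^ a) ^ (1 / a) ≤ 1 := by
    refine (ENNReal.rpow_le_rpow hfa (by have := ha.pos; positivity)).trans ?_
    rw [ENNReal.one_rpow]
  have h2 : ∫⁻ y, ((ball (0 : Euc n) R)ᶜ.indicator newtonK (x - y)) ^ a' =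
      ∫⁻ z, ((ball (0 : Euc n) R)ᶜ.indicator newtonK z) ^ a' :=
    lintegral_sub_left_eq_self (fun z => ((ball (0 : Euc n) R)ᶜ.indicator newtonK z) ^ a') x
  rw [h2, lintegral_newtonK_rpow_exterior a' ha'0 hR,
    ENNReal.mul_rpow_of_nonneg _ _ (by positivity),
    ENNReal.ofReal_rpow_of_nonneg (by positivity) (by positivity), ← Real.rpow_mul hR.le]
  have e : ((n : ℝ) - ((n - 2 : ℕ) : ℝ) * a') * (1 / a') = (n : ℝ) / a' - ((n - 2 : ℕ) : ℝ) := by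
    field_simp
  rw [e]
  calc _ ≤ 1 * _ := mul_le_mul_left h1 _
    _ = _ := by rw [one_mul, mul_comm]

/-- One-dimensional integral used for the strong type estimate. -/
lemma lintegral_level_le {B e γ : ℝ} (hB : 0 < B) (he : -1 < e) (hγ : 0 < γ) (F : ℝ≥0∞) :
    ∫⁻ t in Ioi (0 : ℝ), ENNReal.ofReal (t ^ e) *
        (if ENNReal.ofReal (B * t ^ γ) < F then F else 0) ≤
      ENNReal.ofReal ((B⁻¹) ^ ((e + 1) / γ) / (e + 1)) * F ^ (1 + (e + 1) / γ) := by
  have he1 : 0 < e + 1 := by linarith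
  have hexp : 0 < 1 + (e + 1) / γ := by positivity
  rcases eq_or_ne F ⊤ with rfl | hF
  · rw [ENNReal.top_rpow_of_pos hexp, ENNReal.mul_top]
    · exact le_top
    · simp only [ne_eq, ENNReal.ofReal_eq_zero, not_le]; positivity
  obtain ⟨φ, hφ0, rfl⟩ : ∃ φ : ℝ, 0 ≤ φ ∧ F = ENNReal.ofReal φ :=
    ⟨F.toReal, ENNReal.toReal_nonneg, (ENNReal.ofReal_toReal hF).symm⟩
  rcases hφ0.eq_or_lt with rfl | hφ
  · simp
  -- T solves B T^γ = φ, so the integrand vanishes beyond T.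
  set T : ℝ := (φ * B⁻¹) ^ (1 / γ) with hT
  have hT0 : 0 < T := by positivity
  have hint : IntervalIntegrable (fun t : ℝ => t ^ e) volume 0 T :=
    intervalIntegral.intervalIntegrable_rpow' he
  have hone : ∫⁻ t in Ioc (0 : ℝ) T, ENNReal.ofReal (t ^ e) =
      ENNReal.ofReal (T ^ (e + 1) / (e + 1)) := by
    rw [← ofReal_integral_eq_lintegral_ofReal
      ((intervalIntegrable_iff_integrableOn_Ioc_of_le hT0.le).1 hint)
      ((ae_restrict_iff' measurableSet_Ioc).2 (Eventually.of_forall fun t ht =>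
        Real.rpow_nonneg ht.1.le e)),
      ← intervalIntegral.integral_of_le hT0.le, integral_rpow (Or.inl he),
      Real.zero_rpow he1.ne', sub_zero]
  calc ∫⁻ t in Ioi (0 : ℝ), ENNReal.ofReal (t ^ e) *
        (if ENNReal.ofReal (B * t ^ γ) < ENNReal.ofReal φ then ENNReal.ofReal φ else 0)
      ≤ ∫⁻ t in Ioi (0 : ℝ), (Ioc (0 : ℝ) T).indicator
          (fun t => ENNReal.ofReal φ * ENNReal.ofReal (t ^ e)) t := by
        refine setLIntegral_mono' measurableSet_Ioi fun t ht => ?_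
        have ht0 : (0 : ℝ) < t := ht
        split_ifs with h
        · have h' : B * t ^ γ < φ := (ENNReal.ofReal_lt_ofReal_iff hφ).1 h
          have htT : t ≤ T := by
            have : t ^ γ ≤ φ * B⁻¹ := by
              rw [← div_eq_mul_inv, le_div_iff₀ hB]; linarith
            calc t = (t ^ γ) ^ (1 / γ) := by
                  rw [← Real.rpow_mul ht0.le, mul_one_div_cancel hγ.ne', Real.rpow_one]
              _ ≤ T := Real.rpow_le_rpow (by positivity) this (by positivity)
          rw [indicator_of_mem (show t ∈ Ioc 0 T from ⟨ht0, htT⟩), mul_comm]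
        · simp
    _ ≤ ∫⁻ t, (Ioc (0 : ℝ) T).indicator
          (fun t => ENNReal.ofReal φ * ENNReal.ofReal (t ^ e)) t := setLIntegral_le_lintegral _ _
    _ = ENNReal.ofReal φ * ENNReal.ofReal (T ^ (e + 1) / (e + 1)) := by
        rw [lintegral_indicator measurableSet_Ioc, lintegral_const_mul' _ _ ENNReal.ofReal_ne_top,
          hone]
    _ = _ := by
        rw [ENNReal.ofReal_rpow_of_pos hφ, ← ENNReal.ofReal_mul hφ0,
          ← ENNReal.ofReal_mul (by positivity)]
        congr 1
        rw [hT, ← Real.rpow_mul (by positivity), Real.mul_rpow hφ0 (by positivity),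
          Real.rpow_add hφ, Real.rpow_one, one_div_mul_eq_div]
        ring

end HLS

section HLSMain

variable {n : ℕ}

/-- Level set estimate for a potential, splitting both the kernel and the density. -/
lemma measure_riesz_gt_le (hn : 3 ≤ n) {C R t τ : ℝ} {f : Euc n → ℝ≥0∞} (hf : Measurable f)
    (hR : 0 < R) (ht : 0 < t) (hτ : 0 ≤ τ) (hτR : τ * (R ^ 2 * C) ≤ t / 4)
    (hκ : ∫⁻ z, (ball (0 : Euc n) 1).indicator newtonK z ≤ ENNReal.ofReal C)
    (hfar : ∀ x, ∫⁻ y, f y * (ball (0 : Euc n) R)ᶜ.indicator newtonK (x - y) ≤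
      ENNReal.ofReal (t / 2)) :
    volume {x | ENNReal.ofReal t < riesz f x} ≤
      ENNReal.ofReal (4 / t * (R ^ 2 * C)) *
        ∫⁻ y, (if ENNReal.ofReal τ < f y then f y else 0) := by
  set k : Euc n → ℝ≥0∞ := (ball (0 : Euc n) R).indicator newtonK
  have hk : Measurable k := measurable_newtonK.indicator measurableSet_ball
  have hkint : ∫⁻ z, k z ≤ ENNReal.ofReal (R ^ 2 * C) := by
    rw [lintegral_newtonK_ball hn hR, ENNReal.ofReal_mul (by positivity)]
    gcongr
  set g : Euc n → ℝ≥0∞ := fun y => if ENNReal.ofReal τ < f y then f y else 0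
  have hg : Measurable g :=
    Measurable.ite (measurableSet_lt measurable_const hf) hf measurable_const
  have hfg : ∀ y, f y ≤ ENNReal.ofReal τ + g y := fun y => by
    simp only [g]
    split_ifs with h
    · exact le_add_self
    · simpa using h
  have hjoint : Measurable (fun q : Euc n × Euc n => g q.2 * k (q.1 - q.2)) :=
    (hg.comp measurable_snd).mul (hk.comp (measurable_fst.sub measurable_snd))
  have hnear : Measurable (fun x => ∫⁻ y, g y * k (x - y)) := hjoint.lintegral_prod_right
  have hkx : ∀ x, ∫⁻ y, k (x - y) = ∫⁻ z, k z := fun x => lintegral_sub_left_eq_self k x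
  -- Where the potential exceeds t, the far part accounts for at most t/2 and the part of the
  -- density below height τ, near x, for at most t/4. So g must contribute at least t/4, and
  -- Chebyshev with Tonelli bounds the measure of that set.
  have hsub : {x | ENNReal.ofReal t < riesz f x} ⊆
      {x | ENNReal.ofReal (t / 4) ≤ ∫⁻ y, g y * k (x - y)} := by
    intro x hx
    by_contra hcon
    have hcon' : ∫⁻ y, g y * k (x - y) < ENNReal.ofReal (t / 4) := not_le.1 hcon
    have hx' : ENNReal.ofReal t < riesz f x := hx
    have hmk : Measurable (fun y => k (x - y)) := hk.comp (measurable_const.sub measurable_id)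
    have h1 : ∫⁻ y, f y * k (x - y) ≤ ENNReal.ofReal (t / 4) + ∫⁻ y, g y * k (x - y) := by
      calc ∫⁻ y, f y * k (x - y)
          ≤ ∫⁻ y, (ENNReal.ofReal τ * k (x - y) + g y * k (x - y)) := by
            refine lintegral_mono fun y => ?_
            rw [← add_mul]
            exact mul_le_mul_left (hfg y) _
        _ = (ENNReal.ofReal τ * ∫⁻ z, k z) + ∫⁻ y, g y * k (x - y) := by
            rw [lintegral_add_left (hmk.const_mul _), lintegral_const_mul _ hmk, hkx]
        _ ≤ _ := by
            refine add_le_add_left ?_ _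
            calc ENNReal.ofReal τ * ∫⁻ z, k z
                ≤ ENNReal.ofReal τ * ENNReal.ofReal (R ^ 2 * C) := by gcongr
              _ = ENNReal.ofReal (τ * (R ^ 2 * C)) := (ENNReal.ofReal_mul hτ).symm
              _ ≤ _ := ENNReal.ofReal_le_ofReal hτR
    have h2 : riesz f x < ENNReal.ofReal t := by
      rw [riesz_eq_near_add_far f x hf R]
      calc _ ≤ (ENNReal.ofReal (t / 4) + ∫⁻ y, g y * k (x - y)) + ENNReal.ofReal (t / 2) :=
            add_le_add h1 (hfar x)
        _ < (ENNReal.ofReal (t / 4) + ENNReal.ofReal (t / 4)) + ENNReal.ofReal (t / 2) := by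
            refine ENNReal.add_lt_add_right ENNReal.ofReal_ne_top ?_
            exact ENNReal.add_lt_add_left ENNReal.ofReal_ne_top hcon'
        _ = ENNReal.ofReal t := by
            rw [← ENNReal.ofReal_add (by positivity) (by positivity),
              ← ENNReal.ofReal_add (by positivity) (by positivity)]
            congr 1; ring
    exact absurd hx' (not_lt.2 h2.le)
  have hcheb := mul_meas_ge_le_lintegral (μ := volume) hnear (ENNReal.ofReal (t / 4))
  have hswap : ∫⁻ x, ∫⁻ y, g y * k (x - y) = (∫⁻ y, g y) * ∫⁻ z, k z := by
    rw [lintegral_lintegral_swap hjoint.aemeasurable]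
    have : ∀ y, ∫⁻ x, g y * k (x - y) = g y * ∫⁻ z, k z := fun y => by
      have hm : Measurable (fun x => k (x - y)) := hk.comp (measurable_sub_const y)
      rw [lintegral_const_mul _ hm, lintegral_sub_right_eq_self k y]
    simp_rw [this]
    rw [lintegral_mul_const _ hg]
  calc volume {x | ENNReal.ofReal t < riesz f x}
      ≤ volume {x | ENNReal.ofReal (t / 4) ≤ ∫⁻ y, g y * k (x - y)} := measure_mono hsub
    _ = ENNReal.ofReal (4 / t) * (ENNReal.ofReal (t / 4) *
          volume {x | ENNReal.ofReal (t / 4) ≤ ∫⁻ y, g y * k (x - y)}) := by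
        rw [← mul_assoc, ← ENNReal.ofReal_mul (by positivity)]
        have : 4 / t * (t / 4) = 1 := by field_simp
        rw [this, ENNReal.ofReal_one, one_mul]
    _ ≤ ENNReal.ofReal (4 / t) * ((∫⁻ y, g y) * ENNReal.ofReal (R ^ 2 * C)) := by
        refine mul_le_mul_right ?_ _
        exact hcheb.trans (hswap.le.trans (mul_le_mul_right hkint _))
    _ = _ := by
        rw [ENNReal.ofReal_mul (p := 4 / t) (by positivity), mul_assoc, mul_comm (∫⁻ y, g y)]

/-- Layer cake bound for extended nonnegative functions. -/
lemma lintegral_rpow_le_lintegral_meas_gt {F : Euc n → ℝ≥0∞} (hF : Measurable F) {s : ℝ}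
    (hs : 0 < s) : ∫⁻ x, F x ^ s ≤ ENNReal.ofReal s *
      ∫⁻ t in Ioi (0 : ℝ), volume {x | ENNReal.ofReal t < F x} * ENNReal.ofReal (t ^ (s - 1)) := by
  -- F may be infinite; truncation at k reduces to the real-valued layer cake formula, and monotone
  -- convergence returns to F.
  have hsup : ∀ x, F x ^ s = ⨆ k : ℕ, (min (F x) k) ^ s := by
    intro x
    refine le_antisymm ?_ (iSup_le fun k => ENNReal.rpow_le_rpow (min_le_left _ _) hs.le)
    rcases eq_or_ne (F x) ⊤ with h | h
    · rw [h, ENNReal.top_rpow_of_pos hs]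
      have : ∀ k : ℕ, (k : ℝ≥0∞) ^ s ≤ ⨆ k : ℕ, (min ⊤ (k : ℝ≥0∞)) ^ s := fun k => by
        refine le_iSup_of_le k ?_
        simp
      have ht : Tendsto (fun k : ℕ => (k : ℝ≥0∞) ^ s) atTop (𝓝 (⊤ ^ s)) :=
        (ENNReal.continuous_rpow_const.tendsto ⊤).comp ENNReal.tendsto_nat_nhds_top
      rw [ENNReal.top_rpow_of_pos hs] at ht
      exact le_of_tendsto' ht this
    · obtain ⟨k, hk⟩ := ENNReal.exists_nat_gt h
      refine le_iSup_of_le k ?_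
      rw [min_eq_left hk.le]
  have hmeas : ∀ k : ℕ, Measurable (fun x => (min (F x) (k : ℝ≥0∞)) ^ s) := fun k =>
    (hF.min measurable_const).pow_const s
  simp_rw [hsup]
  rw [lintegral_iSup hmeas (fun i j hij x =>
    ENNReal.rpow_le_rpow (min_le_min le_rfl (by exact_mod_cast hij)) hs.le)]
  refine iSup_le fun k => ?_
  have hfin : ∀ x, min (F x) (k : ℝ≥0∞) ≠ ⊤ := fun x =>
    ((min_le_right _ _).trans_lt (ENNReal.natCast_lt_top k)).ne
  have e : ∀ x, (min (F x) (k : ℝ≥0∞)) ^ s =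
      ENNReal.ofReal ((min (F x) (k : ℝ≥0∞)).toReal ^ s) := fun x => by
    rw [← ENNReal.ofReal_rpow_of_nonneg ENNReal.toReal_nonneg hs.le, ENNReal.ofReal_toReal (hfin x)]
  simp_rw [e]
  rw [lintegral_rpow_eq_lintegral_meas_lt_mul volume
    (Eventually.of_forall fun x => ENNReal.toReal_nonneg)
    (hF.min measurable_const).ennreal_toReal.aemeasurable hs]
  refine mul_le_mul_right (setLIntegral_mono' measurableSet_Ioi fun t ht => ?_) _
  refine mul_le_mul_left (measure_mono fun x hx => ?_) _
  have hx' : t < (min (F x) (k : ℝ≥0∞)).toReal := hx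
  have : ENNReal.ofReal t < min (F x) k := (ENNReal.ofReal_lt_iff_lt_toReal (le_of_lt ht) (hfin x)).2 hx'
  exact this.trans_le (min_le_left _ _)

/-- The Hardy-Littlewood-Sobolev inequality for the Newton potential, normalised form. -/
theorem hls_normalised (hn : 3 ≤ n) {s : ℝ} (hs : (n : ℝ) / (n - 2) < s) :
    ∃ K : ℝ≥0∞, K ≠ ⊤ ∧ ∀ f : Euc n → ℝ≥0∞, Measurable f →
      ∫⁻ y, f y ^ (1 / s + 2 / n : ℝ)⁻¹ ≤ 1 → ∫⁻ x, riesz f x ^ s ≤ K := by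
  have hn0 : (3 : ℝ) ≤ n := by exact_mod_cast hn
  have hn1 : (0 : ℝ) < n := by linarith
  have hn2 : (0 : ℝ) < (n : ℝ) - 2 := by linarith
  have hcast : ((n - 2 : ℕ) : ℝ) = (n : ℝ) - 2 := by push_cast [show 2 ≤ n by omega]; ring
  have hs0 : 0 < s := lt_trans (by positivity) hs
  have hsn : (n : ℝ) < s * (n - 2) := (div_lt_iff₀ hn2).1 hs
  have hainv : (1 / s + 2 / n : ℝ) < 1 := by
    rw [div_add_div _ _ hs0.ne' hn1.ne', div_lt_one (by positivity)]
    linarith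
  set a : ℝ := (1 / s + 2 / n : ℝ)⁻¹ with ha
  have ha1 : 1 < a := one_lt_inv_iff₀.2 ⟨by positivity, hainv⟩
  set a' := a.conjExponent
  have hconj : a.HolderConjugate a' := Real.HolderConjugate.conjExponent ha1
  have ha'0 : 0 < a' := hconj.symm.pos
  have ha'inv : 1 / a' = 1 - 1 / s - 2 / n := by
    have := hconj.inv_add_inv_eq_one
    rw [ha, inv_inv] at this
    rw [one_div]; linarith
  have hexp : (n : ℝ) / a' - ((n - 2 : ℕ) : ℝ) = -(n / s) := by
    rw [hcast, div_eq_mul_one_div, ha'inv]; field_simp; ring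
  have hbn : (n : ℝ) < ((n - 2 : ℕ) : ℝ) * a' := by
    have h1 : (n : ℝ) / a' < ((n - 2 : ℕ) : ℝ) := by
      have : 0 < n / s := by positivity
      linarith
    exact (div_lt_iff₀ ha'0).1 h1
  set D := (∫⁻ z, ((ball (0 : Euc n) 1)ᶜ.indicator newtonK z) ^ a') ^ (1 / a')
  have hD : D < ⊤ := ENNReal.rpow_lt_top_of_nonneg (by positivity)
    (lintegral_newtonK_rpow_unit_exterior_lt_top hbn ha'0).ne
  set κ := ∫⁻ z, (ball (0 : Euc n) 1).indicator newtonK z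
  have hκ : κ < ⊤ := lintegral_newtonK_unit_ball_lt_top hn
  set C : ℝ := D.toReal + κ.toReal + 1
  have hC : 0 < C := by positivity
  have hDC : D ≤ ENNReal.ofReal C := by
    rw [ENNReal.le_ofReal_iff_toReal_le hD.ne hC.le]
    have := κ.toReal_nonneg
    simp only [C]; linarith
  have hκC : κ ≤ ENNReal.ofReal C := by
    rw [ENNReal.le_ofReal_iff_toReal_le hκ.ne hC.le]
    have := D.toReal_nonneg
    simp only [C]; linarith
  -- At level t the radius R = (t/(2C))^(-s/n) makes the far part at most t/2. Then R² =
  -- (t/(2C))^(-σ), and B is fixed by B t^(1+σ) R² C = t/4. The level set estimate carries the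
  -- weight A t^e, and e > -1 amounts to s > n/(n-2).
  set σ : ℝ := 2 * s / n with hσ
  have hσ0 : 0 < σ := by positivity
  set B : ℝ := 1 / (4 * C) * (1 / (2 * C)) ^ σ
  have hB : 0 < B := by positivity
  set e : ℝ := s - 2 - σ
  have he : -1 < e := by
    have : σ < s - 1 := by
      rw [hσ, div_lt_iff₀ hn1]; linarith
    simp only [e]; linarith
  set A : ℝ := 4 * C * (2 * C) ^ σ
  -- Because the truncation height depends on t, the integral over t produces the power f^a itself;
  -- the strong type bound thus needs no interpolation.
  have hae : 1 + (e + 1) / (1 + σ) = a := by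
    have : 1 / s + 2 / (n : ℝ) = (1 + σ) / s := by rw [hσ]; field_simp
    rw [ha, this, inv_div]
    simp only [e]
    field_simp; ring
  refine ⟨ENNReal.ofReal s * (ENNReal.ofReal A *
    ENNReal.ofReal ((B⁻¹) ^ ((e + 1) / (1 + σ)) / (e + 1))), by finiteness, fun f hf hfa => ?_⟩
  refine (lintegral_rpow_le_lintegral_meas_gt (measurable_riesz hf) hs0).trans ?_
  refine mul_le_mul_right ?_ _
  have hlevel : ∀ t ∈ Ioi (0 : ℝ),
      volume {x | ENNReal.ofReal t < riesz f x} * ENNReal.ofReal (t ^ (s - 1)) ≤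
        ENNReal.ofReal A * ∫⁻ y, ENNReal.ofReal (t ^ e) *
          (if ENNReal.ofReal (B * t ^ (1 + σ)) < f y then f y else 0) := by
    intro t ht
    have ht0 : (0 : ℝ) < t := ht
    set R : ℝ := (t / (2 * C)) ^ (-(s / n))
    have hR : 0 < R := by positivity
    have hR2 : R ^ 2 = (t / (2 * C)) ^ (-σ) := by
      simp only [R]
      rw [← Real.rpow_natCast, ← Real.rpow_mul (by positivity), hσ]
      congr 1; push_cast; ring
    have hRn : R ^ (-(n / s) : ℝ) = t / (2 * C) := by
      simp only [R]
      rw [← Real.rpow_mul (by positivity)]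
      have : -(s / (n : ℝ)) * -(n / s) = 1 := by field_simp
      rw [this, Real.rpow_one]
    have hfar : ∀ x, ∫⁻ y, f y * (ball (0 : Euc n) R)ᶜ.indicator newtonK (x - y) ≤
        ENNReal.ofReal (t / 2) := fun x => by
      refine (far_le hconj hf hfa hR x).trans ?_
      rw [hexp, hRn]
      calc D * ENNReal.ofReal (t / (2 * C))
          ≤ ENNReal.ofReal C * ENNReal.ofReal (t / (2 * C)) := by gcongr
        _ = ENNReal.ofReal (t / 2) := by
            rw [← ENNReal.ofReal_mul hC.le]; congr 1; field_simp
    have hpow : (t / (2 * C)) ^ (-σ) = t ^ (-σ) * (2 * C) ^ σ := by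
      rw [div_eq_mul_inv, Real.mul_rpow ht0.le (by positivity), Real.inv_rpow (by positivity),
        Real.rpow_neg (by positivity : (0 : ℝ) ≤ 2 * C), inv_inv]
    have hτR : B * t ^ (1 + σ) * (R ^ 2 * C) ≤ t / 4 := by
      refine le_of_eq ?_
      have h1 : t ^ σ * t ^ (-σ) = 1 := by
        rw [← Real.rpow_add ht0, add_neg_cancel, Real.rpow_zero]
      have h2 : (1 / (2 * C)) ^ σ * (2 * C) ^ σ = 1 := by
        rw [← Real.mul_rpow (by positivity) (by positivity), one_div_mul_cancel (by positivity),
          Real.one_rpow]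
      rw [hR2, hpow, Real.rpow_add ht0, Real.rpow_one]
      calc B * (t * t ^ σ) * (t ^ (-σ) * (2 * C) ^ σ * C)
          = 1 / (4 * C) * C * t * (t ^ σ * t ^ (-σ)) * ((1 / (2 * C)) ^ σ * (2 * C) ^ σ) := by
            simp only [B]; ring
        _ = t / 4 := by rw [h1, h2]; field_simp
    have hlev := measure_riesz_gt_le hn hf hR ht0 (by positivity) hτR hκC hfar
    set G := ∫⁻ y, (if ENNReal.ofReal (B * t ^ (1 + σ)) < f y then f y else 0) with hG
    have hgm : Measurable (fun y => if ENNReal.ofReal (B * t ^ (1 + σ)) < f y then f y else 0) :=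
      Measurable.ite (measurableSet_lt measurable_const hf) hf measurable_const
    rw [lintegral_const_mul _ hgm, ← hG, ← mul_assoc, ← ENNReal.ofReal_mul (by positivity)]
    calc _ ≤ ENNReal.ofReal (4 / t * (R ^ 2 * C)) * G * ENNReal.ofReal (t ^ (s - 1)) :=
          mul_le_mul_left hlev _
      _ = ENNReal.ofReal (4 / t * (R ^ 2 * C) * t ^ (s - 1)) * G := by
          rw [ENNReal.ofReal_mul (p := 4 / t * (R ^ 2 * C)) (by positivity)]; ring
      _ = _ := by
          congr 2
          have h3 : t ^ e = t⁻¹ * t ^ (-σ) * t ^ (s - 1) := by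
            rw [← Real.rpow_neg_one t, ← Real.rpow_add ht0, ← Real.rpow_add ht0]
            congr 1; simp only [e]; ring
          rw [hR2, hpow, h3]; simp only [A]; ring
  have hjoint : Measurable (fun q : ℝ × Euc n => ENNReal.ofReal (q.1 ^ e) *
      (if ENNReal.ofReal (B * q.1 ^ (1 + σ)) < f q.2 then f q.2 else 0)) := by
    refine Measurable.mul (by fun_prop) (Measurable.ite (measurableSet_lt (by fun_prop)
      (hf.comp measurable_snd)) (hf.comp measurable_snd) measurable_const)
  calc ∫⁻ t in Ioi (0 : ℝ), volume {x | ENNReal.ofReal t < riesz f x} *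
        ENNReal.ofReal (t ^ (s - 1))
      ≤ ∫⁻ t in Ioi (0 : ℝ), ENNReal.ofReal A * ∫⁻ y, ENNReal.ofReal (t ^ e) *
          (if ENNReal.ofReal (B * t ^ (1 + σ)) < f y then f y else 0) :=
        setLIntegral_mono' measurableSet_Ioi hlevel
    _ = ENNReal.ofReal A * ∫⁻ y, ∫⁻ t in Ioi (0 : ℝ), ENNReal.ofReal (t ^ e) *
          (if ENNReal.ofReal (B * t ^ (1 + σ)) < f y then f y else 0) := by
        rw [lintegral_const_mul _ hjoint.lintegral_prod_right,
          lintegral_lintegral_swap hjoint.aemeasurable]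
    _ ≤ ENNReal.ofReal A * ∫⁻ y, ENNReal.ofReal ((B⁻¹) ^ ((e + 1) / (1 + σ)) / (e + 1)) *
          f y ^ a := by
        gcongr with y
        have := lintegral_level_le hB he (by positivity : 0 < 1 + σ) (f y)
        rwa [hae] at this
    _ ≤ _ := by
        rw [lintegral_const_mul _ (hf.pow_const a)]
        gcongr
        exact mul_le_of_le_one_right' hfa

end HLSMain

/-! ### Regularity lifting -/

/-- The `L^s` norm of an extended nonnegative function. -/
noncomputable def lnorm {n : ℕ} (s : ℝ) (f : Euc n → ℝ≥0∞) : ℝ≥0∞ := (∫⁻ x, f x ^ s) ^ (1 / s)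

section Lifting

variable {n : ℕ}

lemma lnorm_mono {s : ℝ} (hs : 0 < s) {f g : Euc n → ℝ≥0∞} (h : ∀ᵐ x, f x ≤ g x) :
    lnorm s f ≤ lnorm s g := by
  refine ENNReal.rpow_le_rpow (lintegral_mono_ae ?_) (by positivity)
  filter_upwards [h] with x hx
  exact ENNReal.rpow_le_rpow hx hs.le

lemma lnorm_const_mul {s : ℝ} (hs : 0 < s) {c : ℝ≥0∞} (hc : c ≠ ⊤) (f : Euc n → ℝ≥0∞) :
    lnorm s (fun x => c * f x) = c * lnorm s f := by
  simp only [lnorm, ENNReal.mul_rpow_of_nonneg _ _ hs.le]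
  rw [lintegral_const_mul' _ _ (ENNReal.rpow_ne_top_of_nonneg hs.le hc),
    ENNReal.mul_rpow_of_nonneg _ _ (by positivity), ← ENNReal.rpow_mul,
    mul_one_div_cancel hs.ne', ENNReal.rpow_one]

lemma lnorm_rpow {s : ℝ} (hs : 0 < s) (f : Euc n → ℝ≥0∞) : lnorm s f ^ s = ∫⁻ x, f x ^ s := by
  rw [lnorm, ← ENNReal.rpow_mul, one_div_mul_cancel hs.ne', ENNReal.rpow_one]

lemma lnorm_add_le {s : ℝ} (hs : 1 ≤ s) {f g : Euc n → ℝ≥0∞} (hf : Measurable f)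
    (hg : Measurable g) : lnorm s (fun x => f x + g x) ≤ lnorm s f + lnorm s g :=
  ENNReal.lintegral_Lp_add_le hf.aemeasurable hg.aemeasurable hs

lemma riesz_const_mul {c : ℝ≥0∞} (hc : c ≠ ⊤) (f : Euc n → ℝ≥0∞) (x : Euc n) :
    riesz (fun y => c * f y) x = c * riesz f x := by
  simp only [riesz, mul_assoc]
  rw [lintegral_const_mul' _ _ hc]

lemma riesz_add {f g : Euc n → ℝ≥0∞} (hf : Measurable f) (x : Euc n) :
    riesz (fun y => f y + g y) x = riesz f x + riesz g x := by
  simp only [riesz, add_mul]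
  exact lintegral_add_left (hf.mul (measurable_newtonK.comp (measurable_const.sub measurable_id))) _

lemma riesz_mono {f g : Euc n → ℝ≥0∞} (h : ∀ y, f y ≤ g y) (x : Euc n) :
    riesz f x ≤ riesz g x :=
  lintegral_mono fun y => mul_le_mul_left (h y) _

lemma sobolev_exponent (hn : 3 ≤ n) {s : ℝ} (hs : (n : ℝ) / (n - 2) < s) :
    0 < s ∧ 1 < s ∧ 0 < (1 / s + 2 / n : ℝ)⁻¹ ∧ (1 / s + 2 / n : ℝ)⁻¹ < s := by
  have hn0 : (3 : ℝ) ≤ n := by exact_mod_cast hn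
  have hn2 : (0 : ℝ) < (n : ℝ) - 2 := by linarith
  have hn1 : (0 : ℝ) < n := by linarith
  have h1 : 1 < (n : ℝ) / (n - 2) := by rw [one_lt_div hn2]; linarith
  have hs1 : 1 < s := h1.trans hs
  have hs0 : 0 < s := by linarith
  refine ⟨hs0, hs1, by positivity, ?_⟩
  rw [inv_lt_comm₀ (by positivity) hs0, ← one_div]
  have : 0 < 2 / (n : ℝ) := by positivity
  linarith

/-- The Hardy-Littlewood-Sobolev inequality for the Newton potential. -/
theorem hls (hn : 3 ≤ n) {s : ℝ} (hs : (n : ℝ) / (n - 2) < s) :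
    ∃ K : ℝ≥0∞, K ≠ ⊤ ∧ ∀ f : Euc n → ℝ≥0∞, Measurable f →
      lnorm s (riesz f) ≤ K * lnorm (1 / s + 2 / n : ℝ)⁻¹ f := by
  obtain ⟨hs0, -, ha0, -⟩ := sobolev_exponent hn hs
  obtain ⟨K, hK, hKf⟩ := hls_normalised hn hs
  set a : ℝ := (1 / s + 2 / n : ℝ)⁻¹
  -- The summand 1 keeps the constant nonzero, so that the right side is ⊤ when the norm of f is.
  refine ⟨K ^ (1 / s) + 1, by finiteness, fun f hf => ?_⟩
  set A := lnorm a f with hA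
  rcases eq_or_ne A ⊤ with hAt | hAt
  · rw [hAt, ENNReal.mul_top (by simp)]
    exact le_top
  rcases eq_or_ne A 0 with hA0 | hA0
  · have h0 : f =ᵐ[volume] 0 := by
      have h1 : ∫⁻ x, f x ^ a = 0 := by
        rw [← lnorm_rpow ha0, ← hA, hA0, ENNReal.zero_rpow_of_pos ha0]
      filter_upwards [(lintegral_eq_zero_iff (hf.pow_const a)).1 h1] with x hx
      simpa [ha0, ha0.not_gt] using hx
    have h1 : ∀ x, riesz f x = 0 := fun x => by
      rw [riesz, lintegral_congr_ae (g := fun _ => 0) (by filter_upwards [h0] with y hy; simp [hy])]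
      simp
    have h2 : lnorm s (riesz f) = 0 := by simp [lnorm, h1, hs0]
    rw [h2]; exact zero_le
  · set g : Euc n → ℝ≥0∞ := fun y => A⁻¹ * f y
    have hg : Measurable g := hf.const_mul _
    have hAi : A⁻¹ ≠ ⊤ := ENNReal.inv_ne_top.2 hA0
    have hga : ∫⁻ y, g y ^ a ≤ 1 := by
      rw [← lnorm_rpow ha0, lnorm_const_mul ha0 hAi, ENNReal.inv_mul_cancel hA0 hAt,
        ENNReal.one_rpow]
    have hfg : ∀ x, riesz f x = A * riesz g x := fun x => by
      rw [← riesz_const_mul hAt]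
      congr 1; ext y
      simp only [g]
      rw [← mul_assoc, ENNReal.mul_inv_cancel hA0 hAt, one_mul]
    have h1 : lnorm s (riesz f) = A * lnorm s (riesz g) := by
      rw [← lnorm_const_mul hs0 hAt]; congr 1; ext x; exact hfg x
    rw [h1, mul_comm]
    gcongr
    exact (ENNReal.rpow_le_rpow (hKf g hg hga) (by positivity)).trans le_self_add

/-- The Hardy-Littlewood-Sobolev inequality combined with Hölder's inequality. -/
theorem hls_mul (hn : 3 ≤ n) {s : ℝ} (hs : (n : ℝ) / (n - 2) < s) :
    ∃ K : ℝ≥0∞, K ≠ ⊤ ∧ ∀ W f : Euc n → ℝ≥0∞, Measurable W → Measurable f →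
      lnorm s (riesz fun y => W y * f y) ≤ K * lnorm (n / 2 : ℝ) W * lnorm s f := by
  obtain ⟨hs0, -, ha0, has⟩ := sobolev_exponent hn hs
  have hn1 : (0 : ℝ) < n := by
    have : (3 : ℝ) ≤ n := by exact_mod_cast hn
    linarith
  obtain ⟨K, hK, hKf⟩ := hls hn hs
  refine ⟨K, hK, fun W f hW hf => (hKf _ (hW.mul hf)).trans ?_⟩
  rw [mul_assoc]
  refine mul_le_mul_right ?_ _
  have := ENNReal.lintegral_Lp_mul_le_Lq_mul_Lr (p := (1 / s + 2 / n : ℝ)⁻¹) (q := s)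
    (r := (n / 2 : ℝ)) ha0 has (by rw [one_div, inv_inv, one_div_div]) volume
    hf.aemeasurable hW.aemeasurable
  rw [mul_comm (lnorm _ W)]
  refine le_trans (le_of_eq ?_) this
  simp only [lnorm, Pi.mul_apply, mul_comm]

/-- Regularity lifting: integrability of solutions of `u = c I(V I(V u))` with `V ∈ L^(n/2)`. -/
theorem regularity_lifting (hn : 3 ≤ n) {q s : ℝ} (hq : (n : ℝ) / (n - 2) < q)
    (hs : (n : ℝ) / (n - 2) < s) {V u : Euc n → ℝ≥0∞} (hV : Measurable V) (hu : Measurable u)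
    (hut : ∀ x, u x ≠ ⊤) {c : ℝ≥0∞} (hc : c ≠ ⊤) (hVn : lnorm (n / 2 : ℝ) V ≠ ⊤)
    (huq : lnorm q u ≠ ⊤)
    (hb : ∀ k : ℕ, ∃ M : ℝ≥0∞, M ≠ ⊤ ∧ ∀ x, u x ≤ k → V x * u x ≤ M)
    (heq : ∀ x, u x = c * riesz (fun y => V y * riesz (fun z => V z * u z) y) x) :
    lnorm s u ≠ ⊤ := by
  obtain ⟨hs0, hs1, ha0, has⟩ := sobolev_exponent hn hs
  obtain ⟨hq0, -, -, -⟩ := sobolev_exponent hn hq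
  have hn1 : (0 : ℝ) < n := by
    have : (3 : ℝ) ≤ n := by exact_mod_cast hn
    linarith
  obtain ⟨Kq, hKq, hKqf⟩ := hls_mul (n := n) hn hq
  obtain ⟨Ks, hKs, hKsf⟩ := hls_mul (n := n) hn hs
  obtain ⟨K', hK', hKf'⟩ := hls (n := n) hn hs
  -- These sets exhaust the space because u is finite. Off E k the L^(n/2) norm of V tends to 0; on
  -- E k the product V u is bounded and has bounded support, hence lies in every Lebesgue space.
  set E : ℕ → Set (Euc n) := fun k => {x | ‖x‖ ≤ k ∧ u x ≤ k}
  have hE : ∀ k, MeasurableSet (E k) := fun k =>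
    (measurableSet_le measurable_norm measurable_const).inter
      (measurableSet_le hu measurable_const)
  have hV1m : ∀ k, Measurable ((E k)ᶜ.indicator V) := fun k => hV.indicator (hE k).compl
  have hV2m : ∀ k, Measurable ((E k).indicator V) := fun k => hV.indicator (hE k)
  have hVint : ∫⁻ x, V x ^ (n / 2 : ℝ) ≠ ⊤ := by
    rw [← lnorm_rpow (by positivity)]
    exact ENNReal.rpow_ne_top_of_nonneg (by positivity) hVn
  have hsmall : Tendsto (fun k => lnorm (n / 2 : ℝ) ((E k)ᶜ.indicator V)) atTop (𝓝 0) := by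
    have h1 : Tendsto (fun k => ∫⁻ x, ((E k)ᶜ.indicator V x) ^ (n / 2 : ℝ)) atTop
        (𝓝 (∫⁻ _ : Euc n, 0)) := by
      refine tendsto_lintegral_of_dominated_convergence (fun x => V x ^ (n / 2 : ℝ))
        (fun k => (hV1m k).pow_const _) (fun k => Eventually.of_forall fun x =>
          ENNReal.rpow_le_rpow (indicator_le_self _ _ _) (by positivity)) hVint
        (Eventually.of_forall fun x => ?_)
      obtain ⟨k₁, hk₁⟩ := exists_nat_gt ‖x‖
      obtain ⟨k₂, hk₂⟩ := ENNReal.exists_nat_gt (hut x)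
      refine tendsto_const_nhds.congr' ?_
      filter_upwards [eventually_ge_atTop (max k₁ k₂)] with k hk
      have hx : x ∈ E k := by
        refine ⟨hk₁.le.trans ?_, hk₂.le.trans ?_⟩
        · exact_mod_cast (le_max_left _ _).trans hk
        · exact_mod_cast (le_max_right _ _).trans hk
      rw [indicator_of_notMem (by simpa using hx), ENNReal.zero_rpow_of_pos (by positivity)]
    rw [lintegral_zero] at h1
    have h2 := (ENNReal.continuous_rpow_const (y := 1 / (n / 2 : ℝ))).tendsto 0
    rw [ENNReal.zero_rpow_of_pos (by positivity)] at h2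
    exact h2.comp h1
  have hsmall' : ∀ K : ℝ≥0∞, K ≠ ⊤ → ∀ᶠ k in atTop,
      c * (K * lnorm (n / 2 : ℝ) V * (K * lnorm (n / 2 : ℝ) ((E k)ᶜ.indicator V))) ≤ 2⁻¹ := by
    intro K hK
    have hfin : c * (K * lnorm (n / 2 : ℝ) V * K) ≠ ⊤ := by finiteness
    have := ENNReal.Tendsto.const_mul (a := c * (K * lnorm (n / 2 : ℝ) V * K)) hsmall
      (Or.inr hfin)
    rw [mul_zero] at this
    filter_upwards [this.eventually (ge_mem_nhds (show (0 : ℝ≥0∞) < 2⁻¹ by simp))] with k hk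
    refine le_trans (le_of_eq ?_) hk
    ring
  -- One k must serve both exponents: S has to contract in L^q, where u is known to lie, and in L^s,
  -- where it is sought.
  obtain ⟨k, hkq, hks⟩ := ((hsmall' Kq hKq).and (hsmall' Ks hKs)).exists
  set V₁ := (E k)ᶜ.indicator V
  set V₂ := (E k).indicator V
  set S : (Euc n → ℝ≥0∞) → Euc n → ℝ≥0∞ := fun f x =>
    c * riesz (fun y => V y * riesz (fun z => V₁ z * f z) y) x
  set F : Euc n → ℝ≥0∞ := fun x => c * riesz (fun y => V y * riesz (fun z => V₂ z * u z) y) x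
  have hSm : ∀ f, Measurable f → Measurable (S f) := fun f hf =>
    (measurable_riesz (hV.mul (measurable_riesz ((hV1m k).mul hf)))).const_mul c
  have hFm : Measurable F :=
    (measurable_riesz (hV.mul (measurable_riesz ((hV2m k).mul hu)))).const_mul c
  have hScontr : ∀ {r : ℝ} {K : ℝ≥0∞}, 0 < r →
      (∀ W f : Euc n → ℝ≥0∞, Measurable W → Measurable f →
        lnorm r (riesz fun y => W y * f y) ≤ K * lnorm (n / 2 : ℝ) W * lnorm r f) →
      c * (K * lnorm (n / 2 : ℝ) V * (K * lnorm (n / 2 : ℝ) V₁)) ≤ 2⁻¹ →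
      ∀ f, Measurable f → lnorm r (S f) ≤ 2⁻¹ * lnorm r f := by
    intro r K hr hKr hle f hf
    simp only [S]
    rw [lnorm_const_mul hr hc]
    calc c * lnorm r (riesz fun y => V y * riesz (fun z => V₁ z * f z) y)
        ≤ c * (K * lnorm (n / 2 : ℝ) V * (K * lnorm (n / 2 : ℝ) V₁ * lnorm r f)) := by
          refine mul_le_mul_right ((hKr _ _ hV (measurable_riesz ((hV1m k).mul hf))).trans ?_) _
          exact mul_le_mul_right (hKr _ _ (hV1m k) hf) _
      _ = c * (K * lnorm (n / 2 : ℝ) V * (K * lnorm (n / 2 : ℝ) V₁)) * lnorm r f := by ring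
      _ ≤ _ := mul_le_mul_left hle _
  have hSq := hScontr hq0 hKqf hkq
  have hSs := hScontr hs0 hKsf hks
  have hFs : lnorm s F ≠ ⊤ := by
    have h1 : lnorm (1 / s + 2 / n : ℝ)⁻¹ (fun z => V₂ z * u z) ≠ ⊤ := by
      obtain ⟨M, hM, hMle⟩ := hb k
      refine ENNReal.rpow_ne_top_of_nonneg (by positivity) ?_
      have h2 : ∀ z, (V₂ z * u z) ^ (1 / s + 2 / n : ℝ)⁻¹ ≤
          (closedBall (0 : Euc n) k).indicator (fun _ => M ^ (1 / s + 2 / n : ℝ)⁻¹) z := by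
        intro z
        by_cases hz : z ∈ E k
        · rw [indicator_of_mem (show z ∈ closedBall (0 : Euc n) k by simpa using hz.1)]
          simp only [V₂]
          rw [indicator_of_mem hz]
          exact ENNReal.rpow_le_rpow (hMle z hz.2) ha0.le
        · simp only [V₂]
          rw [indicator_of_notMem hz, zero_mul, ENNReal.zero_rpow_of_pos ha0]
          exact zero_le
      refine ((lintegral_mono h2).trans_lt ?_).ne
      rw [lintegral_indicator measurableSet_closedBall, setLIntegral_const]
      exact ENNReal.mul_lt_top (ENNReal.rpow_lt_top_of_nonneg ha0.le hM)
        measure_closedBall_lt_top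
    simp only [F]
    rw [lnorm_const_mul hs0 hc]
    refine ENNReal.mul_ne_top hc (ne_top_of_le_ne_top ?_
      ((hKsf _ _ hV (measurable_riesz ((hV2m k).mul hu))).trans
        (mul_le_mul_right (hKf' _ ((hV2m k).mul hu)) _)))
    finiteness
  have huSF : ∀ x, u x = S u x + F x := by
    intro x
    simp only [S, F]
    have hm₁ : Measurable fun z => V₁ z * u z := (hV1m k).mul hu
    have hm₂ : Measurable fun y => V y * riesz (fun z => V₁ z * u z) y :=
      hV.mul (measurable_riesz hm₁)
    rw [heq x, ← mul_add, ← riesz_add hm₂]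
    congr 2; ext y
    rw [← mul_add, ← riesz_add hm₁]
    congr 2; ext z
    rw [← add_mul]
    congr 1
    have := congrFun (indicator_self_add_compl (E k) V) z
    rw [← this, Pi.add_apply, add_comm]
  have hSadd : ∀ f g, Measurable f → ∀ x, S (fun y => f y + g y) x = S f x + S g x := by
    intro f g hf x
    simp only [S]
    have hm₁ : Measurable fun z => V₁ z * f z := (hV1m k).mul hf
    have hm₂ : Measurable fun y => V y * riesz (fun z => V₁ z * f z) y :=
      hV.mul (measurable_riesz hm₁)
    rw [← mul_add, ← riesz_add hm₂]
    congr 2; ext y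
    rw [← mul_add, ← riesz_add hm₁]
    congr 2; ext z
    rw [mul_add]
  have hSmono : ∀ f g, (∀ y, f y ≤ g y) → ∀ x, S f x ≤ S g x := fun f g hfg x =>
    mul_le_mul_right (riesz_mono (fun y => mul_le_mul_right (riesz_mono
      (fun z => mul_le_mul_right (hfg z) _) y) _) x) _
  -- Partial sums of the Neumann series for f = S f + F, increasing and bounded in L^s by twice the
  -- norm of F. Since u = S^j u + T j and S^j u tends to 0 in L^q, their supremum H dominates u
  -- almost everywhere.
  set T : ℕ → Euc n → ℝ≥0∞ := fun j => (fun g x => S g x + F x)^[j] (fun _ => 0)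
  have hTsucc : ∀ j, T (j + 1) = fun x => S (T j) x + F x := fun j =>
    Function.iterate_succ_apply' _ _ _
  have hTm : ∀ j, Measurable (T j) := by
    intro j
    induction j with
    | zero => exact measurable_const
    | succ j ih => rw [hTsucc]; exact (hSm _ ih).add hFm
  have hTmono : ∀ j x, T j x ≤ T (j + 1) x := by
    intro j
    induction j with
    | zero => intro x; exact zero_le
    | succ j ih =>
      intro x
      rw [hTsucc j, hTsucc (j + 1)]
      exact add_le_add (hSmono _ _ ih x) le_rfl
  have hTnorm : ∀ j, lnorm s (T j) ≤ 2 * lnorm s F := by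
    intro j
    induction j with
    | zero =>
      have : lnorm s (T 0) = 0 := by simp [T, lnorm, hs0]
      rw [this]; exact zero_le
    | succ j ih =>
      rw [hTsucc]
      refine (lnorm_add_le hs1.le (hSm _ (hTm j)) hFm).trans ?_
      calc lnorm s (S (T j)) + lnorm s F ≤ 2⁻¹ * (2 * lnorm s F) + lnorm s F := by
            gcongr; exact (hSs _ (hTm j)).trans (mul_le_mul_right ih _)
        _ = 2 * lnorm s F := by
            rw [← mul_assoc, ENNReal.inv_mul_cancel (by simp) (by simp), one_mul, two_mul]
  have hSit : ∀ j, Measurable (S^[j] u) ∧ lnorm q (S^[j] u) ≤ 2⁻¹ ^ j * lnorm q u ∧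
      ∀ x, u x = (S^[j] u) x + T j x := by
    intro j
    induction j with
    | zero => exact ⟨hu, by simp, fun x => by simp [T]⟩
    | succ j ih =>
      obtain ⟨h1, h2, h3⟩ := ih
      rw [Function.iterate_succ_apply']
      refine ⟨hSm _ h1, ?_, fun x => ?_⟩
      · refine (hSq _ h1).trans ((mul_le_mul_right h2 _).trans (le_of_eq ?_))
        rw [pow_succ]; ring
      · rw [hTsucc, ← add_assoc, ← hSadd _ _ h1]
        have : (fun y => (S^[j] u) y + T j y) = u := funext fun y => (h3 y).symm
        rw [this]; exact huSF x
  set H : Euc n → ℝ≥0∞ := fun x => ⨆ j, T j x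
  have hHm : Measurable H := Measurable.iSup hTm
  have hHnorm : lnorm s H ≤ 2 * lnorm s F := by
    have h1 : ∫⁻ x, H x ^ s = ⨆ j, ∫⁻ x, T j x ^ s := by
      rw [← lintegral_iSup (fun j => (hTm j).pow_const s)
        (monotone_nat_of_le_succ fun j x => ENNReal.rpow_le_rpow (hTmono j x) hs0.le)]
      refine lintegral_congr fun x => ?_
      exact (ENNReal.orderIsoRpow s hs0).map_iSup _
    have h2 : ∫⁻ x, H x ^ s ≤ (2 * lnorm s F) ^ s := by
      rw [h1]
      refine iSup_le fun j => ?_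
      rw [← lnorm_rpow hs0]
      exact ENNReal.rpow_le_rpow (hTnorm j) hs0.le
    calc lnorm s H ≤ ((2 * lnorm s F) ^ s) ^ (1 / s) := ENNReal.rpow_le_rpow h2 (by positivity)
      _ = _ := by rw [← ENNReal.rpow_mul, mul_one_div_cancel hs0.ne', ENNReal.rpow_one]
  have hdiff : lnorm q (fun x => u x - H x) = 0 := by
    have hle : ∀ j, lnorm q (fun x => u x - H x) ≤ 2⁻¹ ^ j * lnorm q u := fun j => by
      refine (lnorm_mono hq0 (Eventually.of_forall fun x => ?_)).trans (hSit j).2.1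
      rw [tsub_le_iff_right]
      calc u x = (S^[j] u) x + T j x := (hSit j).2.2 x
        _ ≤ _ := by gcongr; exact le_iSup (fun j => T j x) j
    have hlim : Tendsto (fun j : ℕ => (2⁻¹ : ℝ≥0∞) ^ j * lnorm q u) atTop (𝓝 (0 * lnorm q u)) :=
      ENNReal.Tendsto.mul_const (ENNReal.tendsto_pow_atTop_nhds_zero_of_lt_one (by simp))
        (Or.inr huq)
    rw [zero_mul] at hlim
    exact le_antisymm (ge_of_tendsto' hlim hle) zero_le
  have hae : ∀ᵐ x, u x ≤ H x := by
    have h1 : ∫⁻ x, (u x - H x) ^ q = 0 := by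
      rw [← lnorm_rpow hq0 (fun x => u x - H x), hdiff, ENNReal.zero_rpow_of_pos hq0]
    filter_upwards [(lintegral_eq_zero_iff ((hu.sub hHm).pow_const q)).1 h1] with x hx
    have : u x - H x = 0 := by simpa [hq0, hq0.not_gt] using hx
    exact tsub_eq_zero_iff_le.1 this
  exact ne_top_of_le_ne_top (by finiteness) ((lnorm_mono hs0 hae).trans hHnorm)

end Lifting

/-! ### Continuity of Newton potentials -/

section Continuity

variable {n : ℕ}

lemma lintegral_newtonK_rpow_unit_ball_lt_top (hn : 3 ≤ n) {b : ℝ} (hb0 : 0 < b)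
    (hb : ((n - 2 : ℕ) : ℝ) * b < n) :
    ∫⁻ z, ((ball (0 : Euc n) 1).indicator newtonK z) ^ b < ⊤ := by
  have h := integrableOn_ball_of_norm_le_rpow (μ := (volume : Measure (Euc n)))
    (f := fun z : Euc n => newton 0 z ^ b) (C := 1) (r := 1) (by simp; omega) (by simpa using hb)
    (Eventually.of_forall fun y => by
      have h0 := newton_nonneg (0 : Euc n) y
      rw [Real.norm_of_nonneg (by positivity), newton, zero_sub, norm_neg,
        Real.inv_rpow (by positivity), ← Real.rpow_natCast, ← Real.rpow_mul (norm_nonneg _),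
        Real.rpow_neg (norm_nonneg _), one_mul])
    ((measurable_newton_right 0).pow_const b).aestronglyMeasurable
  have h2 := (hasFiniteIntegral_iff_ofReal (Eventually.of_forall fun y =>
    Real.rpow_nonneg (newton_nonneg (0 : Euc n) y) b)).1 h.2
  rw [← lintegral_indicator measurableSet_ball] at h2
  refine lt_of_le_of_lt (lintegral_mono fun z => ?_) h2
  by_cases hz : z ∈ ball (0 : Euc n) 1
  · rw [indicator_of_mem hz, indicator_of_mem hz, newtonK,
      ENNReal.ofReal_rpow_of_nonneg (by positivity) hb0.le, newton, zero_sub, norm_neg]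
  · rw [indicator_of_notMem hz, indicator_of_notMem hz, ENNReal.zero_rpow_of_pos hb0]

lemma exists_lintegral_newtonK_rpow_ball_le (hn : 3 ≤ n) {b : ℝ} (hb0 : 0 < b)
    (hb : ((n - 2 : ℕ) : ℝ) * b < n) {ε : ℝ≥0∞} (hε : ε ≠ 0) :
    ∃ ρ : ℝ, 0 < ρ ∧ ∫⁻ z, ((ball (0 : Euc n) ρ).indicator newtonK z) ^ b ≤ ε := by
  obtain ⟨δ, hδ, hδf⟩ := exists_pos_setLIntegral_lt_of_measure_lt
    (lintegral_newtonK_rpow_unit_ball_lt_top hn hb0 hb).ne hε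
  have hmin : min δ 1 ≠ ⊤ := ne_top_of_le_ne_top ENNReal.one_ne_top (min_le_right _ _)
  have hhalf : min δ 1 / 2 ≠ ⊤ := ENNReal.div_ne_top hmin (by simp)
  have hδ' : 0 < (min δ 1 / 2).toReal := by
    have : min δ 1 / 2 ≠ 0 := by
      simp only [ne_eq, ENNReal.div_eq_zero_iff, not_or]
      exact ⟨(lt_min hδ one_pos).ne', by simp⟩
    exact ENNReal.toReal_pos this hhalf
  obtain ⟨η, hη, hη1, hv⟩ := exists_shell_small (n := n) 0 hδ'
  have hlt : volume (ball (0 : Euc n) η) < δ := by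
    have hsub : (ball (0 : Euc n) η : Set (Euc n)) ≤ᵐ[volume] {y | 0 < ‖y‖ ∧ ‖y‖ < 0 + η} := by
      filter_upwards [ae_ne_point hn 0] with y hy hyb
      exact show 0 < ‖y‖ ∧ ‖y‖ < 0 + η from ⟨norm_pos_iff.2 hy, by
        rw [zero_add]; exact mem_ball_zero_iff.1 hyb⟩
    refine ((measure_mono_ae hsub).trans hv).trans_lt ?_
    rw [ENNReal.ofReal_toReal hhalf]
    refine lt_of_lt_of_le (ENNReal.half_lt_self (lt_min hδ one_pos).ne' hmin)
      (min_le_left _ _)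
  refine ⟨η, hη, le_trans (le_of_eq ?_) (hδf _ hlt).le⟩
  rw [← lintegral_indicator measurableSet_ball]
  refine lintegral_congr fun z => ?_
  by_cases hz : z ∈ ball (0 : Euc n) η
  · rw [indicator_of_mem hz, indicator_of_mem hz, indicator_of_mem (ball_subset_ball hη1 hz)]
  · rw [indicator_of_notMem hz, indicator_of_notMem hz, ENNReal.zero_rpow_of_pos hb0]

/-- The Newton potential of an `L^r` density is continuous if `r > n / 2`. -/
theorem continuous_newton_potential (hn : 3 ≤ n) {f : Euc n → ℝ} (hf : Measurable f)
    (hf0 : ∀ y, 0 ≤ f y) (hint : ∀ x, Integrable (fun y => f y * newton x y)) {r : ℝ}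
    (hr : (n : ℝ) / 2 < r) (hfr : ∫⁻ y, ENNReal.ofReal (f y) ^ r ≠ ⊤) :
    Continuous fun x => ∫ y, f y * newton x y := by
  have hn0 : (3 : ℝ) ≤ n := by exact_mod_cast hn
  have hn2 : ((n - 2 : ℕ) : ℝ) = (n : ℝ) - 2 := by push_cast [show 2 ≤ n by omega]; ring
  have hr1 : 1 < r := by linarith
  have hr0 : 0 < r := by linarith
  set b : ℝ := r.conjExponent with hbdef
  have hconj : r.HolderConjugate b := Real.HolderConjugate.conjExponent hr1
  have hb0 : 0 < b := hconj.symm.pos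
  have hbn : ((n - 2 : ℕ) : ℝ) * b < n := by
    rw [hn2, hbdef, Real.conjExponent, mul_div_assoc', div_lt_iff₀ (by linarith)]
    nlinarith
  -- The kernel truncated at distance ρ is continuous in x and agrees with the Newton kernel for ‖x
  -- - y‖ ≥ ρ.
  set k : ℝ → Euc n → Euc n → ℝ := fun ρ x y => ((max ‖x - y‖ ρ) ^ (n - 2))⁻¹ with hk
  have hk0 : ∀ ρ x y, 0 < ρ → 0 ≤ k ρ x y := fun ρ x y hρ => by
    have : 0 < max ‖x - y‖ ρ := lt_max_of_lt_right hρ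
    simp only [hk]; positivity
  have hkm : ∀ ρ x, Measurable (k ρ x) := fun ρ x => by simp only [hk]; fun_prop
  have hkc : ∀ ρ, 0 < ρ → ∀ y, Continuous fun x => k ρ x y := fun ρ hρ y => by
    simp only [hk]
    refine Continuous.inv₀ (by fun_prop) fun x => ?_
    have : 0 < max ‖x - y‖ ρ := lt_max_of_lt_right hρ
    positivity
  -- For x within ρ of x0, max(‖x - y‖, ρ) is at least half of ‖x0 - y‖; this supplies the majorant
  -- for dominated convergence.
  have hkle : ∀ ρ, 0 < ρ → ∀ x0 x y, y ≠ x0 → ‖x - x0‖ < ρ →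
      k ρ x y ≤ 2 ^ (n - 2) * newton x0 y := by
    intro ρ hρ x0 x y hy hx
    have h1 : 0 < ‖x0 - y‖ := norm_pos_iff.2 (sub_ne_zero.2 hy.symm)
    have h2 : ‖x0 - y‖ / 2 ≤ max ‖x - y‖ ρ := by
      have : ‖x0 - y‖ ≤ ‖x - y‖ + ‖x - x0‖ := by
        rw [add_comm, norm_sub_rev x x0]
        exact norm_sub_le_norm_sub_add_norm_sub _ _ _
      have := le_max_left ‖x - y‖ ρ
      have := le_max_right ‖x - y‖ ρ
      linarith
    calc k ρ x y ≤ ((‖x0 - y‖ / 2) ^ (n - 2))⁻¹ := by simp only [hk]; gcongr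
      _ = _ := by rw [newton, div_pow, inv_div, div_eq_mul_inv]
  have hkint : ∀ ρ, 0 < ρ → ∀ x, Integrable (fun y => f y * k ρ x y) := by
    intro ρ hρ x
    refine ((hint x).const_mul (2 ^ (n - 2))).mono' (hf.mul (hkm ρ x)).aestronglyMeasurable ?_
    filter_upwards [ae_ne_point hn x] with y hy
    rw [Real.norm_of_nonneg (mul_nonneg (hf0 y) (hk0 ρ x y hρ)), mul_left_comm]
    exact mul_le_mul_of_nonneg_left (hkle ρ hρ x x y hy (by simpa using hρ)) (hf0 y)
  have hcont : ∀ ρ, 0 < ρ → Continuous fun x => ∫ y, f y * k ρ x y := by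
    intro ρ hρ
    refine continuous_iff_continuousAt.2 fun x0 => ?_
    refine tendsto_integral_filter_of_dominated_convergence
      (fun y => 2 ^ (n - 2) * (f y * newton x0 y))
      (Eventually.of_forall fun x => (hf.mul (hkm ρ x)).aestronglyMeasurable) ?_
      ((hint x0).const_mul _)
      (Eventually.of_forall fun y => ((hkc ρ hρ y).tendsto x0).const_mul _)
    filter_upwards [ball_mem_nhds x0 hρ] with x hx
    filter_upwards [ae_ne_point hn x0] with y hy
    rw [Real.norm_of_nonneg (mul_nonneg (hf0 y) (hk0 ρ x y hρ)), mul_left_comm]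
    exact mul_le_mul_of_nonneg_left (hkle ρ hρ x0 x y hy (by rwa [mem_ball_iff_norm] at hx)) (hf0 y)
  refine continuous_of_uniform_approx_of_continuous fun U hU => ?_
  obtain ⟨ε, hε, hεU⟩ := Metric.mem_uniformity_dist.1 hU
  set A := (∫⁻ y, ENNReal.ofReal (f y) ^ r) ^ (1 / r) with hA
  have hAt : A ≠ ⊤ := by finiteness
  -- The truncation error is at most the potential of the density within distance ρ of x. Hölder's
  -- inequality makes it small uniformly in x, since (n - 2) b < n for the exponent b conjugate to r
  -- > n/2.
  obtain ⟨ε', hε', hε'A⟩ : ∃ ε' : ℝ≥0∞, ε' ≠ 0 ∧ A * ε' ^ (1 / b) ≤ ENNReal.ofReal (ε / 2) := by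
    have h1 : ENNReal.ofReal (ε / 2) ≠ 0 := by simpa using hε
    refine ⟨(ENNReal.ofReal (ε / 2) / (A + 1)) ^ b, ?_, ?_⟩
    · have : ENNReal.ofReal (ε / 2) / (A + 1) ≠ 0 := by
        simp only [ne_eq, ENNReal.div_eq_zero_iff, not_or]
        exact ⟨h1, by finiteness⟩
      simp [ENNReal.rpow_eq_zero_iff, this, hb0.not_gt]
    · rw [← ENNReal.rpow_mul, mul_one_div_cancel hb0.ne', ENNReal.rpow_one]
      calc A * (ENNReal.ofReal (ε / 2) / (A + 1)) ≤ (A + 1) * (ENNReal.ofReal (ε / 2) / (A + 1)) := by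
            gcongr; exact le_self_add
        _ ≤ _ := ENNReal.mul_div_le
  obtain ⟨ρ, hρ, hρle⟩ := exists_lintegral_newtonK_rpow_ball_le hn hb0 hbn hε'
  refine ⟨_, hcont ρ hρ, fun x => hεU ?_⟩
  rw [Real.dist_eq, ← integral_sub (hint x) (hkint ρ hρ x)]
  have hnear : ∫⁻ y, ENNReal.ofReal (f y) * (ball (0 : Euc n) ρ).indicator newtonK (x - y) ≤
      ENNReal.ofReal (ε / 2) := by
    have hm : Measurable (fun y => (ball (0 : Euc n) ρ).indicator newtonK (x - y)) :=
      (measurable_newtonK.indicator measurableSet_ball).comp (measurable_const.sub measurable_id)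
    refine (ENNReal.lintegral_mul_le_Lp_mul_Lq volume hconj hf.ennreal_ofReal.aemeasurable
      hm.aemeasurable).trans (le_trans ?_ hε'A)
    rw [lintegral_sub_left_eq_self (fun z => ((ball (0 : Euc n) ρ).indicator newtonK z) ^ b) x]
    gcongr
  have hpt : ∀ᵐ y, 0 ≤ f y * newton x y - f y * k ρ x y ∧
      ENNReal.ofReal (f y * newton x y - f y * k ρ x y) ≤
        ENNReal.ofReal (f y) * (ball (0 : Euc n) ρ).indicator newtonK (x - y) := by
    filter_upwards [ae_ne_point hn x] with y hy
    have h1 : 0 < ‖x - y‖ := norm_pos_iff.2 (sub_ne_zero.2 hy.symm)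
    by_cases hxy : x - y ∈ ball (0 : Euc n) ρ
    · rw [indicator_of_mem hxy, newtonK, ← ENNReal.ofReal_mul (hf0 y)]
      refine ⟨?_, ENNReal.ofReal_le_ofReal ?_⟩
      · rw [← mul_sub]
        refine mul_nonneg (hf0 y) (sub_nonneg.2 ?_)
        simp only [hk, newton]
        gcongr
        exact le_max_left _ _
      · have := mul_nonneg (hf0 y) (hk0 ρ x y hρ)
        rw [← newton]
        linarith
    · have h2 : ρ ≤ ‖x - y‖ := by simpa using hxy
      have h3 : k ρ x y = newton x y := by simp only [hk, newton, max_eq_left h2]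
      simp [h3]
  have hnn : 0 ≤ ∫ y, (f y * newton x y - f y * k ρ x y) :=
    integral_nonneg_of_ae (hpt.mono fun y hy => hy.1)
  rw [abs_of_nonneg hnn, integral_eq_lintegral_of_nonneg_ae (hpt.mono fun y hy => hy.1)
    ((hf.mul (measurable_newton_right x)).sub (hf.mul (hkm ρ x))).aestronglyMeasurable]
  refine lt_of_le_of_lt (ENNReal.toReal_le_of_le_ofReal (by positivity)
    ((lintegral_mono_ae (hpt.mono fun y hy => hy.2)).trans hnear)) (by linarith)

end Continuity

/-! ### The integral system -/

section IntegralSystem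

variable {n : ℕ} {p c₁ c₂ : ℝ} {u v : Euc n → ℝ}

lemma scalingDefect_pos (hn : 3 ≤ n) (hp : p < 2 * (n : ℝ) / ((n : ℝ) - 2) - 1) :
    0 < scalingDefect n p := by
  have hn0 : (3 : ℝ) ≤ n := by exact_mod_cast hn
  have hn2 : (0 : ℝ) < (n : ℝ) - 2 := by linarith
  have h1 : p + 1 < 2 * (n : ℝ) / ((n : ℝ) - 2) := by linarith
  rw [lt_div_iff₀ hn2] at h1
  unfold scalingDefect; linarith

namespace IsPositiveIntegralSolution

lemma integrable_left_newton (h : IsPositiveIntegralSolution n p c₁ c₂ u v) (x : Euc n) :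
    Integrable (fun y => u y ^ (p - 1) * v y * newton x y) := h.integrable_left x

lemma integrable_right_newton (h : IsPositiveIntegralSolution n p c₁ c₂ u v) (x : Euc n) :
    Integrable (fun y => u y ^ p * newton x y) := h.integrable_right x

lemma eq_left_newton (h : IsPositiveIntegralSolution n p c₁ c₂ u v) (x : Euc n) :
    u x = c₁ * ∫ y, u y ^ (p - 1) * v y * newton x y := h.eq_left x

lemma eq_right_newton (h : IsPositiveIntegralSolution n p c₁ c₂ u v) (x : Euc n) :
    v x = c₂ * ∫ y, u y ^ p * newton x y := h.eq_right x

theorem false_of_le (hn : 3 ≤ n) (hp : 1 < p) (hp' : p ≤ (n : ℝ) / ((n : ℝ) - 2)) (hc₁ : 0 < c₁)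
    (hc₂ : 0 < c₂) (h : IsPositiveIntegralSolution n p c₁ c₂ u v) : False :=
  no_positive_superpair hn hp hp' hc₁ hc₂ h.measurable_left h.measurable_right h.pos_left
    h.pos_right h.integrable_left_newton h.integrable_right_newton
    (fun x => (h.eq_left_newton x).ge) (fun x => (h.eq_right_newton x).ge)

lemma ofReal_integral_eq_riesz {f g : Euc n → ℝ} (hf : ∀ y, 0 ≤ f y) (hg : ∀ y, 0 ≤ g y)
    {x : Euc n} (h : Integrable (fun y => f y * g y * newton x y)) :
    ENNReal.ofReal (∫ y, f y * g y * newton x y) =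
      riesz (fun y => ENNReal.ofReal (f y) * ENNReal.ofReal (g y)) x := by
  rw [ofReal_integral_eq_lintegral_ofReal h (Eventually.of_forall fun y =>
    mul_nonneg (mul_nonneg (hf y) (hg y)) (newton_nonneg x y)), riesz]
  refine lintegral_congr fun y => ?_
  rw [ENNReal.ofReal_mul (mul_nonneg (hf y) (hg y)), ENNReal.ofReal_mul (hf y)]
  rfl

/-- The range p ≤ n/(n-2) falls to the supersolution argument. For larger p the exponent q =
n(p-1)/2 exceeds n/(n-2), as the Hardy-Littlewood-Sobolev inequality requires, and u ∈ L^q means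
u^(p-1) ∈ L^(n/2): these are the hypotheses of `regularity_lifting`. The gain in integrability makes
u and v continuous, and moving spheres conclude. -/
theorem false_of_memLp (hn : 3 ≤ n) (hp : 1 < p) (hp' : p < 2 * (n : ℝ) / ((n : ℝ) - 2) - 1)
    (hc₁ : 0 < c₁) (hc₂ : 0 < c₂) (h : IsPositiveIntegralSolution n p c₁ c₂ u v)
    (hL : MemLp u (ENNReal.ofReal ((n : ℝ) * (p - 1) / 2))) : False := by
  by_cases hple : p ≤ (n : ℝ) / ((n : ℝ) - 2)
  · exact h.false_of_le hn hp hple hc₁ hc₂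
  push Not at hple
  have hn0 : (3 : ℝ) ≤ n := by exact_mod_cast hn
  have hn2 : (0 : ℝ) < (n : ℝ) - 2 := by linarith
  have hp1 : 0 < p - 1 := by linarith
  have hu0 := fun y => (h.pos_left y).le
  have hv0 := fun y => (h.pos_right y).le
  have hup : ∀ y, 0 ≤ u y ^ (p - 1) := fun y => Real.rpow_nonneg (hu0 y) _
  have hpow : ∀ y, u y ^ p = u y ^ (p - 1) * u y := fun y => by
    rw [Real.rpow_sub_one (h.pos_left y).ne', div_mul_cancel₀ _ (h.pos_left y).ne']
  have hint₂ : ∀ x, Integrable (fun y => u y ^ (p - 1) * u y * newton x y) := fun x => by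
    simpa only [hpow] using h.integrable_right_newton x
  have heq₂ : ∀ x, v x = c₂ * ∫ y, u y ^ (p - 1) * u y * newton x y := fun x => by
    simpa only [hpow] using h.eq_right_newton x
  set U : Euc n → ℝ≥0∞ := fun y => ENNReal.ofReal (u y) with hU
  set W : Euc n → ℝ≥0∞ := fun y => ENNReal.ofReal (v y) with hW
  set V : Euc n → ℝ≥0∞ := fun y => ENNReal.ofReal (u y ^ (p - 1)) with hV
  have hUm : Measurable U := h.measurable_left.ennreal_ofReal
  have hVm : Measurable V := (h.measurable_left.pow_const _).ennreal_ofReal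
  have hVU : ∀ y, V y = U y ^ (p - 1) := fun y =>
    (ENNReal.ofReal_rpow_of_nonneg (hu0 y) hp1.le).symm
  have hUeq : ∀ x, U x = ENNReal.ofReal c₁ * riesz (fun y => V y * W y) x := fun x => by
    rw [← ofReal_integral_eq_riesz hup hv0 (h.integrable_left_newton x),
      ← ENNReal.ofReal_mul hc₁.le, ← h.eq_left_newton x]
  have hWeq : ∀ x, W x = ENNReal.ofReal c₂ * riesz (fun y => V y * U y) x := fun x => by
    rw [← ofReal_integral_eq_riesz hup hu0 (hint₂ x), ← ENNReal.ofReal_mul hc₂.le, ← heq₂ x]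
  have hq : (n : ℝ) / (n - 2) < (n : ℝ) * (p - 1) / 2 := by
    have h1 : 2 / ((n : ℝ) - 2) < p - 1 := by
      have : (n : ℝ) / ((n : ℝ) - 2) = 1 + 2 / ((n : ℝ) - 2) := by field_simp; ring
      linarith
    calc (n : ℝ) / (n - 2) = n * (2 / ((n : ℝ) - 2)) / 2 := by field_simp
      _ < _ := by gcongr
  have hq0 : 0 < (n : ℝ) * (p - 1) / 2 := by positivity
  have hUq : ∫⁻ x, U x ^ ((n : ℝ) * (p - 1) / 2) ≠ ⊤ := by
    have := lintegral_rpow_enorm_lt_top_of_eLpNorm_lt_top (by simpa using hq0) (by simp)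
      hL.eLpNorm_lt_top
    rw [ENNReal.toReal_ofReal hq0.le] at this
    refine ((lintegral_congr fun x => ?_).trans_lt this).ne
    rw [Real.enorm_of_nonneg (hu0 x)]
  have hVn : lnorm (n / 2 : ℝ) V ≠ ⊤ := by
    refine ENNReal.rpow_ne_top_of_nonneg (by positivity) (ne_of_eq_of_ne ?_ hUq)
    refine lintegral_congr fun x => ?_
    rw [hVU, ← ENNReal.rpow_mul]
    congr 1; ring
  -- The target exponent p n puts both densities, homogeneous of degree p in (u, v), into L^n, above
  -- the threshold n/2 of `continuous_newton_potential`.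
  have hs : (n : ℝ) / (n - 2) < p * n := by
    rw [div_lt_iff₀ hn2]
    nlinarith [mul_pos hp1 (show (0 : ℝ) < n by linarith)]
  have hs0 : 0 < p * n := by positivity
  -- Substituting the equation for v into that for u gives u = c₁ c₂ I(V I(V u)).
  have hUs : lnorm (p * n) U ≠ ⊤ := by
    refine regularity_lifting hn hq hs hVm hUm (fun x => ENNReal.ofReal_ne_top)
      (c := ENNReal.ofReal c₁ * ENNReal.ofReal c₂) (by finiteness) hVn
      (ENNReal.rpow_ne_top_of_nonneg (by positivity) hUq) (fun k => ?_) fun x => ?_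
    · refine ⟨(k : ℝ≥0∞) ^ (p - 1) * k, ?_, fun x hx => ?_⟩
      · exact ENNReal.mul_ne_top (ENNReal.rpow_ne_top_of_nonneg hp1.le (by simp)) (by simp)
      · rw [hVU]; gcongr
    · rw [hUeq x, mul_assoc, ← riesz_const_mul (c := ENNReal.ofReal c₂) ENNReal.ofReal_ne_top]
      congr 1
      refine congrArg (fun F => riesz F x) (funext fun y => ?_)
      rw [hWeq y, mul_left_comm]
  have hWs : lnorm (p * n) W ≠ ⊤ := by
    obtain ⟨K, hK, hKf⟩ := hls_mul hn hs
    have : W = fun x => ENNReal.ofReal c₂ * riesz (fun y => V y * U y) x := funext hWeq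
    rw [this, lnorm_const_mul hs0 ENNReal.ofReal_ne_top]
    exact ENNReal.mul_ne_top ENNReal.ofReal_ne_top
      (ne_top_of_le_ne_top (by finiteness) (hKf V U hVm hUm))
  have hUi : ∫⁻ x, U x ^ (p * n) ≠ ⊤ := by
    rw [← lnorm_rpow hs0]; exact ENNReal.rpow_ne_top_of_nonneg hs0.le hUs
  have hWi : ∫⁻ x, W x ^ (p * n) ≠ ⊤ := by
    rw [← lnorm_rpow hs0]; exact ENNReal.rpow_ne_top_of_nonneg hs0.le hWs
  have hpn : (n : ℝ) / 2 < n := by linarith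
  have hrpow : ∀ t : ℝ≥0∞, (t ^ (p - 1) * t) = t ^ p := fun t => by
    conv_lhs => rw [← ENNReal.rpow_one t, ← ENNReal.rpow_mul, one_mul]
    rw [← ENNReal.rpow_add_of_nonneg _ _ hp1.le zero_le_one, sub_add_cancel]
  have hcu : Continuous u := by
    have h1 := continuous_newton_potential hn
      ((h.measurable_left.pow_const (p - 1)).mul h.measurable_right)
      (fun y => mul_nonneg (hup y) (hv0 y)) h.integrable_left_newton hpn (by
        refine ne_top_of_le_ne_top (ENNReal.add_ne_top.2 ⟨hUi, hWi⟩) ?_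
        rw [← lintegral_add_left (hUm.pow_const _)]
        refine lintegral_mono fun y => ?_
        rw [Pi.mul_apply, ENNReal.ofReal_mul (hup y)]
        have h2 : V y * W y ≤ max (U y) (W y) ^ p := by
          rw [← hrpow, hVU]
          exact mul_le_mul' (ENNReal.rpow_le_rpow (le_max_left _ _) hp1.le) (le_max_right _ _)
        refine (ENNReal.rpow_le_rpow h2 (by positivity)).trans ?_
        rw [← ENNReal.rpow_mul]
        rcases max_choice (U y) (W y) with h3 | h3 <;> rw [h3]
        · exact le_self_add
        · exact le_add_self)
    have h2 : u = fun x => c₁ * ∫ y, u y ^ (p - 1) * v y * newton x y := funext h.eq_left_newton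
    rw [h2]; exact h1.const_mul c₁
  have hcv : Continuous v := by
    have h1 := continuous_newton_potential hn
      ((h.measurable_left.pow_const (p - 1)).mul h.measurable_left)
      (fun y => mul_nonneg (hup y) (hu0 y)) hint₂ hpn (by
        refine ne_of_eq_of_ne (lintegral_congr fun y => ?_) hUi
        rw [Pi.mul_apply, ENNReal.ofReal_mul (hup y), ENNReal.rpow_mul, ← hrpow, ← hVU])
    have h2 : v = fun x => c₂ * ∫ y, u y ^ (p - 1) * u y * newton x y := funext heq₂
    rw [h2]; exact h1.const_mul c₂
  exact IsPotentialPair.elim hn hp (scalingDefect_pos hn hp')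
    { nonneg_a := le_rfl
      nonneg_b := le_rfl
      pos_c := hc₁
      pos_d := hc₂
      continuous_left := hcu
      continuous_right := hcv
      pos_left := h.pos_left
      pos_right := h.pos_right
      integrable_left := h.integrable_left_newton
      integrable_right := hint₂
      eq_left := fun x => by rw [zero_add]; exact h.eq_left_newton x
      eq_right := fun x => by rw [zero_add]; exact heq₂ x }

end IsPositiveIntegralSolution

end IntegralSystem

/-! ### Weighted ball means -/

/-- A compactly supported `C¹` bump on the unit ball. -/
noncomputable def bump {n : ℕ} (z : Euc n) : ℝ := (max (1 - ‖z‖ ^ 2) 0) ^ 2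

/-- The weight `w` with `∇ bump = -w z`. -/
noncomputable def bumpWeight {n : ℕ} (z : Euc n) : ℝ := 4 * max (1 - ‖z‖ ^ 2) 0

/-- The mean of `u` on the ball of radius `r` about `x`, with weight `bumpWeight`. -/
noncomputable def weightedMean {n : ℕ} (u : Euc n → ℝ) (x : Euc n) (r : ℝ) : ℝ :=
  ∫ z, u (x + r • z) * bumpWeight z

section Bump

variable {n : ℕ}

lemma bump_nonneg (z : Euc n) : 0 ≤ bump z := by unfold bump; positivity

lemma bumpWeight_nonneg (z : Euc n) : 0 ≤ bumpWeight z := by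
  unfold bumpWeight
  have := le_max_right (1 - ‖z‖ ^ 2) 0
  positivity

lemma max_one_sub_sq_eq_zero {t : ℝ} (h : 1 ≤ t) : max (1 - t ^ 2) 0 = 0 :=
  max_eq_right (by nlinarith)

lemma bump_eq_zero {z : Euc n} (h : 1 ≤ ‖z‖) : bump z = 0 := by
  simp [bump, max_one_sub_sq_eq_zero h]

lemma bumpWeight_eq_zero {z : Euc n} (h : 1 ≤ ‖z‖) : bumpWeight z = 0 := by
  simp [bumpWeight, max_one_sub_sq_eq_zero h]

lemma continuous_bump : Continuous (bump : Euc n → ℝ) := by unfold bump; fun_prop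

lemma continuous_bumpWeight : Continuous (bumpWeight : Euc n → ℝ) := by unfold bumpWeight; fun_prop

/-- Squaring makes the positive part differentiable at 0, where it is O(h²); this is why `bump` is a
square. -/
lemma hasDerivAt_max_zero_sq (t : ℝ) : HasDerivAt (fun s : ℝ => (max s 0) ^ 2) (2 * max t 0) t := by
  rcases lt_trichotomy t 0 with h | rfl | h
  · rw [max_eq_right h.le, mul_zero]
    refine (hasDerivAt_const t (0 : ℝ)).congr_of_eventuallyEq ?_
    filter_upwards [Iio_mem_nhds h] with s hs
    simp [max_eq_right (le_of_lt (mem_Iio.1 hs))]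
  · simp only [max_self, mul_zero]
    rw [hasDerivAt_iff_isLittleO_nhds_zero]
    simp only [zero_add, max_self, smul_zero, sub_zero, ne_eq, OfNat.ofNat_ne_zero,
      not_false_eq_true, zero_pow]
    have h1 : (fun h : ℝ => max h 0 ^ 2) =O[𝓝 0] fun h : ℝ => h ^ 2 := by
      refine Asymptotics.IsBigO.of_bound 1 (Eventually.of_forall fun h => ?_)
      rw [one_mul, Real.norm_of_nonneg (sq_nonneg _), Real.norm_of_nonneg (sq_nonneg _)]
      rcases le_total h 0 with h0 | h0
      · rw [max_eq_right h0]; simpa using sq_nonneg h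
      · rw [max_eq_left h0]
    refine h1.trans_isLittleO ?_
    simpa using Asymptotics.isLittleO_pow_pow (𝕜 := ℝ) (show 1 < 2 by norm_num)
  · rw [max_eq_left h.le]
    have := (hasDerivAt_pow 2 t).congr_of_eventuallyEq (f₁ := fun s : ℝ => (max s 0) ^ 2) (by
      filter_upwards [Ioi_mem_nhds h] with s hs
      simp [max_eq_left (le_of_lt (mem_Ioi.1 hs))])
    simpa using this

lemma hasFDerivAt_bump (z : Euc n) :
    HasFDerivAt bump (-(bumpWeight z) • innerSL ℝ z) z := by
  have h1 : HasFDerivAt (fun y : Euc n => 1 - ‖y‖ ^ 2) (-(2 • innerSL ℝ z)) z := by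
    simpa using ((hasFDerivAt_id z).norm_sq).const_sub 1
  have h2 := (hasDerivAt_max_zero_sq (1 - ‖z‖ ^ 2)).comp_hasFDerivAt z h1
  refine h2.congr_fderiv ?_
  ext w
  simp [bumpWeight]; ring

lemma integrable_mul_of_unit_ball {g w : Euc n → ℝ} (hg : Continuous g) (hw : Continuous w)
    (h0 : ∀ z, 1 ≤ ‖z‖ → w z = 0) : Integrable (fun z => g z * w z) := by
  refine (hg.mul hw).integrable_of_hasCompactSupport
    (HasCompactSupport.intro (isCompact_closedBall (0 : Euc n) 1) fun z hz => ?_)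
  have : 1 ≤ ‖z‖ := by
    have := hz
    rw [mem_closedBall_zero_iff, not_le] at this
    exact this.le
  simp [h0 z this]

/-- Integration by parts against the bump. -/
lemma integral_fderiv_mul_bumpWeight {u : Euc n → ℝ} (hu : ContDiff ℝ 2 u) (x : Euc n) (r : ℝ) :
    ∫ z, fderiv ℝ u (x + r • z) z * bumpWeight z =
      ∫ z, r * Laplacian.laplacian u (x + r • z) * bump z := by
  set b := EuclideanSpace.basisFun (Fin n) ℝ
  have hd1 : Differentiable ℝ (fderiv ℝ u) :=
    (hu.fderiv_right (m := 1) (by norm_num)).differentiable (by norm_num)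
  have hc2 : Continuous (fderiv ℝ (fderiv ℝ u)) :=
    (hu.fderiv_right (m := 1) (by norm_num)).continuous_fderiv (by norm_num)
  have hline : ∀ z : Euc n, HasFDerivAt (fun z : Euc n => x + r • z)
      (r • ContinuousLinearMap.id ℝ (Euc n)) z := fun z =>
    ((hasFDerivAt_id z).const_smul r).const_add x
  set g : Fin n → Euc n → ℝ := fun i z => fderiv ℝ u (x + r • z) (b i) with hg
  have hgd : ∀ i z, HasFDerivAt (g i)
      (((ContinuousLinearMap.apply ℝ ℝ (b i)).comp (fderiv ℝ (fderiv ℝ u) (x + r • z))).comp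
        (r • ContinuousLinearMap.id ℝ (Euc n))) z := fun i z =>
    (((ContinuousLinearMap.apply ℝ ℝ (b i)).hasFDerivAt).comp _ (hd1 _).hasFDerivAt).comp z (hline z)
  have hgc : ∀ i, Continuous (g i) := fun i =>
    continuous_iff_continuousAt.2 fun z => (hgd i z).continuousAt
  have hgd' : ∀ i z, fderiv ℝ (g i) z (b i) =
      r * fderiv ℝ (fderiv ℝ u) (x + r • z) (b i) (b i) := fun i z => by
    rw [(hgd i z).fderiv]; simp
  have hbump : ∀ i z, fderiv ℝ bump z (b i) = -(z i * bumpWeight z) := fun i z => by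
    rw [(hasFDerivAt_bump z).fderiv]
    simp [b, EuclideanSpace.inner_single_right, mul_comm]
  have hz : ∀ i, Continuous fun z : Euc n => z i := fun i => by fun_prop
  have hI1 : ∀ i, Integrable (fun z => g i z * (z i * bumpWeight z)) := fun i =>
    integrable_mul_of_unit_ball (hgc i) ((hz i).mul continuous_bumpWeight)
      fun z h => by simp [bumpWeight_eq_zero h]
  have hI2 : ∀ i, Integrable (fun z => r * fderiv ℝ (fderiv ℝ u) (x + r • z) (b i) (b i) * bump z) :=
    fun i => integrable_mul_of_unit_ball (by fun_prop) continuous_bump fun z h => bump_eq_zero h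
  -- The i-th derivative of `bump` is -z_i times `bumpWeight`, so each coordinate is one integration
  -- by parts.
  have hibp : ∀ i, ∫ z, g i z * (z i * bumpWeight z) =
      ∫ z, r * fderiv ℝ (fderiv ℝ u) (x + r • z) (b i) (b i) * bump z := fun i => by
    have := integral_mul_fderiv_eq_neg_fderiv_mul_of_integrable (μ := (volume : Measure (Euc n)))
      (f := g i) (g := bump) (v := b i) (by simpa only [hgd'] using hI2 i)
      (by simp only [hbump, mul_neg]; exact (hI1 i).neg)
      (integrable_mul_of_unit_ball (hgc i) continuous_bump fun z h => bump_eq_zero h)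
      (fun z _ => (hgd i z).differentiableAt) (fun z _ => (hasFDerivAt_bump z).differentiableAt)
    simp only [hbump, hgd', mul_neg, integral_neg, neg_inj] at this
    exact this
  have hL : ∀ z, fderiv ℝ u (x + r • z) z * bumpWeight z = ∑ i, g i z * (z i * bumpWeight z) := by
    intro z
    have h1 : z = ∑ i, z i • b i := by
      have := b.sum_repr z
      simpa [b] using this.symm
    conv_lhs => rw [show fderiv ℝ u (x + r • z) z = fderiv ℝ u (x + r • z) (∑ i, z i • b i) by
      rw [← h1]]
    rw [map_sum, Finset.sum_mul]
    refine Finset.sum_congr rfl fun i _ => ?_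
    rw [map_smul, smul_eq_mul]; simp only [hg]; ring
  have hR : ∀ z, r * Laplacian.laplacian u (x + r • z) * bump z =
      ∑ i, r * fderiv ℝ (fderiv ℝ u) (x + r • z) (b i) (b i) * bump z := by
    intro z
    rw [InnerProductSpace.laplacian_eq_iteratedFDeriv_orthonormalBasis u b]
    simp only [iteratedFDeriv_two_apply]
    rw [Finset.mul_sum, Finset.sum_mul]
    simp
  simp only [hL, hR]
  rw [integral_finsetSum _ fun i _ => hI1 i, integral_finsetSum _ fun i _ => hI2 i]
  exact Finset.sum_congr rfl fun i _ => hibp i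

lemma integrable_prod_of_unit_ball {G : ℝ × Euc n → ℝ} (hG : Continuous G)
    (h0 : ∀ r z, 1 ≤ ‖z‖ → G (r, z) = 0) (R : ℝ) :
    Integrable G ((volume.restrict (Ioc 0 R)).prod volume) := by
  have h1 : (volume.restrict (Ioc 0 R)).prod (volume : Measure (Euc n)) =
      ((volume : Measure ℝ).prod volume).restrict (Ioc 0 R ×ˢ univ) := by
    rw [← Measure.prod_restrict, Measure.restrict_univ]
  rw [h1]
  have h2 : IntegrableOn G (Icc 0 R ×ˢ closedBall (0 : Euc n) 1) (volume.prod volume) :=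
    hG.continuousOn.integrableOn_compact (isCompact_Icc.prod (isCompact_closedBall _ _))
  refine IntegrableOn.of_forall_sdiff_eq_zero h2 (measurableSet_Ioc.prod MeasurableSet.univ) ?_
  rintro ⟨r, z⟩ ⟨h3, h4⟩
  refine h0 r z ?_
  by_contra! h5
  exact h4 ⟨Ioc_subset_Icc_self h3.1, mem_closedBall_zero_iff.2 h5.le⟩

lemma weightedMean_zero (u : Euc n → ℝ) (x : Euc n) :
    weightedMean u x 0 = u x * ∫ z : Euc n, bumpWeight z := by
  simp [weightedMean, integral_const_mul]

/-- The derivative of the mean in r is the weighted integral of the radial derivative of u, which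
integration by parts turns into r ∫ Δu · bump. Integrating over 0 < r ≤ R and applying Fubini gives
the formula. -/
lemma weightedMean_sub {u : Euc n → ℝ} (hu : ContDiff ℝ 2 u) (x : Euc n) {R : ℝ} (hR : 0 ≤ R) :
    weightedMean u x R - weightedMean u x 0 =
      ∫ q : ℝ × Euc n, q.1 * Laplacian.laplacian u (x + q.1 • q.2) * bump q.2
        ∂((volume.restrict (Ioc 0 R)).prod volume) := by
  have hu1 : Differentiable ℝ u := hu.differentiable (by norm_num)
  have hc1 : Continuous (fderiv ℝ u) := hu.continuous_fderiv (by norm_num)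
  have hcL : Continuous (Laplacian.laplacian u) := by
    rw [InnerProductSpace.laplacian_eq_iteratedFDeriv_orthonormalBasis u
      (EuclideanSpace.basisFun (Fin n) ℝ)]
    have := hu.continuous_iteratedFDeriv (m := 2) (by norm_num)
    fun_prop
  have hcb := continuous_bump (n := n)
  have hcw := continuous_bumpWeight (n := n)
  have hI1 : Integrable (fun q : ℝ × Euc n => fderiv ℝ u (x + q.1 • q.2) q.2 * bumpWeight q.2)
      ((volume.restrict (Ioc 0 R)).prod volume) :=
    integrable_prod_of_unit_ball (by fun_prop) (fun r z h => by simp [bumpWeight_eq_zero h]) R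
  have hI2 : Integrable (fun q : ℝ × Euc n =>
      q.1 * Laplacian.laplacian u (x + q.1 • q.2) * bump q.2)
      ((volume.restrict (Ioc 0 R)).prod volume) :=
    integrable_prod_of_unit_ball (by fun_prop) (fun r z h => by simp [bump_eq_zero h]) R
  have hIu : ∀ r : ℝ, Integrable (fun z : Euc n => u (x + r • z) * bumpWeight z) := fun r =>
    integrable_mul_of_unit_ball (hu.continuous.comp (by fun_prop)) hcw
      fun z h => bumpWeight_eq_zero h
  rw [integral_prod _ hI2]
  simp only [← integral_fderiv_mul_bumpWeight hu x]
  rw [← integral_prod _ hI1, integral_prod_symm _ hI1, weightedMean, weightedMean,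
    ← integral_sub (hIu R) (hIu 0)]
  refine integral_congr_ae (Eventually.of_forall fun z => ?_)
  simp only
  rw [integral_mul_const, ← sub_mul, ← intervalIntegral.integral_of_le hR,
    intervalIntegral.integral_eq_sub_of_hasDerivAt (f := fun r => u (x + r • z))]
  · intro r _
    have h1 : HasDerivAt (fun r : ℝ => x + r • z) z r := by
      simpa using ((hasDerivAt_id r).smul_const z).const_add x
    exact (hu1 (x + r • z)).hasFDerivAt.comp_hasDerivAt r h1
  · exact (Continuous.intervalIntegrable (by fun_prop) _ _)

end Bump

/-! ### Newton representation of positive superharmonic functions -/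

section Representation

variable {n : ℕ}

/-- The ratio between the superposition of dilated bumps and the Newton kernel. -/
noncomputable def newtonConst (n : ℕ) : ℝ≥0∞ :=
  ∫⁻ r in Ioi (0 : ℝ), ENNReal.ofReal (r * r⁻¹ ^ n * (max (1 - r⁻¹ ^ 2) 0) ^ 2)

/-- The integrand vanishes for r ≤ 1, and for r > 1 it is at most r^(1-n) ≤ r^(-2), since n ≥ 3. -/
lemma newtonConst_ne_top (hn : 3 ≤ n) : newtonConst n ≠ ⊤ := by
  have h1 : IntegrableOn (fun t : ℝ => t ^ (-2 : ℝ)) (Ioi 1) :=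
    integrableOn_Ioi_rpow_of_lt (by norm_num) one_pos
  have h2 := ((hasFiniteIntegral_iff_ofReal ((ae_restrict_mem measurableSet_Ioi).mono fun t ht =>
    Real.rpow_nonneg (by have := mem_Ioi.1 ht; linarith) _)).1 h1.2)
  rw [← lintegral_indicator measurableSet_Ioi] at h2
  rw [newtonConst, ← lintegral_indicator measurableSet_Ioi]
  refine (lt_of_le_of_lt (lintegral_mono fun r => ?_) h2).ne
  by_cases hr0 : r ∈ Ioi (0 : ℝ)
  · rw [indicator_of_mem hr0]
    by_cases hr : r ∈ Ioi (1 : ℝ)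
    · rw [indicator_of_mem hr]
      apply ENNReal.ofReal_le_ofReal
      have hr' : 1 < r := hr
      have hr0' : 0 < r := hr0
      have h3 : max (1 - r⁻¹ ^ 2) 0 ≤ 1 := max_le (by have := sq_nonneg r⁻¹; linarith) zero_le_one
      have h4 : r⁻¹ ^ n ≤ r⁻¹ ^ 3 :=
        pow_le_pow_of_le_one (by positivity) (inv_le_one_of_one_le₀ hr'.le) hn
      calc r * r⁻¹ ^ n * (max (1 - r⁻¹ ^ 2) 0) ^ 2 ≤ r * r⁻¹ ^ 3 * 1 ^ 2 := by gcongr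
        _ = r ^ (-2 : ℝ) := by
            rw [Real.rpow_neg hr0'.le, Real.rpow_ofNat]
            field_simp
    · have h5 : 1 ≤ r⁻¹ := (one_le_inv₀ hr0).2 (not_lt.1 hr)
      rw [max_one_sub_sq_eq_zero h5]
      simp
  · rw [indicator_of_notMem hr0]; exact zero_le

lemma newtonConst_ne_zero : newtonConst n ≠ 0 := by
  intro h
  rw [newtonConst, setLIntegral_eq_zero_iff measurableSet_Ioi (by fun_prop)] at h
  have h1 : volume (Ioi (1 : ℝ)) = 0 := by
    refine measure_mono_null ?_ (ae_iff.1 h)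
    intro r hr hr0
    have hr' : 1 < r := hr
    have h0 : 0 < r := by linarith
    have h2 : r⁻¹ < 1 := inv_lt_one_of_one_lt₀ hr'
    have h3 : 0 < r⁻¹ := by positivity
    have h4 : 0 < max (1 - r⁻¹ ^ 2) 0 := lt_max_of_lt_left (by nlinarith)
    have h5 := hr0 h0
    rw [ENNReal.ofReal_eq_zero] at h5
    have : 0 < r * r⁻¹ ^ n * max (1 - r⁻¹ ^ 2) 0 ^ 2 := by positivity
    linarith
  simp at h1

lemma lintegral_comp_mul_pos {g : ℝ → ℝ≥0∞} (hg : Measurable g) {R : ℝ} (hR : 0 < R) :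
    ∫⁻ r, g r = ENNReal.ofReal R * ∫⁻ r, g (R * r) := by
  have h1 : ∫⁻ r, g (R * r) = ∫⁻ r, g r ∂(Measure.map (R * ·) volume) :=
    (lintegral_map hg (measurable_const_mul R)).symm
  rw [h1, Real.map_volume_mul_left hR.ne', lintegral_smul_measure, smul_eq_mul, ← mul_assoc,
    ← ENNReal.ofReal_mul hR.le, abs_of_pos (by positivity), mul_inv_cancel₀ hR.ne',
    ENNReal.ofReal_one, one_mul]

/-- `bump` is radial and r^(1-n) dr is homogeneous of degree 2 - n; the substitution of ‖y‖ r for r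
extracts the Newton kernel. -/
lemma lintegral_bump_dilations (hn : 3 ≤ n) {y : Euc n} (hy : y ≠ 0) :
    ∫⁻ r in Ioi (0 : ℝ), ENNReal.ofReal (r * r⁻¹ ^ n * bump (r⁻¹ • y)) =
      newtonConst n * newtonK y := by
  have hy0 : 0 < ‖y‖ := norm_pos_iff.2 hy
  have hcb := continuous_bump (n := n)
  have hm : Measurable ((Ioi (0 : ℝ)).indicator fun r =>
      ENNReal.ofReal (r * r⁻¹ ^ n * bump (r⁻¹ • y))) := by
    refine Measurable.indicator ?_ measurableSet_Ioi
    have : Measurable fun r : ℝ => bump (r⁻¹ • y) :=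
      hcb.measurable.comp (measurable_inv.smul_const y)
    fun_prop
  rw [← lintegral_indicator measurableSet_Ioi, lintegral_comp_mul_pos hm hy0, newtonConst,
    ← lintegral_indicator measurableSet_Ioi, newtonK, mul_comm _ (ENNReal.ofReal _),
    ← lintegral_const_mul' _ _ ENNReal.ofReal_ne_top, ← lintegral_const_mul' _ _ ENNReal.ofReal_ne_top]
  refine lintegral_congr fun r => ?_
  by_cases hr : r ∈ Ioi (0 : ℝ)
  · have hr0 : 0 < r := hr
    rw [indicator_of_mem hr, indicator_of_mem (show ‖y‖ * r ∈ Ioi (0 : ℝ) from mul_pos hy0 hr0),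
      ← ENNReal.ofReal_mul hy0.le, ← ENNReal.ofReal_mul (by positivity)]
    congr 1
    have h1 : ‖(‖y‖ * r)⁻¹ • y‖ = r⁻¹ := by
      rw [norm_smul, norm_inv, norm_mul, norm_norm, Real.norm_of_nonneg hr0.le]
      field_simp
    obtain ⟨m, rfl⟩ : ∃ m, n = m + 2 := ⟨n - 2, by omega⟩
    rw [bump, h1, Nat.add_sub_cancel, mul_inv, mul_pow]
    have : ‖y‖⁻¹ ^ (m + 2) = (‖y‖ ^ m)⁻¹ * ‖y‖⁻¹ ^ 2 := by rw [pow_add, inv_pow]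
    rw [this]
    field_simp
  · have hr' : ¬ (‖y‖ * r ∈ Ioi (0 : ℝ)) := fun h => hr (by
      have : 0 < ‖y‖ * r := h
      exact (mul_pos_iff_of_pos_left hy0).1 this)
    rw [indicator_of_notMem hr, indicator_of_notMem hr', mul_zero, mul_zero]

/-- Superposing the bump averages of `f` over all radii gives the Newton potential. -/
lemma lintegral_bump_averages (hn : 3 ≤ n) {f : Euc n → ℝ} (hf : Continuous f)
    (hf0 : ∀ y, 0 ≤ f y) (x : Euc n) :
    ∫⁻ r in Ioi (0 : ℝ), ∫⁻ z, ENNReal.ofReal (r * f (x + r • z) * bump z) =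
      newtonConst n * riesz (fun y => ENNReal.ofReal (f y)) x := by
  have hcb := continuous_bump (n := n)
  have hfm := hf.measurable
  have hbm := hcb.measurable
  have h1 : ∀ r ∈ Ioi (0 : ℝ), ∫⁻ z, ENNReal.ofReal (r * f (x + r • z) * bump z) =
      ∫⁻ y, ENNReal.ofReal (f (x + y)) * ENNReal.ofReal (r * r⁻¹ ^ n * bump (r⁻¹ • y)) := by
    intro r hr
    have hr0 : 0 < r := hr
    rw [lintegral_comp_smul_pos (g := fun z => ENNReal.ofReal (r * f (x + r • z) * bump z))
      (by fun_prop) (inv_pos.2 hr0), ← lintegral_const_mul' _ _ ENNReal.ofReal_ne_top]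
    refine lintegral_congr fun y => ?_
    rw [← ENNReal.ofReal_mul (by positivity), ← ENNReal.ofReal_mul (hf0 _), smul_smul,
      mul_inv_cancel₀ hr0.ne', one_smul]
    congr 1; ring
  have hm : Measurable (fun q : ℝ × Euc n =>
      ENNReal.ofReal (f (x + q.2)) * ENNReal.ofReal (q.1 * q.1⁻¹ ^ n * bump (q.1⁻¹ • q.2))) := by
    have h2 : Measurable fun q : ℝ × Euc n => bump (q.1⁻¹ • q.2) :=
      hbm.comp (measurable_fst.inv.smul measurable_snd)
    fun_prop
  rw [setLIntegral_congr_fun measurableSet_Ioi h1, lintegral_lintegral_swap hm.aemeasurable]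
  have h3 : ∀ᵐ y : Euc n, ∫⁻ r in Ioi (0 : ℝ),
      ENNReal.ofReal (f (x + y)) * ENNReal.ofReal (r * r⁻¹ ^ n * bump (r⁻¹ • y)) =
      newtonConst n * (ENNReal.ofReal (f (x + y)) * newtonK y) := by
    filter_upwards [ae_ne_point hn 0] with y hy
    rw [lintegral_const_mul' _ _ ENNReal.ofReal_ne_top, lintegral_bump_dilations hn hy,
      mul_left_comm]
  rw [lintegral_congr_ae h3, lintegral_const_mul' _ _ (newtonConst_ne_top hn), riesz,
    ← lintegral_add_left_eq_self (fun y => ENNReal.ofReal (f y) * newtonK (x - y)) x]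
  congr 2; ext y
  simp [newtonK]

lemma integrable_mul_bumpWeight {u : Euc n → ℝ} (hu : Continuous u) (x : Euc n) (r : ℝ) :
    Integrable fun z : Euc n => u (x + r • z) * bumpWeight z :=
  integrable_mul_of_unit_ball (hu.comp (by fun_prop)) continuous_bumpWeight
    fun _ h => bumpWeight_eq_zero h

lemma weightedMean_nonneg {u : Euc n → ℝ} (hu : ∀ x, 0 ≤ u x) (x : Euc n) (r : ℝ) :
    0 ≤ weightedMean u x r :=
  integral_nonneg fun z => mul_nonneg (hu _) (bumpWeight_nonneg z)

/-- If the difference is nonzero, w lies in the ball of radius 2, where the weight dilated by 4 is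
at least 3, while the difference is at most 16 ‖h‖. The majorant is again a weight, so a shift of
the centre is controlled by a mean over a larger ball. -/
lemma abs_bumpWeight_add_sub_le {h : Euc n} (hh : ‖h‖ ≤ 1) (w : Euc n) :
    |bumpWeight (w + h) - bumpWeight w| ≤ 6 * ‖h‖ * bumpWeight ((4⁻¹ : ℝ) • w) := by
  by_cases hc : 1 ≤ ‖w‖ ∧ 1 ≤ ‖w + h‖
  · rw [bumpWeight_eq_zero hc.1, bumpWeight_eq_zero hc.2, sub_zero, abs_zero]
    exact mul_nonneg (by positivity) (bumpWeight_nonneg _)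
  · have h1 : ‖w‖ ≤ ‖w + h‖ + ‖h‖ := by simpa using norm_sub_le (w + h) h
    have h2 : ‖w + h‖ ≤ ‖w‖ + ‖h‖ := norm_add_le w h
    have h3 : ‖w‖ ≤ 2 ∧ ‖w + h‖ ≤ 2 := by
      by_cases h4 : 1 ≤ ‖w‖
      · have : ¬ 1 ≤ ‖w + h‖ := fun h5 => hc ⟨h4, h5⟩
        constructor <;> linarith
      · constructor <;> linarith
    have h5 : 3 ≤ bumpWeight ((4⁻¹ : ℝ) • w) := by
      have h6 : (3 : ℝ) / 4 ≤ max (1 - ‖(4⁻¹ : ℝ) • w‖ ^ 2) 0 := by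
        refine le_max_of_le_left ?_
        rw [norm_smul, Real.norm_of_nonneg (by norm_num)]
        nlinarith [norm_nonneg w]
      unfold bumpWeight; linarith
    have h7 : |bumpWeight (w + h) - bumpWeight w| ≤ 16 * ‖h‖ := by
      unfold bumpWeight
      rw [← mul_sub, abs_mul, abs_of_pos (by norm_num : (0 : ℝ) < 4)]
      have h8 := abs_max_sub_max_le_abs (1 - ‖w + h‖ ^ 2) (1 - ‖w‖ ^ 2) 0
      have h9 : |1 - ‖w + h‖ ^ 2 - (1 - ‖w‖ ^ 2)| ≤ 4 * ‖h‖ := by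
        rw [abs_le]
        constructor <;> nlinarith [norm_nonneg w, norm_nonneg (w + h), norm_nonneg h, h3.1, h3.2]
      linarith
    nlinarith [norm_nonneg h]

/-- A Liouville estimate: when the means about x are bounded, means about different centres differ
by O(1/R). The factor 4^n is the Jacobian of the dilation by 4. -/
lemma abs_weightedMean_sub_le {u : Euc n → ℝ} (hu : Continuous u) (hu0 : ∀ x, 0 ≤ u x)
    (x x' : Euc n) {R : ℝ} (hR : 0 < R) (hRx : ‖x' - x‖ ≤ R) :
    |weightedMean u x' R - weightedMean u x R| ≤
      6 * (‖x' - x‖ / R) * (4 ^ n * weightedMean u x (4 * R)) := by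
  set h : Euc n := -(R⁻¹ • (x' - x)) with hh
  have hnorm : ‖h‖ = ‖x' - x‖ / R := by
    rw [hh, norm_neg, norm_smul, norm_inv, Real.norm_of_nonneg hR.le]; ring
  have hh1 : ‖h‖ ≤ 1 := by rw [hnorm, div_le_one hR]; exact hRx
  have hx : ∀ w : Euc n, x' + R • (w + h) = x + R • w := fun w => by
    rw [hh, smul_add, smul_neg, smul_smul, mul_inv_cancel₀ hR.ne', one_smul]; abel
  have hi' : Integrable fun w : Euc n => u (x + R • w) * bumpWeight (w + h) := by
    simpa only [hx] using (integrable_mul_bumpWeight hu x' R).comp_add_right h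
  have h1 : weightedMean u x' R = ∫ w, u (x + R • w) * bumpWeight (w + h) := by
    rw [weightedMean, ← integral_add_right_eq_self _ h]
    simp only [hx]
  have h4 : ∀ w : Euc n, (4 * R) • (4⁻¹ : ℝ) • w = R • w := fun w => by
    rw [smul_smul]; congr 1; ring
  have hi4 : Integrable fun w : Euc n => u (x + R • w) * bumpWeight ((4⁻¹ : ℝ) • w) := by
    simpa only [h4] using (integrable_mul_bumpWeight hu x (4 * R)).comp_smul
      (R := (4⁻¹ : ℝ)) (by norm_num)
  have h2 : ∫ w, u (x + R • w) * bumpWeight ((4⁻¹ : ℝ) • w) = 4 ^ n * weightedMean u x (4 * R) := by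
    have := Measure.integral_comp_smul (volume : Measure (Euc n))
      (fun z => u (x + (4 * R) • z) * bumpWeight z) (4⁻¹ : ℝ)
    simp only [h4] at this
    rw [this, finrank_euclideanSpace_fin, smul_eq_mul, inv_pow, inv_inv,
      abs_of_pos (by positivity), weightedMean]
  rw [h1, weightedMean, ← integral_sub hi' (integrable_mul_bumpWeight hu x R), ← h2, ← hnorm,
    ← integral_const_mul]
  refine (abs_integral_le_integral_abs).trans
    (integral_mono (hi'.sub (integrable_mul_bumpWeight hu x R)).abs (hi4.const_mul _) fun w => ?_)
  simp only
  rw [← mul_sub, abs_mul, abs_of_nonneg (hu0 _), mul_left_comm]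
  exact mul_le_mul_of_nonneg_left (abs_bumpWeight_add_sub_le hh1 w) (hu0 _)

lemma integral_bumpWeight_pos : 0 < ∫ z : Euc n, bumpWeight z := by
  have hi : Integrable (bumpWeight : Euc n → ℝ) := by
    simpa using integrable_mul_of_unit_ball (continuous_const (y := (1 : ℝ)))
      (continuous_bumpWeight (n := n)) fun _ h => bumpWeight_eq_zero h
  refine continuous_bumpWeight.integral_pos_of_hasCompactSupport_nonneg_nonzero
    (HasCompactSupport.intro (isCompact_closedBall (0 : Euc n) 1) fun z hz => ?_)
    bumpWeight_nonneg (x := 0) (by simp [bumpWeight])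
  rw [mem_closedBall_zero_iff, not_le] at hz
  exact bumpWeight_eq_zero hz.le

/-- A positive superharmonic `C²` function on the whole space is a nonnegative constant plus a
multiple of the Newton potential of minus its Laplacian. -/
theorem exists_newton_representation (hn : 3 ≤ n) {u : Euc n → ℝ} (hu : ContDiff ℝ 2 u)
    (hu0 : ∀ x, 0 ≤ u x) (hΔ : ∀ x, 0 ≤ -Laplacian.laplacian u x) :
    ∃ a κ : ℝ, 0 ≤ a ∧ 0 < κ ∧ ∀ x,
      Integrable (fun y => -Laplacian.laplacian u y * newton x y) ∧
      u x = a + κ * ∫ y, -Laplacian.laplacian u y * newton x y := by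
  have hcb := continuous_bump (n := n)
  have hcL : Continuous (Laplacian.laplacian u) := by
    rw [InnerProductSpace.laplacian_eq_iteratedFDeriv_orthonormalBasis u
      (EuclideanSpace.basisFun (Fin n) ℝ)]
    have := hu.continuous_iteratedFDeriv (m := 2) (by norm_num)
    fun_prop
  set f : Euc n → ℝ := fun y => -Laplacian.laplacian u y with hf
  have hfc : Continuous f := hcL.neg
  set m : ℝ := ∫ z : Euc n, bumpWeight z with hm
  have hm0 : 0 < m := integral_bumpWeight_pos
  set J : Euc n → ℝ≥0∞ := fun x => newtonConst n * riesz (fun y => ENNReal.ofReal (f y)) x with hJ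
  set A : Euc n → ℝ → ℝ≥0∞ := fun x r =>
    ∫⁻ z, ENNReal.ofReal (r * f (x + r • z) * bump z) with hA
  -- The drop of the mean from radius 0 to k is the superposition of the bump averages of -Δu over
  -- radii up to k. As k grows it increases to J, a multiple of the Newton potential, and u ≥ 0
  -- bounds J x by u x * m.
  have hJk : ∀ x (k : ℕ), ENNReal.ofReal (u x * m - weightedMean u x k) =
      ∫⁻ r in Ioc (0 : ℝ) k, A x r := by
    intro x k
    have hG : Continuous fun q : ℝ × Euc n => q.1 * f (x + q.1 • q.2) * bump q.2 := by fun_prop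
    have hI := integrable_prod_of_unit_ball hG (fun r z h => by simp [bump_eq_zero h]) (k : ℝ)
    have h1 := weightedMean_sub hu x (Nat.cast_nonneg (α := ℝ) k)
    rw [weightedMean_zero] at h1
    have h2 : u x * m - weightedMean u x k =
        ∫ q : ℝ × Euc n, q.1 * f (x + q.1 • q.2) * bump q.2
          ∂((volume.restrict (Ioc 0 (k : ℝ))).prod volume) := by
      rw [← neg_sub, h1, ← integral_neg]
      refine integral_congr_ae (Eventually.of_forall fun q => ?_)
      simp only [hf]; ring
    have hae : ∀ᵐ q : ℝ × Euc n ∂((volume.restrict (Ioc 0 (k : ℝ))).prod volume),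
        0 ≤ q.1 * f (x + q.1 • q.2) * bump q.2 := by
      have h3 : ∀ᵐ r : ℝ ∂(volume.restrict (Ioc 0 (k : ℝ))), 0 < r :=
        (ae_restrict_mem measurableSet_Ioc).mono fun r hr => hr.1
      filter_upwards [Measure.quasiMeasurePreserving_fst.ae h3] with q hq
      exact mul_nonneg (mul_nonneg hq.le (hΔ _)) (bump_nonneg _)
    rw [h2, ofReal_integral_eq_lintegral_ofReal hI hae, lintegral_prod _ (by fun_prop)]
  have hunion : ⋃ k : ℕ, Ioc (0 : ℝ) k = Ioi 0 := by
    ext r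
    simp only [mem_iUnion, mem_Ioc, mem_Ioi]
    exact ⟨fun ⟨k, h⟩ => h.1, fun h => ⟨⌈r⌉₊, h, Nat.le_ceil r⟩⟩
  have hmono : Monotone fun k : ℕ => Ioc (0 : ℝ) k := fun i j hij =>
    Ioc_subset_Ioc_right (by exact_mod_cast hij)
  have hJsup : ∀ x, J x = ⨆ k : ℕ, ENNReal.ofReal (u x * m - weightedMean u x k) := by
    intro x
    simp only [hJk]
    rw [← setLIntegral_iUnion_of_directed _ hmono.directed_le, hunion]
    exact (lintegral_bump_averages hn hfc hΔ x).symm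
  have hJtop : ∀ x, J x ≠ ⊤ := fun x => by
    rw [hJsup]
    refine ne_top_of_le_ne_top (ENNReal.ofReal_ne_top (r := u x * m)) (iSup_le fun k => ?_)
    exact ENNReal.ofReal_le_ofReal (by linarith [weightedMean_nonneg hu0 x k])
  have hle : ∀ x (k : ℕ), weightedMean u x k ≤ u x * m := by
    intro x k
    have h1 := weightedMean_sub hu x (Nat.cast_nonneg (α := ℝ) k)
    rw [weightedMean_zero] at h1
    have h2 : ∫ q : ℝ × Euc n, q.1 * Laplacian.laplacian u (x + q.1 • q.2) * bump q.2
        ∂((volume.restrict (Ioc 0 (k : ℝ))).prod volume) ≤ 0 := by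
      refine integral_nonpos_of_ae ?_
      have h3 : ∀ᵐ r : ℝ ∂(volume.restrict (Ioc 0 (k : ℝ))), 0 < r :=
        (ae_restrict_mem measurableSet_Ioc).mono fun r hr => hr.1
      filter_upwards [Measure.quasiMeasurePreserving_fst.ae h3] with q hq
      have := mul_nonneg (mul_nonneg hq.le (hΔ (x + q.1 • q.2))) (bump_nonneg q.2)
      simp only [Pi.zero_apply]; linarith
    linarith
  have hlim : ∀ x, Tendsto (fun k : ℕ => weightedMean u x k) atTop
      (𝓝 (u x * m - (J x).toReal)) := by
    intro x
    have h1 : Monotone fun k : ℕ => ENNReal.ofReal (u x * m - weightedMean u x k) := by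
      simp only [hJk]
      exact fun i j hij => lintegral_mono_set (hmono hij)
    have h2 := (ENNReal.tendsto_toReal (hJtop x)).comp ((hJsup x) ▸ tendsto_atTop_iSup h1)
    have h3 := h2.const_sub (u x * m)
    refine h3.congr fun k => ?_
    rw [Function.comp_apply, ENNReal.toReal_ofReal (by linarith [hle x k])]; ring
  -- The means about x and about 0 have the same limit, by the Liouville estimate with means about 0
  -- bounded by u 0 * m. Divided by m, this limit is the additive constant.
  have hconst : ∀ x, u x * m - (J x).toReal = u 0 * m - (J 0).toReal := by
    intro x
    have h1 := (hlim x).sub (hlim 0)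
    have h2 : Tendsto (fun k : ℕ => weightedMean u x k - weightedMean u 0 k) atTop (𝓝 0) := by
      have h3 : Tendsto (fun k : ℕ => 6 * (‖x - 0‖ / (k : ℝ)) * (4 ^ n * (u 0 * m))) atTop
          (𝓝 (6 * 0 * (4 ^ n * (u 0 * m)))) :=
        ((tendsto_const_div_atTop_nhds_zero_nat ‖x - 0‖).const_mul 6).mul_const _
      rw [mul_zero, zero_mul] at h3
      refine squeeze_zero_norm' ?_ h3
      filter_upwards [eventually_ge_atTop (max 1 ⌈‖x - 0‖⌉₊)] with k hk
      have hk1 : (1 : ℝ) ≤ k := by exact_mod_cast (le_max_left _ _).trans hk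
      have hkx : ‖x - 0‖ ≤ k := (Nat.le_ceil _).trans (by exact_mod_cast (le_max_right _ _).trans hk)
      refine (abs_weightedMean_sub_le hu.continuous hu0 0 x (by linarith) hkx).trans ?_
      have h4 := hle 0 (4 * k)
      push_cast at h4
      gcongr
    have := tendsto_nhds_unique h1 h2
    linarith
  have hc0 : 0 < (newtonConst n).toReal :=
    ENNReal.toReal_pos newtonConst_ne_zero (newtonConst_ne_top hn)
  refine ⟨(u 0 * m - (J 0).toReal) / m, (newtonConst n).toReal / m, ?_, by positivity, fun x => ?_⟩
  · exact div_nonneg (ge_of_tendsto' (hlim 0) fun k => weightedMean_nonneg hu0 0 k) hm0.le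
  · have h0 : ∀ y, 0 ≤ f y * newton x y := fun y => mul_nonneg (hΔ y) (newton_nonneg x y)
    have hmeas : AEStronglyMeasurable (fun y => f y * newton x y) volume :=
      (hfc.measurable.mul (measurable_newton_right x)).aestronglyMeasurable
    have hriesz : riesz (fun y => ENNReal.ofReal (f y)) x =
        ∫⁻ y, ENNReal.ofReal (f y * newton x y) := by
      refine lintegral_congr fun y => ?_
      rw [ENNReal.ofReal_mul (hΔ y)]; rfl
    have hfin : ∫⁻ y, ENNReal.ofReal (f y * newton x y) ≠ ⊤ := by
      rw [← hriesz]
      intro h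
      exact hJtop x (by simp only [hJ, h]; exact ENNReal.mul_top newtonConst_ne_zero)
    refine ⟨⟨hmeas, (hasFiniteIntegral_iff_ofReal (Eventually.of_forall h0)).2
      (lt_top_iff_ne_top.2 hfin)⟩, ?_⟩
    have h1 : (J x).toReal = (newtonConst n).toReal * ∫ y, f y * newton x y := by
      rw [integral_eq_lintegral_of_nonneg_ae (Eventually.of_forall h0) hmeas, ← hriesz,
        ← ENNReal.toReal_mul]
    have h2 := hconst x
    rw [h1] at h2
    change u x = _ + _ * ∫ y, f y * newton x y
    rw [← h2]
    field_simp
    ring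

end Representation

/-! ### Classical solutions and the conclusion -/

namespace IsPositiveClassicalSolution

variable {n : ℕ} {p : ℝ} {u v : Euc n → ℝ}

/-- Classical solutions solve an integral system with nonnegative additive constants. -/
theorem exists_isPotentialPair (hn : 3 ≤ n) (hp : 1 < p) (h : IsPositiveClassicalSolution n p u v) :
    ∃ a b c d : ℝ, IsPotentialPair n p a b c d u v := by
  have hs : 0 < √p := Real.sqrt_pos.2 (by linarith)
  have hpow : ∀ y, u y ^ p = u y ^ (p - 1) * u y := fun y => by
    rw [Real.rpow_sub_one (h.pos_left y).ne', div_mul_cancel₀ _ (h.pos_left y).ne']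
  have hup : ∀ y, 0 ≤ u y ^ (p - 1) := fun y => Real.rpow_nonneg (h.pos_left y).le _
  obtain ⟨a, κ, ha, hκ, hl⟩ := exists_newton_representation hn h.contDiff_left
    (fun x => (h.pos_left x).le) fun x => by
      rw [h.eq_left x]; exact mul_nonneg hs.le (mul_nonneg (hup x) (h.pos_right x).le)
  obtain ⟨b, μ, hb, hμ, hr⟩ := exists_newton_representation hn h.contDiff_right
    (fun x => (h.pos_right x).le) fun x => by
      rw [h.eq_right x, hpow]; exact mul_nonneg hs.le (mul_nonneg (hup x) (h.pos_left x).le)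
  simp only [h.eq_left, h.eq_right, hpow, mul_assoc, integral_const_mul,
    integrable_const_mul_iff hs.ne'.isUnit] at hl hr
  exact ⟨a, b, κ * √p, μ * √p,
    { nonneg_a := ha
      nonneg_b := hb
      pos_c := by positivity
      pos_d := by positivity
      continuous_left := h.contDiff_left.continuous
      continuous_right := h.contDiff_right.continuous
      pos_left := h.pos_left
      pos_right := h.pos_right
      integrable_left := fun x => by simpa only [mul_assoc] using (hl x).1
      integrable_right := fun x => by simpa only [mul_assoc] using (hr x).1
      eq_left := fun x => by simpa only [mul_assoc] using (hl x).2
      eq_right := fun x => by simpa only [mul_assoc] using (hr x).2 }⟩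

/-- Classical solutions are continuous from the outset, so the Newton representation leads straight
to the moving spheres. -/
theorem false_of_subcritical (hn : 3 ≤ n) (hp : 1 < p)
    (hp' : p < 2 * (n : ℝ) / ((n : ℝ) - 2) - 1) (h : IsPositiveClassicalSolution n p u v) :
    False := by
  obtain ⟨a, b, c, d, hP⟩ := h.exists_isPotentialPair hn hp
  exact hP.elim hn hp (scalingDefect_pos hn hp')

end IsPositiveClassicalSolution

theorem theorem1p1 (n : ℕ) (hn : 3 ≤ n) (p : ℝ) (hp : 1 < p) :
    (p ≤ (n : ℝ) / ((n : ℝ) - 2) →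
      (¬ ∃ u v : EuclideanSpace ℝ (Fin n) → ℝ, IsPositiveClassicalSolution n p u v) ∧
      (∀ c₁ c₂ : ℝ, 0 < c₁ → 0 < c₂ →
        ¬ ∃ u v : EuclideanSpace ℝ (Fin n) → ℝ, IsPositiveIntegralSolution n p c₁ c₂ u v)) ∧
    (2 ≤ p → p < 2 * (n : ℝ) / ((n : ℝ) - 2) - 1 →
      (¬ ∃ u v : EuclideanSpace ℝ (Fin n) → ℝ, IsPositiveClassicalSolution n p u v ∧
        MeasureTheory.MemLp u (ENNReal.ofReal ((n : ℝ) * (p - 1) / 2)) MeasureTheory.volume) ∧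
      (∀ c₁ c₂ : ℝ, 0 < c₁ → 0 < c₂ →
        ¬ ∃ u v : EuclideanSpace ℝ (Fin n) → ℝ, IsPositiveIntegralSolution n p c₁ c₂ u v ∧
          MeasureTheory.MemLp u (ENNReal.ofReal ((n : ℝ) * (p - 1) / 2))
            MeasureTheory.volume)) := by
  -- This places the range of part (1) within the subcritical range, where moving spheres exclude
  -- classical solutions.
  have hlt : (n : ℝ) / ((n : ℝ) - 2) < 2 * (n : ℝ) / ((n : ℝ) - 2) - 1 := by
    have hn0 : (3 : ℝ) ≤ n := by exact_mod_cast hn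
    have hn2 : (0 : ℝ) < (n : ℝ) - 2 := by linarith
    have h1 : 1 < (n : ℝ) / (n - 2) := by rw [one_lt_div hn2]; linarith
    rw [mul_div_assoc]; linarith
  refine ⟨fun hple => ⟨?_, ?_⟩, fun _ hplt => ⟨?_, ?_⟩⟩
  · rintro ⟨u, v, h⟩
    exact h.false_of_subcritical hn hp (hple.trans_lt hlt)
  · rintro c₁ c₂ hc₁ hc₂ ⟨u, v, h⟩
    exact h.false_of_le hn hp hple hc₁ hc₂
  · rintro ⟨u, v, h, -⟩
    exact h.false_of_subcritical hn hp hplt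
  · rintro c₁ c₂ hc₁ hc₂ ⟨u, v, h, hL⟩
    exact h.false_of_memLp hn hp hplt hc₁ hc₂ hL
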